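/- Let $(M,g)$ be a compact smooth Riemannian $4$-manifold without boundary (hence of bounded geometry), and let $\omega',\omega''$ be two parallel calibrating $2$-forms on $M$ (i.e. $\nabla\omega=0$, $d\omega=0$, and at every point the comass $\max\{\omega(u,v): u,v \text{ orthonormal}\}$ equals $1$) such that $\omega'\wedge\omega'$ and $\omega''\wedge\omega''$ determine opposite orientations of $M$, i.e. they vanish nowhere and have opposite signs at every point. Then there is a constant $\epsilon\in(0,1)$, depending only on $(M,g,\omega',\omega'')$, such that for every $A_0\ge 0$ there is a constant $C$, depending only on $(M,g,\omega',\omega'')$ and $A_0$, with the following property. Let $\Sigma$ be a compact oriented surface without boundary, let $T>0$, and let $F:\Sigma\times[0,T]\to M$ be a smooth mean curvature flow, i.e. each $F_t=F(\cdot,t)$ is an immersion and $\partial F/\partial t=H$, the mean curvature vector of $F_t$. Suppose that the second fundamental form $A$ satisfies $|A|\le A_0$ on $\Sigma$ at $t=0$, and that $$ *\omega'>1-\epsilon \quad\text{and}\quad *\omega''>1-\epsilon \quad\text{on } F_t(\Sigma) \text{ for all } t\in[0,T], $$ where $*\omega$ is the value of $\omega$ on a positively oriented orthonormal basis of the tangent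 plane of $F_t(\Sigma)$. Then $|A|\le C$ on $\Sigma\times[0,T]$. In particular the bound does not depend on $T$. -/

import Mathlib

open scoped Manifold ContDiff Matrix

noncomputable section

namespace SurfaceMCF

/-- Coordinate space `ℝⁿ`. -/
abbrev E (n : ℕ) := EuclideanSpace ℝ (Fin n)

/-- The `i`-th coordinate vector `∂ᵢ` of `ℝⁿ`. -/
def dir {n : ℕ} (i : Fin n) : E n := EuclideanSpace.single i 1

/-! ### Local geometry in coordinates

`G y a b` is the value at `y` of a metric on (an open subset of) `ℝᵐ` on the vectors `a`, `b`;
`f : ℝ² → ℝᵐ` is a parametrised surface. -/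

section Local

variable {m : ℕ} (G : E m → E m → E m → ℝ) (f : E 2 → E m)

/-- The matrix `G_{AB}` of the metric. -/
def metricMatrix (y : E m) : Matrix (Fin m) (Fin m) ℝ :=
  Matrix.of fun A B => G y (dir A) (dir B)

/-- Christoffel symbol of the first kind:
`⟨∇_a b, c⟩ = ½ (∂_a G(b,c) + ∂_b G(a,c) - ∂_c G(a,b))` for constant vectors `a, b, c`. -/
def christoffelLower (y a b c : E m) : ℝ :=
  (fderiv ℝ (fun z => G z b c) y a + fderiv ℝ (fun z => G z a c) y b
    - fderiv ℝ (fun z => G z a b) y c) / 2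

/-- Levi-Civita connection on constant vector fields: `Γ_y(a,b) = ∇_a b`. -/
def christoffel (y a b : E m) : E m :=
  ∑ C, (∑ D, (metricMatrix G y)⁻¹ C D * christoffelLower G y a b (dir D)) • dir C

/-- The covariant derivative `(∇_c W)(a,b)` of a bilinear form `W` for the metric `G`. -/
def covDerivForm (W : E m → E m → E m → ℝ) (y c a b : E m) : ℝ :=
  fderiv ℝ (fun z => W z a b) y c
    - W y (christoffel G y c a) b - W y a (christoffel G y c b)

/-- The exterior derivative `dW(a,b,c)` of a two-form `W`. -/
def extDerivForm (W : E m → E m → E m → ℝ) (y a b c : E m) : ℝ :=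
  fderiv ℝ (fun z => W z b c) y a + fderiv ℝ (fun z => W z c a) y b
    + fderiv ℝ (fun z => W z a b) y c

/-- `∂ᵢ f`. -/
def pd (z : E 2) (i : Fin 2) : E m := fderiv ℝ f z (dir i)

/-- The induced metric `g_{ij} = ⟨∂ᵢ f, ∂ⱼ f⟩`. -/
def gram (z : E 2) : Matrix (Fin 2) (Fin 2) ℝ :=
  Matrix.of fun i j => G (f z) (pd f z i) (pd f z j)

/-- Normal projection `v^N = v - g^{kl} ⟨v, ∂ₖ f⟩ ∂ₗ f`. -/
def normalPart (z : E 2) (v : E m) : E m :=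
  v - ∑ k, ∑ l, ((gram G f z)⁻¹ k l * G (f z) v (pd f z k)) • pd f z l

/-- The ambient covariant derivative `∇̄_{∂ᵢ} ∂ⱼ f = ∂ᵢ∂ⱼ f + Γ(∂ᵢ f, ∂ⱼ f)`. -/
def ambientHess (z : E 2) (i j : Fin 2) : E m :=
  fderiv ℝ (fun w => pd f w j) z (dir i) + christoffel G (f z) (pd f z i) (pd f z j)

/-- The second fundamental form `A(∂ᵢ, ∂ⱼ) = (∇̄_{∂ᵢ} ∂ⱼ f)^N`. -/
def sff (z : E 2) (i j : Fin 2) : E m := normalPart G f z (ambientHess G f z i j)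

/-- The mean curvature vector `H = g^{kl} A(∂ₖ, ∂ₗ)`. -/
def meanCurv (z : E 2) : E m := ∑ k, ∑ l, (gram G f z)⁻¹ k l • sff G f z k l

/-- `|A|² = g^{ij} g^{kl} ⟨A(∂ᵢ, ∂ₖ), A(∂ⱼ, ∂ₗ)⟩`. -/
def sffNormSq (z : E 2) : ℝ :=
  ∑ i, ∑ j, ∑ k, ∑ l, (gram G f z)⁻¹ i j * (gram G f z)⁻¹ k l
    * G (f z) (sff G f z i k) (sff G f z j l)

/-- `α(∂₁ f, ∂₂ f) / √det g`: the Hodge star of `f^* α` when `∂₁, ∂₂` is positively oriented. -/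
def starPullback (W : E m → E m → E m → ℝ) (z : E 2) : ℝ :=
  W (f z) (pd f z 0) (pd f z 1) / Real.sqrt (gram G f z).det

end Local

/-! ### Tensors on manifolds -/

section Manifold

variable {n : ℕ} {X : Type*} [TopologicalSpace X] [ChartedSpace (E n) X]

/-- The expression at `y ∈ ℝⁿ` of a field `β` of bilinear forms in the chart around `q`. -/
def coordForm
    (β : ∀ p : X, TangentSpace 𝓘(ℝ, E n) p →L[ℝ] TangentSpace 𝓘(ℝ, E n) p →L[ℝ] ℝ)
    (q : X) (y a b : E n) : ℝ :=
  β ((extChartAt 𝓘(ℝ, E n) q).symm y)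
    (mfderiv 𝓘(ℝ, E n) 𝓘(ℝ, E n) (extChartAt 𝓘(ℝ, E n) q).symm y a)
    (mfderiv 𝓘(ℝ, E n) 𝓘(ℝ, E n) (extChartAt 𝓘(ℝ, E n) q).symm y b)

variable (n X) in
/-- Smooth differential two-forms. -/
structure TwoForm [IsManifold 𝓘(ℝ, E n) ∞ X] where
  val (p : X) : TangentSpace 𝓘(ℝ, E n) p →L[ℝ] TangentSpace 𝓘(ℝ, E n) p →L[ℝ] ℝ
  alternating (p : X) (v : TangentSpace 𝓘(ℝ, E n) p) : val p v v = 0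
  smooth : ContMDiff 𝓘(ℝ, E n) (𝓘(ℝ, E n).prod 𝓘(ℝ, E n →L[ℝ] E n →L[ℝ] ℝ)) ∞
    (fun p => Bundle.TotalSpace.mk' (E n →L[ℝ] E n →L[ℝ] ℝ)
      (E := fun p : X => TangentSpace 𝓘(ℝ, E n) p →L[ℝ] TangentSpace 𝓘(ℝ, E n) p →L[ℝ] ℝ)
      p (val p))

variable (n X) in
/-- Smooth Riemannian metrics. -/
abbrev Metric [IsManifold 𝓘(ℝ, E n) ∞ X] :=
  Bundle.ContMDiffRiemannianMetric 𝓘(ℝ, E n) ∞ (E n)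
    (fun p : X => TangentSpace 𝓘(ℝ, E n) p)

variable [IsManifold 𝓘(ℝ, E n) ∞ X]

/-- `∇α = 0`. -/
def TwoForm.IsParallel (g : Metric n X) (α : TwoForm n X) : Prop :=
  ∀ q : X, ∀ y ∈ (extChartAt 𝓘(ℝ, E n) q).target, ∀ c a b : E n,
    covDerivForm (coordForm g.inner q) (coordForm α.val q) y c a b = 0

/-- `dα = 0`. -/
def TwoForm.IsClosed (α : TwoForm n X) : Prop :=
  ∀ q : X, ∀ y ∈ (extChartAt 𝓘(ℝ, E n) q).target, ∀ a b c : E n,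
    extDerivForm (coordForm α.val q) y a b c = 0

/-- The comass of `α` at `p` is `c`: the maximum of `α` over oriented orthonormal pairs. -/
def TwoForm.HasComassAt (g : Metric n X) (α : TwoForm n X) (p : X) (c : ℝ) : Prop :=
  IsGreatest {r : ℝ | ∃ u v : TangentSpace 𝓘(ℝ, E n) p,
    g.inner p u u = 1 ∧ g.inner p v v = 1 ∧ g.inner p u v = 0 ∧ r = α.val p u v} c

/-- A calibrating two-form: closed and of comass one. -/
structure TwoForm.IsCalibrating (g : Metric n X) (α : TwoForm n X) : Prop where
  closed : α.IsClosed
  comass (p : X) : α.HasComassAt g p 1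

/-- The four-form `α ∧ α`. -/
def TwoForm.wedgeSq (α : TwoForm n X) (p : X) (e : Fin 4 → TangentSpace 𝓘(ℝ, E n) p) : ℝ :=
  2 * (α.val p (e 0) (e 1) * α.val p (e 2) (e 3) - α.val p (e 0) (e 2) * α.val p (e 1) (e 3)
    + α.val p (e 0) (e 3) * α.val p (e 1) (e 2))

end Manifold

/-- On a four-manifold, `ω' ∧ ω'` and `ω'' ∧ ω''` vanish nowhere and determine opposite
orientations: they have opposite signs on every basis of every tangent space. -/
def OppositeOrientations {M : Type*} [TopologicalSpace M] [ChartedSpace (E 4) M]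
    [IsManifold 𝓘(ℝ, E 4) ∞ M] (ω' ω'' : TwoForm 4 M) : Prop :=
  ∀ (p : M) (e : Fin 4 → TangentSpace 𝓘(ℝ, E 4) p), LinearIndependent ℝ e →
    ω'.wedgeSq p e * ω''.wedgeSq p e < 0

/-- An orientation of a surface, represented by a nowhere vanishing two-form. -/
def IsOrientationForm {S : Type*} [TopologicalSpace S] [ChartedSpace (E 2) S]
    [IsManifold 𝓘(ℝ, E 2) ∞ S] (μ : TwoForm 2 S) : Prop :=
  ∀ x : S, μ.val x ≠ 0

/-! ### Immersed surfaces and mean curvature flow -/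

section Flow

variable {M : Type*} [TopologicalSpace M] [ChartedSpace (E 4) M] [IsManifold 𝓘(ℝ, E 4) ∞ M]
  {S : Type*} [TopologicalSpace S] [ChartedSpace (E 2) S] [IsManifold 𝓘(ℝ, E 2) ∞ S]

/-- The expression of `F : S → M` in the charts around `p : S` and `q : M`. -/
def coordMap (F : S → M) (p : S) (q : M) (z : E 2) : E 4 :=
  extChartAt 𝓘(ℝ, E 4) q (F ((extChartAt 𝓘(ℝ, E 2) p).symm z))

/-- The norm `|A|` of the second fundamental form of `F` at `x`, computed in the charts
around `x` and `F x`. -/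
def normA (g : Metric 4 M) (F : S → M) (x : S) : ℝ :=
  Real.sqrt (sffNormSq (coordForm g.inner (F x)) (coordMap F x (F x))
    (extChartAt 𝓘(ℝ, E 2) x x))

/-- The function `*(F^* α)` at `x`, where `*` is the Hodge star of the metric `F^* g` and the
orientation given by `μ`. -/
def hodgeStar (g : Metric 4 M) (α : TwoForm 4 M) (μ : TwoForm 2 S) (F : S → M) (x : S) : ℝ :=
  (SignType.sign (coordForm μ.val x (extChartAt 𝓘(ℝ, E 2) x x) (dir 0) (dir 1)) : ℝ)
    * starPullback (coordForm g.inner (F x)) (coordMap F x (F x)) (coordForm α.val (F x))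
        (extChartAt 𝓘(ℝ, E 2) x x)

/-- `F` is a smooth mean curvature flow of immersions `F t : S → M`, `t ∈ [0,T]`: in all charts
the velocity `∂F/∂t` is the mean curvature vector (one-sided derivatives at `0` and `T`). -/
structure IsMeanCurvatureFlow (g : Metric 4 M) (T : ℝ) (F : ℝ → S → M) : Prop where
  smooth : ContMDiffOn (𝓘(ℝ, ℝ).prod 𝓘(ℝ, E 2)) 𝓘(ℝ, E 4) ∞
    (fun tx : ℝ × S => F tx.1 tx.2) (Set.Icc 0 T ×ˢ Set.univ)
  immersion : ∀ t ∈ Set.Icc 0 T, ∀ x : S,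
    Function.Injective (mfderiv 𝓘(ℝ, E 2) 𝓘(ℝ, E 4) (F t) x)
  flow : ∀ t ∈ Set.Icc 0 T, ∀ (p x : S) (q : M),
    x ∈ (extChartAt 𝓘(ℝ, E 2) p).source → F t x ∈ (extChartAt 𝓘(ℝ, E 4) q).source →
    HasDerivWithinAt (fun s => extChartAt 𝓘(ℝ, E 4) q (F s x))
      (meanCurv (coordForm g.inner q) (coordMap (F t) p q) (extChartAt 𝓘(ℝ, E 2) p x))
      (Set.Icc 0 T) t

end Flow

end SurfaceMCF

end

/-! The maximum principle is applied to |A|² exp(-pη), where η = *ω' + *ω''. By itself (∂ₜ - Δ)|A|²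
is bounded only by a quartic expression in |A|, which does not exclude blow-up. The quartic term is
beaten because (∂ₜ - Δ)η ≥ c|A|² - C as long as the tangent planes are close to planes calibrated by
both forms.

The opposite orientations give this inequality. At a plane calibrated by both forms, comass one
forces the normal form e¹∧e² + λ e³∧e⁴ with |λ| ≤ 1, and the two values λ', λ'' have opposite signs.
On the graph of slope P over that plane, η equals (2 + (λ' + λ'') det P) / √(1 + |P|² + (det P)²)
with |λ' + λ''| ≤ 1. Hence η ≤ 2 - |P|²/4 for small P (`sum_starA_slope_le`), so η is strictly
concave in the slope. For λ' = λ'' = 1 it would be constant along complex lines. The same sign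
condition makes the common calibrated plane at a point unique (`planeJet_of_calibrated`).

At a maximum of |A|² exp(-pη) over past times, 0 ≤ (∂ₜ - Δ)|A|² - |A|² (p (∂ₜ - Δ)η - p² |∇η|²).
First p is taken large, so that p c exceeds the quartic constant. Then the planes are required to be
so nearly calibrated that the derivative of η in the jet is at most δ, with δ depending on p; this
is possible because η is maximal at calibrated planes (`exists_norm_fderiv_le`). The term p²|∇η|² is
then harmless and |A|² is bounded at the maximum (`algebraic_bound`, `exists_bound_at_max`). Since ε
is chosen after p and before any flow, it does not see A₀.

The evolution inequalities are obtained without tensor calculus on the surface. Near the maximum the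
flow is written as a moving graph over the calibrated plane (`exists_graph_solution`). The height u
solves a quasilinear parabolic system whose coefficients depend on the first jet of u; |A|² is a
quadratic form Q in V = D²u + β(jet), and η is a function of the jet. The inequalities (`heat_Q_le`,
`le_heat_eta`) then follow from the chain rule and from bounds on the coefficients over a compact
set of jets.

Independence of the charts (`sffNormSq_chart`, `abs_starPullback_chart`), compactness of the set of
planes (`exists_nearly_calibrated_mem`) and a finite cover of M (`exists_uniform_estimate`) make the
constants uniform. The maximum over [0,t] × S then gives the bound at all times
(`IsMeanCurvatureFlow.normSqA_le`). -/

noncomputable section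

namespace SurfaceMCF

/-! ### Iterated directional derivatives -/

section Calculus

variable {X Y W : Type*} [NormedAddCommGroup X] [NormedSpace ℝ X]
  [NormedAddCommGroup Y] [NormedSpace ℝ Y] [NormedAddCommGroup W] [NormedSpace ℝ W]

/-- The derivative of `f` in the constant direction `v`. -/
def pder (v : X) (f : X → Y) (x : X) : Y := fderiv ℝ f x v

theorem pder_def (v : X) (f : X → Y) (x : X) : pder v f x = fderiv ℝ f x v := rfl

theorem differentiableAt_of_contDiffAt_two {f : X → Y} {x : X} (hf : ContDiffAt ℝ 2 f x) :
    DifferentiableAt ℝ f x := hf.differentiableAt (by norm_num)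

theorem differentiableAt_fderiv {f : X → Y} {x : X} (hf : ContDiffAt ℝ 2 f x) :
    DifferentiableAt ℝ (fderiv ℝ f) x :=
  (hf.fderiv_right (m := 1) (by norm_num)).differentiableAt (by norm_num)

theorem eventually_contDiffAt_two {f : X → Y} {x : X} (hf : ContDiffAt ℝ 2 f x) :
    ∀ᶠ z in nhds x, ContDiffAt ℝ 2 f z :=
  hf.eventually (by simp)

theorem pder_pder_eq {f : X → Y} {x : X} (hf : ContDiffAt ℝ 2 f x) (a b : X) :
    pder a (pder b f) x = fderiv ℝ (fderiv ℝ f) x a b := by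
  have h := differentiableAt_fderiv hf
  change fderiv ℝ (fun w => fderiv ℝ f w b) x a = _
  rw [fderiv_clm_apply h (differentiableAt_const b)]
  simp

theorem pder_pder_comm {f : X → Y} {x : X} (hf : ContDiffAt ℝ 2 f x) (a b : X) :
    pder a (pder b f) x = pder b (pder a f) x := by
  rw [pder_pder_eq hf, pder_pder_eq hf]
  exact (hf.isSymmSndFDerivAt (by simp)) a b

theorem pder_comp {g : Y → W} {f : X → Y} {x : X} (hg : DifferentiableAt ℝ g (f x))
    (hf : DifferentiableAt ℝ f x) (a : X) :
    pder a (fun z => g (f z)) x = fderiv ℝ g (f x) (pder a f x) := by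
  have := fderiv_comp x hg hf
  simp only [pder]
  rw [show (fun z => g (f z)) = g ∘ f from rfl, this]
  rfl

/-- Second-order chain rule. In the application to η, the Hessian term carries the concavity and the
gradient term is made small. -/
theorem pder_pder_comp {g : Y → W} {f : X → Y} {x : X} (hg : ContDiffAt ℝ 2 g (f x))
    (hf : ContDiffAt ℝ 2 f x) (a b : X) :
    pder a (pder b (fun z => g (f z))) x =
      pder (pder a f x) (pder (pder b f x) g) (f x)
        + fderiv ℝ g (f x) (pder a (pder b f) x) := by
  have hev : pder b (fun z => g (f z)) =ᶠ[nhds x] fun z => fderiv ℝ g (f z) (fderiv ℝ f z b) := by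
    have h1 := eventually_contDiffAt_two hf
    have h2 := hf.continuousAt.eventually (eventually_contDiffAt_two hg)
    filter_upwards [h1, h2] with z hz1 hz2
    exact pder_comp (differentiableAt_of_contDiffAt_two hz2)
      (differentiableAt_of_contDiffAt_two hz1) b
  rw [pder_def a, hev.fderiv_eq, pder_pder_eq hg, pder_pder_eq hf]
  have h3 : DifferentiableAt ℝ (fun z => fderiv ℝ g (f z)) x :=
    (differentiableAt_fderiv hg).comp x (differentiableAt_of_contDiffAt_two hf)
  have h4 : DifferentiableAt ℝ (fun z => fderiv ℝ f z b) x :=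
    (differentiableAt_fderiv hf).clm_apply (differentiableAt_const b)
  rw [fderiv_clm_apply h3 h4]
  have h5 := pder_comp (differentiableAt_fderiv hg) (differentiableAt_of_contDiffAt_two hf) a
  have h6 := pder_pder_eq hf a b
  simp only [pder] at h5 h6 ⊢
  simp only [add_apply, ContinuousLinearMap.comp_apply, ContinuousLinearMap.flip_apply, h5]
  rw [add_comm, ← h6]
  rfl

theorem contDiffOn_pder {f : X → Y} {s : Set X} (hf : ContDiffOn ℝ ∞ f s) (hs : IsOpen s)
    (v : X) : ContDiffOn ℝ ∞ (pder v f) s :=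
  (hf.fderiv_of_isOpen hs (m := ∞) (by simp)).clm_apply contDiffOn_const

theorem contDiffAt_two_of_contDiffOn {f : X → Y} {s : Set X} (hf : ContDiffOn ℝ ∞ f s)
    (hs : IsOpen s) {x : X} (hx : x ∈ s) : ContDiffAt ℝ 2 f x :=
  (hf.contDiffAt (hs.mem_nhds hx)).of_le (by exact WithTop.coe_le_coe.2 le_top)

theorem pder_congr_of_eqOn {f g : X → Y} {s : Set X} (hs : IsOpen s) (h : Set.EqOn f g s)
    (v : X) : Set.EqOn (pder v f) (pder v g) s := fun x hx => by
  have : f =ᶠ[nhds x] g := Filter.eventuallyEq_of_mem (hs.mem_nhds hx) h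
  simp [pder, this.fderiv_eq]

theorem pder_pder_comm_on {f : X → Y} {s : Set X} (hf : ContDiffOn ℝ ∞ f s)
    (hs : IsOpen s) (a b : X) : Set.EqOn (pder a (pder b f)) (pder b (pder a f)) s :=
  fun _ hx => pder_pder_comm (contDiffAt_two_of_contDiffOn hf hs hx) a b

@[simp]
theorem pder_const (v : X) (c : Y) : pder v (fun _ : X => c) = fun _ => 0 := by
  funext x; simp [pder]

theorem pder_add {f g : X → Y} {x : X} (hf : DifferentiableAt ℝ f x)
    (hg : DifferentiableAt ℝ g x) (v : X) :
    pder v (fun z => f z + g z) x = pder v f x + pder v g x := by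
  simp [pder, fderiv_fun_add hf hg]

theorem pder_mul {f g : X → ℝ} {x : X} (hf : DifferentiableAt ℝ f x)
    (hg : DifferentiableAt ℝ g x) (v : X) :
    pder v (fun z => f z * g z) x = pder v f x * g x + f x * pder v g x := by
  simp [pder, fderiv_fun_mul hf hg]; ring

theorem pder_sum {ι : Type*} {s : Finset ι} {f : ι → X → Y} {x : X}
    (hf : ∀ i ∈ s, DifferentiableAt ℝ (f i) x) (v : X) :
    pder v (fun z => ∑ i ∈ s, f i z) x = ∑ i ∈ s, pder v (f i) x := by
  simp [pder, fderiv_fun_sum hf]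

theorem pder_pi {ι : Type*} [Fintype ι] {f : X → ι → Y} {x : X}
    (hf : DifferentiableAt ℝ f x) (v : X) (i : ι) :
    pder v f x i = pder v (fun z => f z i) x := by
  have := fderiv_pi (𝕜 := ℝ) (φ := fun i z => f z i) (x := x)
    (fun i => (differentiableAt_pi.1 hf) i)
  simp only [pder]
  rw [show (fun x i => f x i) = f from rfl] at this
  rw [this]; rfl

/-- The second derivative at a local maximum is nonpositive. -/
theorem pder_pder_nonpos_of_isLocalMax {f : X → ℝ} {x : X} (hf : ContDiffAt ℝ 2 f x)
    (v : X) (hmax : ∀ᶠ s in nhds (0 : ℝ), f (x + s • v) ≤ f x) :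
    pder v (pder v f) x ≤ 0 := by
  set h : ℝ → ℝ := fun s => f (x + s • v) with hh
  set c : ℝ → X := fun s => x + s • v with hc
  have hc0 : c 0 = x := by simp [hc]
  have hcd : ContDiff ℝ 2 c := by fun_prop
  have hpc : ∀ s, pder (1 : ℝ) c s = v := fun s => by
    have : HasDerivAt c v s := by
      have h := ((hasDerivAt_id s).smul_const v).const_add x
      rwa [one_smul] at h
    simpa [pder] using this.deriv
  have hf0 : ContDiffAt ℝ 2 f (c 0) := by rwa [hc0]
  have key := pder_pder_comp hf0 (hcd.contDiffAt (x := 0)) 1 1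
  have hpc' : pder (1 : ℝ) c = fun _ => v := funext hpc
  simp only [hpc', hc0] at key
  have hz : pder (1 : ℝ) (fun _ : ℝ => v) 0 = 0 := by simp [pder]
  rw [hz, map_zero, add_zero] at key
  rw [← key]
  have hd : pder (1 : ℝ) (pder (1 : ℝ) h) 0 = deriv (deriv h) 0 := by
    have : pder (1 : ℝ) h = deriv h := by ext s; simp [pder]
    rw [this]; simp [pder]
  change pder (1 : ℝ) (pder (1 : ℝ) h) 0 ≤ 0
  rw [hd]
  -- A positive second derivative would make 0 a local minimum as well, so `h` would be locally
  -- constant and its second derivative would vanish.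
  by_contra hpos
  push Not at hpos
  have h0 : h 0 = f x := by simp [hh]
  have hM : IsLocalMax h 0 := by
    filter_upwards [hmax] with s hs
    rw [h0]; exact hs
  have hm := isLocalMin_of_deriv_deriv_pos hpos hM.deriv_eq_zero
    (hf0.continuousAt.comp hcd.continuous.continuousAt)
  have hconst : h =ᶠ[nhds 0] fun _ => h 0 := by
    filter_upwards [hM, hm] with s h1 h2
    exact le_antisymm h1 h2
  have h1 : deriv h =ᶠ[nhds 0] fun _ => 0 := by
    filter_upwards [hconst.eventually_nhds] with s hs
    rw [Filter.EventuallyEq.deriv_eq hs]; simp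
  rw [h1.deriv_eq] at hpos
  simp at hpos

/-- The derivative towards a one-sided maximum is nonnegative. -/
theorem pder_nonneg_of_left_max {f : X → ℝ} {x : X} (hf : DifferentiableAt ℝ f x) (v : X)
    (hmax : ∀ᶠ s in nhdsWithin (0 : ℝ) (Set.Iic 0), f (x + s • v) ≤ f x) :
    0 ≤ pder v f x := by
  have hc : HasDerivAt (fun s : ℝ => x + s • v) v 0 := by
    simpa using ((hasDerivAt_id (0 : ℝ)).smul_const v).const_add x
  have hx : x + (0 : ℝ) • v = x := by simp
  have hd : HasDerivAt (fun s : ℝ => f (x + s • v)) (fderiv ℝ f x v) 0 := by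
    have h1 : HasFDerivAt f (fderiv ℝ f x) (x + (0 : ℝ) • v) := by rw [hx]; exact hf.hasFDerivAt
    exact h1.comp_hasDerivAt 0 hc
  have hslope := hasDerivAt_iff_tendsto_slope.1 hd
  have hle : nhdsWithin (0 : ℝ) (Set.Iio 0) ≤ nhdsWithin 0 {0}ᶜ :=
    nhdsWithin_mono _ (fun s hs => ne_of_lt hs)
  refine ge_of_tendsto (hslope.mono_left hle) ?_
  have h2 := hmax.filter_mono (nhdsWithin_mono (0 : ℝ) Set.Iio_subset_Iic_self)
  filter_upwards [h2, self_mem_nhdsWithin] with s hs hs0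
  rw [slope_def_field, hx, sub_zero]
  exact div_nonneg_of_nonpos (by linarith) (le_of_lt hs0)

end Calculus

end SurfaceMCF

end

noncomputable section

namespace SurfaceMCF

/-! ### Quasilinear parabolic systems for graphs -/

section GraphSystem

/-- Space-time `ℝ × ℝ²`. -/
abbrev SpaceTime := ℝ × E 2

/-- The time direction. -/
def vt : SpaceTime := (1, 0)

/-- The spatial coordinate directions. -/
def vs (k : Fin 2) : SpaceTime := (0, dir k)

/-- First jets `(w, u, Du)` of maps `ℝ² → ℝ²`; the last component is indexed by
direction and target coordinate. -/
abbrev Jet := E 2 × (Fin 2 → ℝ) × (Fin 2 → Fin 2 → ℝ)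

/-- The index set of the components `u^a_{ij}`, as `(i, j, a)`. -/
abbrev HessIndex := Fin 2 × Fin 2 × Fin 2

/-- The spatial first jet of `u`. -/
def jet (u : Fin 2 → SpaceTime → ℝ) (z : SpaceTime) : Jet :=
  (z.2, fun a => u a z, fun i a => pder (vs i) (u a) z)

/-- The operator `∂ₜ - m^{kl} ∂ₖ ∂ₗ`. -/
def heat {W : Type*} [NormedAddCommGroup W] [NormedSpace ℝ W] (m : Fin 2 → Fin 2 → ℝ)
    (f : SpaceTime → W) (z : SpaceTime) : W :=
  pder vt f z - ∑ k, ∑ l, m k l • pder (vs k) (pder (vs l) f) z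

/-- `Ψ` and its first two derivatives are bounded by `B` on `K`. -/
structure BoundedTwo (B : ℝ) (K : Set Jet) (Ψ : Jet → ℝ) : Prop where
  val : ∀ J ∈ K, |Ψ J| ≤ B
  fst : ∀ J ∈ K, ‖fderiv ℝ Ψ J‖ ≤ B
  snd : ∀ J ∈ K, ∀ a b, |pder a (pder b Ψ) J| ≤ B * ‖a‖ * ‖b‖

/-- The coefficients of the system `∂ₜ u = g^{kl}(J) (∂ₖ∂ₗ u + β_{kl}(J))`, together with those of
the quadratic form `N(J)` in the modified second derivatives. -/
structure GraphSystem where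
  dom : Set Jet
  isOpen_dom : IsOpen dom
  gi : Fin 2 → Fin 2 → Jet → ℝ
  be : HessIndex → Jet → ℝ
  nf : HessIndex → HessIndex → Jet → ℝ
  smooth_gi : ∀ k l, ContDiffOn ℝ ∞ (gi k l) dom
  smooth_be : ∀ I, ContDiffOn ℝ ∞ (be I) dom
  smooth_nf : ∀ I I', ContDiffOn ℝ ∞ (nf I I') dom
  symm_gi : ∀ k l J, gi k l J = gi l k J
  symm_nf : ∀ I I' J, nf I I' J = nf I' I J

namespace GraphSystem

variable (Sy : GraphSystem)

/-- Second derivative component of `u`. -/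
def hess (u : Fin 2 → SpaceTime → ℝ) (I : HessIndex) : SpaceTime → ℝ :=
  pder (vs I.1) (pder (vs I.2.1) (u I.2.2))

/-- The modified second derivatives `V_{ij} = ∂ᵢ∂ⱼ u + β_{ij}(J)`. -/
def V (u : Fin 2 → SpaceTime → ℝ) (I : HessIndex) (z : SpaceTime) : ℝ :=
  hess u I z + Sy.be I (jet u z)

/-- The quadratic quantity `N(J)(V, V)`. -/
def Q (u : Fin 2 → SpaceTime → ℝ) (z : SpaceTime) : ℝ :=
  ∑ I, ∑ I', Sy.nf I I' (jet u z) * (Sy.V u I z * Sy.V u I' z)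

/-- `u` is a smooth solution of the system on the open set `O`. -/
structure IsSolution (O : Set SpaceTime) (u : Fin 2 → SpaceTime → ℝ) : Prop where
  isOpen : IsOpen O
  smooth : ∀ a, ContDiffOn ℝ ∞ (u a) O
  mem : ∀ z ∈ O, jet u z ∈ Sy.dom
  eqn : ∀ z ∈ O, ∀ a, pder vt (u a) z = ∑ k, ∑ l, Sy.gi k l (jet u z) * Sy.V u (k, l, a) z

/-- Uniform bounds for the coefficients on `K`. -/
structure Bounds (B : ℝ) (K : Set Jet) : Prop where
  one_le : 1 ≤ B
  subset : K ⊆ Sy.dom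
  norm_le : ∀ J ∈ K, ‖J‖ ≤ B
  gi : ∀ k l, BoundedTwo B K (Sy.gi k l)
  be : ∀ I, BoundedTwo B K (Sy.be I)
  nf : ∀ I I', BoundedTwo B K (Sy.nf I I')

/-- One plus the size of the second derivatives. -/
def rho (u : Fin 2 → SpaceTime → ℝ) (z : SpaceTime) : ℝ := 1 + ‖fun I => hess u I z‖

/-- The size of the third derivatives. -/
def third (u : Fin 2 → SpaceTime → ℝ) (z : SpaceTime) : ℝ :=
  ‖fun (k : Fin 2) (I : HessIndex) => pder (vs k) (hess u I) z‖

theorem one_le_rho (u : Fin 2 → SpaceTime → ℝ) (z : SpaceTime) : 1 ≤ rho u z := by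
  simp [rho]

theorem third_nonneg (u : Fin 2 → SpaceTime → ℝ) (z : SpaceTime) : 0 ≤ third u z :=
  norm_nonneg _

theorem abs_hess_le (u : Fin 2 → SpaceTime → ℝ) (z : SpaceTime) (I : HessIndex) :
    |hess u I z| ≤ rho u z := by
  have := norm_le_pi_norm (fun I => hess u I z) I
  rw [Real.norm_eq_abs] at this
  simp only [rho]; linarith

theorem abs_pder_hess_le (u : Fin 2 → SpaceTime → ℝ) (z : SpaceTime) (k : Fin 2)
    (I : HessIndex) : |pder (vs k) (hess u I) z| ≤ third u z := by
  have h1 := norm_le_pi_norm (fun (k : Fin 2) (I : HessIndex) => pder (vs k) (hess u I) z) k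
  have h2 := norm_le_pi_norm (fun (I : HessIndex) => pder (vs k) (hess u I) z) I
  rw [Real.norm_eq_abs] at h2
  exact h2.trans h1

variable {Sy} {O : Set SpaceTime} {u : Fin 2 → SpaceTime → ℝ} {B : ℝ} {K : Set Jet}
  {z : SpaceTime}

theorem IsSolution.smooth_hess (h : Sy.IsSolution O u) (I : HessIndex) :
    ContDiffOn ℝ ∞ (hess u I) O :=
  contDiffOn_pder (contDiffOn_pder (h.smooth _) h.isOpen _) h.isOpen _

theorem IsSolution.smooth_jet (h : Sy.IsSolution O u) : ContDiffOn ℝ ∞ (jet u) O := by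
  refine contDiff_snd.contDiffOn.prodMk (ContDiffOn.prodMk ?_ ?_)
  · exact contDiffOn_pi.2 fun a => h.smooth a
  · exact contDiffOn_pi.2 fun i => contDiffOn_pi.2 fun a => contDiffOn_pder (h.smooth a) h.isOpen _

theorem IsSolution.smooth_comp (h : Sy.IsSolution O u) {W : Type*} [NormedAddCommGroup W]
    [NormedSpace ℝ W] {Ψ : Jet → W} (hΨ : ContDiffOn ℝ ∞ Ψ Sy.dom) :
    ContDiffOn ℝ ∞ (fun z => Ψ (jet u z)) O :=
  hΨ.comp h.smooth_jet h.mem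

theorem IsSolution.smooth_V (h : Sy.IsSolution O u) (I : HessIndex) :
    ContDiffOn ℝ ∞ (Sy.V u I) O :=
  (h.smooth_hess I).add (h.smooth_comp (Sy.smooth_be I))

theorem pder_triple {f : SpaceTime → E 2} {p : SpaceTime → Fin 2 → ℝ}
    {q : SpaceTime → Fin 2 → Fin 2 → ℝ} (hf : DifferentiableAt ℝ f z)
    (hp : ∀ a, DifferentiableAt ℝ (fun z => p z a) z)
    (hq : ∀ i a, DifferentiableAt ℝ (fun z => q z i a) z) (v : SpaceTime) :
    pder v (fun z => ((f z, p z, q z) : Jet)) z =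
      (pder v f z, fun a => pder v (fun z => p z a) z, fun i a => pder v (fun z => q z i a) z) := by
  have h2 : DifferentiableAt ℝ p z := differentiableAt_pi.2 hp
  have h3' : ∀ i, DifferentiableAt ℝ (fun z => q z i) z := fun i => differentiableAt_pi.2 (hq i)
  have h3 : DifferentiableAt ℝ q z := differentiableAt_pi.2 h3'
  have h := (hf.hasFDerivAt.prodMk (h2.hasFDerivAt.prodMk h3.hasFDerivAt)).fderiv
  have e : pder v (fun z => ((f z, p z, q z) : Jet)) z = (pder v f z, pder v p z, pder v q z) := by
    simp only [pder]
    rw [h]; rfl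
  rw [e]
  refine Prod.ext rfl (Prod.ext ?_ ?_)
  · funext a; exact pder_pi h2 v a
  · funext i a
    change pder v q z i a = _
    rw [pder_pi h3 v i, pder_pi (h3' i) v a]

theorem differentiableAt_of_contDiffOn {W : Type*} [NormedAddCommGroup W] [NormedSpace ℝ W]
    {f : SpaceTime → W} (hf : ContDiffOn ℝ ∞ f O) (hO : IsOpen O) (hz : z ∈ O) :
    DifferentiableAt ℝ f z :=
  differentiableAt_of_contDiffAt_two (contDiffAt_two_of_contDiffOn hf hO hz)

theorem IsSolution.pder_jet (h : Sy.IsSolution O u) (v : SpaceTime) :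
    Set.EqOn (pder v (jet u)) (fun z => 
      (v.2, fun a => pder v (u a) z, fun i a => pder v (pder (vs i) (u a)) z)) O := by
  intro z hz
  have := pder_triple (z := z) (f := fun z : SpaceTime => z.2) (p := fun z a => u a z)
    (q := fun z i a => pder (vs i) (u a) z) differentiableAt_snd
    (fun a => differentiableAt_of_contDiffOn (h.smooth a) h.isOpen hz)
    (fun i a => differentiableAt_of_contDiffOn (contDiffOn_pder (h.smooth a) h.isOpen _)
      h.isOpen hz) v
  exact this.trans (Prod.ext (by simp [pder, fderiv_snd]) rfl)

theorem IsSolution.pder_pder_jet (h : Sy.IsSolution O u) (hz : z ∈ O) (v w : SpaceTime) :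
    pder v (pder w (jet u)) z =
      (0, fun a => pder v (pder w (u a)) z, fun i a => pder v (pder w (pder (vs i) (u a))) z) := by
  rw [pder_congr_of_eqOn h.isOpen (h.pder_jet w) v hz]
  have := pder_triple (z := z) (f := fun _ : SpaceTime => w.2) (p := fun z a => pder w (u a) z)
    (q := fun z i a => pder w (pder (vs i) (u a)) z) (differentiableAt_const _)
    (fun a => differentiableAt_of_contDiffOn (contDiffOn_pder (h.smooth a) h.isOpen _)
      h.isOpen hz)
    (fun i a => differentiableAt_of_contDiffOn (contDiffOn_pder
      (contDiffOn_pder (h.smooth a) h.isOpen _) h.isOpen _) h.isOpen hz) v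
  exact this.trans (Prod.ext (by simp) rfl)

theorem IsSolution.heat_jet (h : Sy.IsSolution O u) (hz : z ∈ O) (m : Fin 2 → Fin 2 → ℝ) :
    heat m (jet u) z =
      (0, fun a => heat m (u a) z, fun i a => heat m (pder (vs i) (u a)) z) := by
  simp only [heat, h.pder_pder_jet hz, h.pder_jet _ hz]
  refine Prod.ext ?_ (Prod.ext ?_ ?_)
  · simp [vt]
  · funext a; simp [Fin.sum_univ_two]
  · funext i a; simp [Fin.sum_univ_two]

/-- The matrix `m` is frozen, so no derivative falls on it. With the sign convention ∂ₜ - m∂∂, a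
concave `Ψ` contributes a nonnegative term when `m` is positive. -/
theorem heat_comp {W : Type*} [NormedAddCommGroup W] [NormedSpace ℝ W]
    {J : SpaceTime → W} {Ψ : W → ℝ} (hΨ : ContDiffAt ℝ 2 Ψ (J z)) (hJ : ContDiffAt ℝ 2 J z)
    (m : Fin 2 → Fin 2 → ℝ) :
    heat m (fun z => Ψ (J z)) z = fderiv ℝ Ψ (J z) (heat m J z)
      - ∑ k, ∑ l, m k l * pder (pder (vs k) J z) (pder (pder (vs l) J z) Ψ) (J z) := by
  simp only [heat, pder_pder_comp hΨ hJ, pder_comp (differentiableAt_of_contDiffAt_two hΨ)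
    (differentiableAt_of_contDiffAt_two hJ), map_sub, map_sum, map_smul, smul_eq_mul, mul_add,
    Finset.sum_add_distrib]
  ring

theorem heat_add {W : Type*} [NormedAddCommGroup W] [NormedSpace ℝ W] {f g : SpaceTime → W}
    (hO : IsOpen O) (hf : ContDiffOn ℝ ∞ f O)
    (hg : ContDiffOn ℝ ∞ g O) (hz : z ∈ O) (m : Fin 2 → Fin 2 → ℝ) :
    heat m (fun z => f z + g z) z = heat m f z + heat m g z := by
  have key : ∀ v, Set.EqOn (pder v (fun z => f z + g z)) (fun z => pder v f z + pder v g z) O :=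
    fun v z hz => pder_add (differentiableAt_of_contDiffOn hf hO hz)
      (differentiableAt_of_contDiffOn hg hO hz) v
  have key2 : ∀ v w, pder v (pder w (fun z => f z + g z)) z
      = pder v (pder w f) z + pder v (pder w g) z := fun v w => by
    rw [pder_congr_of_eqOn hO (key w) v hz]
    exact pder_add (differentiableAt_of_contDiffOn (contDiffOn_pder hf hO _) hO hz)
      (differentiableAt_of_contDiffOn (contDiffOn_pder hg hO _) hO hz) v
  simp only [heat, key _ hz, key2, smul_add, Finset.sum_add_distrib]
  abel

theorem pder_pder_mul {f g : SpaceTime → ℝ} (hO : IsOpen O) (hf : ContDiffOn ℝ ∞ f O)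
    (hg : ContDiffOn ℝ ∞ g O) (hz : z ∈ O) (v w : SpaceTime) :
    pder v (pder w (fun z => f z * g z)) z = pder v (pder w f) z * g z + pder w f z * pder v g z
      + pder v f z * pder w g z + f z * pder v (pder w g) z := by
  have key : Set.EqOn (pder w (fun z => f z * g z))
      (fun z => pder w f z * g z + f z * pder w g z) O :=
    fun z hz => pder_mul (differentiableAt_of_contDiffOn hf hO hz)
      (differentiableAt_of_contDiffOn hg hO hz) w
  have df := differentiableAt_of_contDiffOn hf hO hz
  have dg := differentiableAt_of_contDiffOn hg hO hz
  have df' := differentiableAt_of_contDiffOn (contDiffOn_pder hf hO w) hO hz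
  have dg' := differentiableAt_of_contDiffOn (contDiffOn_pder hg hO w) hO hz
  rw [pder_congr_of_eqOn hO key v hz, pder_add (df'.fun_mul dg) (df.fun_mul dg'), pder_mul df' dg,
    pder_mul df dg']
  ring

theorem heat_mul {f g : SpaceTime → ℝ} (hO : IsOpen O) (hf : ContDiffOn ℝ ∞ f O)
    (hg : ContDiffOn ℝ ∞ g O) (hz : z ∈ O) {m : Fin 2 → Fin 2 → ℝ} (hm : ∀ k l, m k l = m l k) :
    heat m (fun z => f z * g z) z = heat m f z * g z + f z * heat m g z
      - 2 * ∑ k, ∑ l, m k l * (pder (vs k) f z * pder (vs l) g z) := by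
  simp only [heat, pder_pder_mul hO hf hg hz, pder_mul (differentiableAt_of_contDiffOn hf hO hz)
    (differentiableAt_of_contDiffOn hg hO hz), Fin.sum_univ_two, smul_eq_mul, hm 1 0]
  ring

theorem heat_sum {ι : Type*} (s : Finset ι) {f : ι → SpaceTime → ℝ} (hO : IsOpen O)
    (hf : ∀ i, ContDiffOn ℝ ∞ (f i) O) (hz : z ∈ O) (m : Fin 2 → Fin 2 → ℝ) :
    heat m (fun z => ∑ i ∈ s, f i z) z = ∑ i ∈ s, heat m (f i) z := by
  classical
  induction s using Finset.induction_on with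
  | empty => simp [heat]
  | insert i s his ih =>
    simp only [Finset.sum_insert his]
    rw [heat_add hO (hf i) (ContDiffOn.sum fun j _ => hf j) hz, ih]

end GraphSystem

end GraphSystem

end SurfaceMCF

end

noncomputable section

namespace SurfaceMCF

/-! ### Evolution equations of u, Du, D²u and bounds for their right-hand sides. -/

section GraphEstimates

namespace GraphSystem

variable {Sy : GraphSystem} {O : Set SpaceTime} {u : Fin 2 → SpaceTime → ℝ} {B : ℝ}
  {K : Set Jet} {z : SpaceTime}

theorem pder_pder_pder_comm_on {f : SpaceTime → ℝ} (hf : ContDiffOn ℝ ∞ f O) (hO : IsOpen O)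
    (a b c : SpaceTime) :
    Set.EqOn (pder a (pder b (pder c f))) (pder c (pder a (pder b f))) O := by
  intro z hz
  rw [pder_congr_of_eqOn hO (pder_pder_comm_on hf hO b c) a hz]
  exact pder_pder_comm_on (contDiffOn_pder hf hO b) hO a c hz

theorem pder_four_comm_on {f : SpaceTime → ℝ} (hf : ContDiffOn ℝ ∞ f O) (hO : IsOpen O)
    (a b c d : SpaceTime) :
    Set.EqOn (pder a (pder b (pder c (pder d f)))) (pder c (pder d (pder a (pder b f)))) O := by
  intro z hz
  rw [pder_pder_pder_comm_on (contDiffOn_pder hf hO d) hO a b c hz]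
  exact pder_congr_of_eqOn hO (pder_pder_pder_comm_on hf hO a b d) c hz

theorem pder_pder_sum {ι : Type*} (s : Finset ι) {f : ι → SpaceTime → ℝ} (hO : IsOpen O)
    (hf : ∀ i, ContDiffOn ℝ ∞ (f i) O) (v w : SpaceTime) :
    Set.EqOn (pder v (pder w (fun z => ∑ i ∈ s, f i z)))
      (fun z => ∑ i ∈ s, pder v (pder w (f i)) z) O := by
  intro z hz
  have h1 : Set.EqOn (pder w (fun z => ∑ i ∈ s, f i z)) (fun z => ∑ i ∈ s, pder w (f i) z) O :=
    fun z hz => pder_sum (fun i _ => differentiableAt_of_contDiffOn (hf i) hO hz) w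
  rw [pder_congr_of_eqOn hO h1 v hz]
  exact pder_sum (fun i _ => differentiableAt_of_contDiffOn
    (contDiffOn_pder (hf i) hO w) hO hz) v

theorem IsSolution.pder_V (h : Sy.IsSolution O u) (v : SpaceTime) (I : HessIndex) :
    Set.EqOn (pder v (Sy.V u I))
      (fun z => pder v (hess u I) z + pder v (fun z => Sy.be I (jet u z)) z) O := fun _ hz =>
  pder_add (differentiableAt_of_contDiffOn (h.smooth_hess I) h.isOpen hz)
    (differentiableAt_of_contDiffOn (h.smooth_comp (Sy.smooth_be I)) h.isOpen hz) v

theorem IsSolution.pder_pder_V (h : Sy.IsSolution O u) (hz : z ∈ O) (v w : SpaceTime)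
    (I : HessIndex) :
    pder v (pder w (Sy.V u I)) z =
      pder v (pder w (hess u I)) z + pder v (pder w (fun z => Sy.be I (jet u z))) z := by
  rw [pder_congr_of_eqOn h.isOpen (h.pder_V w I) v hz]
  exact pder_add (differentiableAt_of_contDiffOn (contDiffOn_pder (h.smooth_hess I) h.isOpen _)
    h.isOpen hz) (differentiableAt_of_contDiffOn (contDiffOn_pder
      (h.smooth_comp (Sy.smooth_be I)) h.isOpen _) h.isOpen hz) v

/-- The equation satisfied by the solution itself. -/
theorem IsSolution.heat_self (h : Sy.IsSolution O u) (hz : z ∈ O) (a : Fin 2) :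
    heat (fun k l => Sy.gi k l (jet u z)) (u a) z =
      ∑ k, ∑ l, Sy.gi k l (jet u z) * Sy.be (k, l, a) (jet u z) := by
  simp only [heat, h.eqn z hz, V, hess, mul_add, Finset.sum_add_distrib, smul_eq_mul]
  ring

/-- The equation satisfied by the first derivatives. -/
theorem IsSolution.heat_pder (h : Sy.IsSolution O u) (hz : z ∈ O) (i a : Fin 2) :
    heat (fun k l => Sy.gi k l (jet u z)) (pder (vs i) (u a)) z =
      ∑ k, ∑ l, (pder (vs i) (fun z => Sy.gi k l (jet u z)) z * Sy.V u (k, l, a) z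
        + Sy.gi k l (jet u z) * pder (vs i) (fun z => Sy.be (k, l, a) (jet u z)) z) := by
  have h1 : pder vt (pder (vs i) (u a)) z =
      ∑ k, ∑ l, (pder (vs i) (fun z => Sy.gi k l (jet u z)) z * Sy.V u (k, l, a) z
        + Sy.gi k l (jet u z) * pder (vs i) (Sy.V u (k, l, a)) z) := by
    rw [pder_pder_comm_on (h.smooth a) h.isOpen _ _ hz,
      pder_congr_of_eqOn h.isOpen (fun z hz => h.eqn z hz a) _ hz]
    have hd : ∀ k l, DifferentiableAt ℝ
        (fun z => Sy.gi k l (jet u z) * Sy.V u (k, l, a) z) z := fun k l =>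
      differentiableAt_of_contDiffOn ((h.smooth_comp (Sy.smooth_gi k l)).mul (h.smooth_V _))
        h.isOpen hz
    rw [pder_sum (fun k _ => DifferentiableAt.fun_sum fun l _ => hd k l)]
    refine Finset.sum_congr rfl fun k _ => ?_
    rw [pder_sum (fun l _ => hd k l)]
    refine Finset.sum_congr rfl fun l _ => ?_
    exact pder_mul (differentiableAt_of_contDiffOn (h.smooth_comp (Sy.smooth_gi k l)) h.isOpen hz)
      (differentiableAt_of_contDiffOn (h.smooth_V _) h.isOpen hz) _
  simp only [heat, h1, h.pder_V _ _ hz, hess, Fin.sum_univ_two, smul_eq_mul,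
    pder_pder_pder_comm_on (h.smooth a) h.isOpen _ _ (vs i) hz]
  ring

/-- The equation satisfied by the second derivatives. -/
theorem IsSolution.heat_hess (h : Sy.IsSolution O u) (hz : z ∈ O) (i j a : Fin 2) :
    heat (fun k l => Sy.gi k l (jet u z)) (hess u (i, j, a)) z =
      ∑ k, ∑ l, (pder (vs i) (pder (vs j) (fun z => Sy.gi k l (jet u z))) z * Sy.V u (k, l, a) z
        + pder (vs j) (fun z => Sy.gi k l (jet u z)) z * pder (vs i) (Sy.V u (k, l, a)) z
        + pder (vs i) (fun z => Sy.gi k l (jet u z)) z * pder (vs j) (Sy.V u (k, l, a)) z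
        + Sy.gi k l (jet u z)
          * pder (vs i) (pder (vs j) (fun z => Sy.be (k, l, a) (jet u z))) z) := by
  have h1 : pder vt (hess u (i, j, a)) z =
      ∑ k, ∑ l, (pder (vs i) (pder (vs j) (fun z => Sy.gi k l (jet u z))) z * Sy.V u (k, l, a) z
        + pder (vs j) (fun z => Sy.gi k l (jet u z)) z * pder (vs i) (Sy.V u (k, l, a)) z
        + pder (vs i) (fun z => Sy.gi k l (jet u z)) z * pder (vs j) (Sy.V u (k, l, a)) z
        + Sy.gi k l (jet u z) * pder (vs i) (pder (vs j) (Sy.V u (k, l, a))) z) := by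
    have e1 : pder vt (hess u (i, j, a)) z = pder (vs i) (pder (vs j) (pder vt (u a))) z := by
      simp only [hess]
      rw [pder_pder_comm_on (contDiffOn_pder (h.smooth a) h.isOpen _) h.isOpen _ _ hz]
      exact pder_congr_of_eqOn h.isOpen (pder_pder_comm_on (h.smooth a) h.isOpen _ _) _ hz
    have hs : ∀ k l, ContDiffOn ℝ ∞
        (fun z => Sy.gi k l (jet u z) * Sy.V u (k, l, a) z) O := fun k l =>
      (h.smooth_comp (Sy.smooth_gi k l)).mul (h.smooth_V _)
    rw [e1, pder_congr_of_eqOn h.isOpen (pder_congr_of_eqOn h.isOpen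
      (fun z hz => h.eqn z hz a) _) _ hz,
      pder_pder_sum _ h.isOpen (fun k => ContDiffOn.sum fun l _ => hs k l) _ _ hz]
    refine Finset.sum_congr rfl fun k _ => ?_
    rw [pder_pder_sum _ h.isOpen (fun l => hs k l) _ _ hz]
    refine Finset.sum_congr rfl fun l _ => ?_
    rw [pder_pder_mul h.isOpen (h.smooth_comp (Sy.smooth_gi k l)) (h.smooth_V _) hz]
  simp only [heat, h1, h.pder_pder_V hz]
  simp only [hess, Fin.sum_univ_two, smul_eq_mul,
    pder_four_comm_on (h.smooth a) h.isOpen _ _ (vs i) (vs j) hz]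
  ring

theorem abs_clm_apply_le (A : Jet →L[ℝ] ℝ) (x : Jet) : |A x| ≤ ‖A‖ * ‖x‖ := A.le_opNorm x

/-- The derivative of a jet consists of a coordinate vector, the slopes (already part of the bounded
jet) and second derivatives of u, so it costs one factor `rho`. -/
theorem norm_pder_jet_le (h : Sy.IsSolution O u) (hB : Sy.Bounds B K) (hz : z ∈ O)
    (hJ : jet u z ∈ K) (k : Fin 2) : ‖pder (vs k) (jet u) z‖ ≤ B * rho u z := by
  have hρ := one_le_rho u z
  have h1 := hB.one_le
  have h2 : B ≤ B * rho u z := le_mul_of_one_le_right (by linarith) hρ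
  have h3 : rho u z ≤ B * rho u z := le_mul_of_one_le_left (by linarith) h1
  have hn := hB.norm_le _ hJ
  rw [h.pder_jet _ hz]
  refine max_le ?_ (max_le ?_ ?_)
  · simp only [vs, dir]
    simp; linarith
  · refine (pi_norm_le_iff_of_nonneg (by linarith)).2 fun a => ?_
    have e1 : ‖(jet u z).2.2 k a‖ ≤ ‖jet u z‖ :=
      (norm_le_pi_norm _ a).trans ((norm_le_pi_norm _ k).trans
        ((norm_snd_le _).trans (norm_snd_le _)))
    exact (e1.trans hn).trans h2
  · refine (pi_norm_le_iff_of_nonneg (by linarith)).2 fun i =>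
      (pi_norm_le_iff_of_nonneg (by linarith)).2 fun a => ?_
    exact (abs_hess_le u z (k, i, a)).trans h3

theorem norm_pder_pder_jet_le (h : Sy.IsSolution O u) (hz : z ∈ O) (k l : Fin 2) :
    ‖pder (vs k) (pder (vs l) (jet u)) z‖ ≤ rho u z + third u z := by
  have hρ := one_le_rho u z
  have ht := third_nonneg u z
  rw [h.pder_pder_jet hz]
  refine max_le (by simp; linarith) (max_le ?_ ?_)
  · refine (pi_norm_le_iff_of_nonneg (by linarith)).2 fun a => ?_
    exact (abs_hess_le u z (k, l, a)).trans (by linarith)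
  · refine (pi_norm_le_iff_of_nonneg (by linarith)).2 fun i =>
      (pi_norm_le_iff_of_nonneg (by linarith)).2 fun a => ?_
    exact (abs_pder_hess_le u z k (l, i, a)).trans (by linarith)

/-- The bookkeeping is by weight: one spatial derivative of a coefficient weighs `rho`, and two
weigh `rho ^ 2` or one third derivative. Powers of `B` are not optimised. -/
theorem abs_pder_comp_le (h : Sy.IsSolution O u) (hB : Sy.Bounds B K) (hz : z ∈ O)
    (hJ : jet u z ∈ K) {Ψ : Jet → ℝ} (hΨ : ContDiffOn ℝ ∞ Ψ Sy.dom) (hb : BoundedTwo B K Ψ)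
    (k : Fin 2) : |pder (vs k) (fun z => Ψ (jet u z)) z| ≤ B ^ 2 * rho u z := by
  have hΨ' := contDiffAt_two_of_contDiffOn hΨ Sy.isOpen_dom (h.mem z hz)
  rw [pder_comp (differentiableAt_of_contDiffAt_two hΨ')
    (differentiableAt_of_contDiffOn h.smooth_jet h.isOpen hz)]
  have h1 := ContinuousLinearMap.le_opNorm (fderiv ℝ Ψ (jet u z)) (pder (vs k) (jet u) z)
  have h2 : ‖fderiv ℝ Ψ (jet u z)‖ * ‖pder (vs k) (jet u) z‖ ≤ B * (B * rho u z) :=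
    mul_le_mul (hb.fst _ hJ) (norm_pder_jet_le h hB hz hJ k) (norm_nonneg _)
      (by linarith [hB.one_le])
  calc _ ≤ B * (B * rho u z) := h1.trans h2
    _ = _ := by ring

theorem abs_pder_pder_comp_le (h : Sy.IsSolution O u) (hB : Sy.Bounds B K) (hz : z ∈ O)
    (hJ : jet u z ∈ K) {Ψ : Jet → ℝ} (hΨ : ContDiffOn ℝ ∞ Ψ Sy.dom) (hb : BoundedTwo B K Ψ)
    (k l : Fin 2) : |pder (vs k) (pder (vs l) (fun z => Ψ (jet u z))) z|
      ≤ B ^ 3 * (2 * rho u z ^ 2 + third u z) := by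
  have hΨ' := contDiffAt_two_of_contDiffOn hΨ Sy.isOpen_dom (h.mem z hz)
  have hρ := one_le_rho u z
  have ht := third_nonneg u z
  have hB1 := hB.one_le
  have hB0 : 0 ≤ B := by linarith
  rw [pder_pder_comp hΨ' (contDiffAt_two_of_contDiffOn h.smooth_jet h.isOpen hz)]
  have h1 := hb.snd _ hJ (pder (vs k) (jet u) z) (pder (vs l) (jet u) z)
  have h2 : B * ‖pder (vs k) (jet u) z‖ * ‖pder (vs l) (jet u) z‖
      ≤ B * (B * rho u z) * (B * rho u z) := by
    gcongr <;> exact norm_pder_jet_le h hB hz hJ _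
  have h3 : |fderiv ℝ Ψ (jet u z) (pder (vs k) (pder (vs l) (jet u)) z)|
      ≤ B * (rho u z + third u z) := by
    refine (abs_clm_apply_le _ _).trans ?_
    gcongr
    · exact hb.fst _ hJ
    · exact norm_pder_pder_jet_le h hz k l
  refine (abs_add_le _ _).trans ?_
  have h4 : B ≤ B ^ 3 := by nlinarith [mul_nonneg hB0 (by nlinarith : (0:ℝ) ≤ B ^ 2 - 1)]
  have h5 : rho u z + third u z ≤ rho u z ^ 2 + third u z := by nlinarith
  have h6 : B * (rho u z + third u z) ≤ B ^ 3 * (rho u z ^ 2 + third u z) :=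
    mul_le_mul h4 h5 (by linarith) (by positivity)
  nlinarith

theorem abs_V_le (hB : Sy.Bounds B K) (hJ : jet u z ∈ K) (I : HessIndex) :
    |Sy.V u I z| ≤ 2 * B * rho u z := by
  have hρ := one_le_rho u z
  have hB1 := hB.one_le
  have h1 := abs_hess_le u z I
  have h2 := (hB.be I).val _ hJ
  refine (abs_add_le _ _).trans ?_
  nlinarith

theorem abs_pder_V_le (h : Sy.IsSolution O u) (hB : Sy.Bounds B K) (hz : z ∈ O)
    (hJ : jet u z ∈ K) (k : Fin 2) (I : HessIndex) :
    |pder (vs k) (Sy.V u I) z| ≤ third u z + B ^ 2 * rho u z := by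
  rw [h.pder_V _ _ hz]
  exact (abs_add_le _ _).trans (add_le_add (abs_pder_hess_le u z k I)
    (abs_pder_comp_le h hB hz hJ (Sy.smooth_be I) (hB.be I) k))

theorem abs_sum_two_two_le {f : Fin 2 → Fin 2 → ℝ} {c : ℝ} (hf : ∀ k l, |f k l| ≤ c) :
    |∑ k, ∑ l, f k l| ≤ 4 * c := by
  have h00 := abs_le.1 (hf 0 0)
  have h01 := abs_le.1 (hf 0 1)
  have h10 := abs_le.1 (hf 1 0)
  have h11 := abs_le.1 (hf 1 1)
  simp only [Fin.sum_univ_two]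
  exact abs_le.2 ⟨by linarith, by linarith⟩

theorem abs_mul_le_mul {a b c d : ℝ} (h1 : |a| ≤ c) (h2 : |b| ≤ d) : |a * b| ≤ c * d := by
  rw [abs_mul]; exact mul_le_mul h1 h2 (abs_nonneg _) ((abs_nonneg _).trans h1)

/-- Third derivatives cancel between ∂ₜ∂ᵢu and the principal part of the differentiated equation.
What remains is at most quadratic in D²u. -/
theorem norm_heat_jet_le (h : Sy.IsSolution O u) (hB : Sy.Bounds B K) (hz : z ∈ O)
    (hJ : jet u z ∈ K) :
    ‖heat (fun k l => Sy.gi k l (jet u z)) (jet u) z‖ ≤ 12 * B ^ 3 * rho u z ^ 2 := by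
  have hρ := one_le_rho u z
  have hB1 := hB.one_le
  have hB0 : 0 ≤ B := by linarith
  have hpos : 0 ≤ 12 * B ^ 3 * rho u z ^ 2 := by positivity
  rw [h.heat_jet hz]
  refine max_le (by simpa using hpos) (max_le ?_ ?_)
  · refine (pi_norm_le_iff_of_nonneg hpos).2 fun a => ?_
    change |heat (fun k l => Sy.gi k l (jet u z)) (u a) z| ≤ _
    rw [h.heat_self hz]
    refine (abs_sum_two_two_le (c := B * B) fun k l =>
      abs_mul_le_mul ((hB.gi k l).val _ hJ) ((hB.be _).val _ hJ)).trans ?_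
    have : B * B ≤ B ^ 3 * rho u z ^ 2 := by
      have : B * B * 1 ≤ B * B * (B * rho u z ^ 2) := by gcongr; nlinarith
      nlinarith
    nlinarith
  · refine (pi_norm_le_iff_of_nonneg hpos).2 fun i => (pi_norm_le_iff_of_nonneg hpos).2 fun a => ?_
    change |heat (fun k l => Sy.gi k l (jet u z)) (pder (vs i) (u a)) z| ≤ _
    rw [h.heat_pder hz]
    refine (abs_sum_two_two_le (c := B ^ 2 * rho u z * (2 * B * rho u z)
      + B * (B ^ 2 * rho u z)) fun k l => ?_).trans ?_
    · refine (abs_add_le _ _).trans (add_le_add (abs_mul_le_mul ?_ ?_) (abs_mul_le_mul ?_ ?_))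
      · exact abs_pder_comp_le h hB hz hJ (Sy.smooth_gi k l) (hB.gi k l) i
      · exact abs_V_le hB hJ _
      · exact (hB.gi k l).val _ hJ
      · exact abs_pder_comp_le h hB hz hJ (Sy.smooth_be _) (hB.be _) i
    · have : B ^ 3 * rho u z ≤ B ^ 3 * rho u z ^ 2 := by gcongr; nlinarith
      nlinarith

theorem abs_heat_comp_le (h : Sy.IsSolution O u) (hB : Sy.Bounds B K) (hz : z ∈ O)
    (hJ : jet u z ∈ K) {Ψ : Jet → ℝ} (hΨ : ContDiffOn ℝ ∞ Ψ Sy.dom) (hb : BoundedTwo B K Ψ) :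
    |heat (fun k l => Sy.gi k l (jet u z)) (fun z => Ψ (jet u z)) z|
      ≤ 16 * B ^ 4 * rho u z ^ 2 := by
  have hB1 := hB.one_le
  have hB0 : 0 ≤ B := by linarith
  rw [heat_comp (contDiffAt_two_of_contDiffOn hΨ Sy.isOpen_dom (h.mem z hz))
    (contDiffAt_two_of_contDiffOn h.smooth_jet h.isOpen hz)]
  have h1 : |fderiv ℝ Ψ (jet u z) (heat (fun k l => Sy.gi k l (jet u z)) (jet u) z)|
      ≤ B * (12 * B ^ 3 * rho u z ^ 2) := by
    refine (abs_clm_apply_le _ _).trans ?_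
    gcongr
    · exact hb.fst _ hJ
    · exact norm_heat_jet_le h hB hz hJ
  have h2 : |∑ k, ∑ l, Sy.gi k l (jet u z) * pder (pder (vs k) (jet u) z)
      (pder (pder (vs l) (jet u) z) Ψ) (jet u z)| ≤ 4 * (B * (B * (B * rho u z) * (B * rho u z))) := by
    refine abs_sum_two_two_le fun k l => abs_mul_le_mul ((hB.gi k l).val _ hJ) ?_
    refine (hb.snd _ hJ _ _).trans ?_
    have hρ := one_le_rho u z
    have h0 : 0 ≤ B * (B * rho u z) := by positivity
    gcongr <;> exact norm_pder_jet_le h hB hz hJ _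
  refine (abs_sub _ _).trans ((add_le_add h1 h2).trans (le_of_eq (by ring)))

/-- Fourth derivatives cancel in the same way. Third derivatives survive only linearly and with a
factor `rho`; after multiplication by V this is exactly what the good gradient term of `Q` can
absorb. -/
theorem abs_heat_V_le (h : Sy.IsSolution O u) (hB : Sy.Bounds B K) (hz : z ∈ O)
    (hJ : jet u z ∈ K) (I : HessIndex) :
    |heat (fun k l => Sy.gi k l (jet u z)) (Sy.V u I) z|
      ≤ 48 * B ^ 4 * (rho u z ^ 3 + rho u z * third u z) := by
  have hB1 := hB.one_le
  have hB0 : 0 ≤ B := by linarith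
  have hρ := one_le_rho u z
  have ht := third_nonneg u z
  have e : heat (fun k l => Sy.gi k l (jet u z)) (Sy.V u I) z = 
      heat (fun k l => Sy.gi k l (jet u z)) (hess u I) z +
      heat (fun k l => Sy.gi k l (jet u z)) (fun z => Sy.be I (jet u z)) z :=
    heat_add h.isOpen (h.smooth_hess I) (h.smooth_comp (Sy.smooth_be I)) hz _
  have h1 : |heat (fun k l => Sy.gi k l (jet u z)) (hess u I) z| ≤
      4 * (B ^ 3 * (2 * rho u z ^ 2 + third u z) * (2 * B * rho u z)
        + B ^ 2 * rho u z * (third u z + B ^ 2 * rho u z)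
        + B ^ 2 * rho u z * (third u z + B ^ 2 * rho u z)
        + B * (B ^ 3 * (2 * rho u z ^ 2 + third u z))) := by
    obtain ⟨i, j, a⟩ := I
    rw [h.heat_hess hz]
    refine abs_sum_two_two_le fun k l => ?_
    refine (abs_add_le _ _).trans (add_le_add ((abs_add_le _ _).trans (add_le_add
      ((abs_add_le _ _).trans (add_le_add (abs_mul_le_mul ?_ ?_) (abs_mul_le_mul ?_ ?_)))
        (abs_mul_le_mul ?_ ?_))) (abs_mul_le_mul ?_ ?_))
    · exact abs_pder_pder_comp_le h hB hz hJ (Sy.smooth_gi k l) (hB.gi k l) i j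
    · exact abs_V_le hB hJ _
    · exact abs_pder_comp_le h hB hz hJ (Sy.smooth_gi k l) (hB.gi k l) _
    · exact abs_pder_V_le h hB hz hJ _ _
    · exact abs_pder_comp_le h hB hz hJ (Sy.smooth_gi k l) (hB.gi k l) _
    · exact abs_pder_V_le h hB hz hJ _ _
    · exact (hB.gi k l).val _ hJ
    · exact abs_pder_pder_comp_le h hB hz hJ (Sy.smooth_be _) (hB.be _) i j
  have h2 := abs_heat_comp_le h hB hz hJ (Sy.smooth_be I) (hB.be I)
  rw [e]
  refine (abs_add_le _ _).trans ((add_le_add h1 h2).trans ?_)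
  set r := rho u z
  set s := third u z
  have i1 : B ^ 2 * (r * s) ≤ B ^ 4 * (r * s) := by
    have : B ^ 2 ≤ B ^ 4 := pow_le_pow_right₀ hB1 (by norm_num)
    gcongr
  have i2 : B ^ 4 * r ^ 2 ≤ B ^ 4 * r ^ 3 := by
    have : r ^ 2 ≤ r ^ 3 := pow_le_pow_right₀ hρ (by norm_num)
    gcongr
  have i3 : B ^ 4 * s ≤ B ^ 4 * (r * s) := by
    have : s ≤ r * s := le_mul_of_one_le_left ht hρ
    gcongr
  have i4 : 0 ≤ B ^ 4 * (r * s) := by positivity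
  nlinarith

end GraphSystem

end GraphEstimates

end SurfaceMCF

end

noncomputable section

namespace SurfaceMCF

/-! ### Traces of products of quadratic forms in the plane. -/

section Trace

theorem quadratic_det_nonneg {a b c : ℝ} (h : ∀ x y : ℝ, 0 ≤ a * x ^ 2 + 2 * b * x * y + c * y ^ 2) :
    0 ≤ a ∧ 0 ≤ c ∧ b ^ 2 ≤ a * c := by
  have ha : 0 ≤ a := by simpa using h 1 0
  have hc : 0 ≤ c := by simpa using h 0 1
  refine ⟨ha, hc, ?_⟩
  rcases ha.eq_or_lt with h0 | h0
  · subst h0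
    have hb : b = 0 := by
      by_contra hb
      -- At this point the form would take the value -1.
      have h1 := h (-(c + 1) / (2 * b)) 1
      have h2 : 2 * b * (-(c + 1) / (2 * b)) = -(c + 1) := by field_simp
      rw [h2] at h1
      linarith
    simp [hb]
  -- The form at (-b, a) equals a (ac - b²).
  · have h1 := h (-b) a
    have : 0 ≤ a * (a * c - b ^ 2) := by nlinarith
    nlinarith [nonneg_of_mul_nonneg_right this h0]

/-- The determinant conditions give (bb')² ≤ (aa')(cc'), and the arithmetic-geometric mean
inequality turns this into 2|bb'| ≤ aa' + cc'. -/
theorem trace_mul_nonneg {a b c a' b' c' : ℝ}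
    (h : ∀ x y : ℝ, 0 ≤ a * x ^ 2 + 2 * b * x * y + c * y ^ 2)
    (h' : ∀ x y : ℝ, 0 ≤ a' * x ^ 2 + 2 * b' * x * y + c' * y ^ 2) :
    0 ≤ a * a' + 2 * (b * b') + c * c' := by
  obtain ⟨h1, h2, h3⟩ := quadratic_det_nonneg h
  obtain ⟨h1', h2', h3'⟩ := quadratic_det_nonneg h'
  have h4 : (b * b') ^ 2 ≤ (a * a') * (c * c') := by
    calc (b * b') ^ 2 = b ^ 2 * b' ^ 2 := by ring
      _ ≤ (a * c) * (a' * c') := mul_le_mul h3 h3' (sq_nonneg _) (by positivity)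
      _ = _ := by ring
  have h5 : 0 ≤ a * a' := by positivity
  have h6 : 0 ≤ c * c' := by positivity
  have h7 : |2 * (b * b')| ≤ a * a' + c * c' := by
    refine abs_le_of_sq_le_sq ?_ (by linarith)
    nlinarith [sq_nonneg (a * a' - c * c')]
  linarith [neg_le_of_abs_le h7]

/-- If `m ≥ lam` and `b ≥ 0` as quadratic forms on `ℝ²`, then `tr (m b) ≥ lam tr b`. -/
theorem trace_mul_lower {m b : Fin 2 → Fin 2 → ℝ} {lam : ℝ} (hm : ∀ k l, m k l = m l k)
    (hb : ∀ k l, b k l = b l k)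
    (hm1 : ∀ x : Fin 2 → ℝ, lam * ∑ k, x k ^ 2 ≤ ∑ k, ∑ l, m k l * (x k * x l))
    (hb1 : ∀ x : Fin 2 → ℝ, 0 ≤ ∑ k, ∑ l, b k l * (x k * x l)) :
    lam * ∑ k, b k k ≤ ∑ k, ∑ l, m k l * b k l := by
  -- The two nonnegative forms are m - lam · id and b.
  have h := trace_mul_nonneg (a := m 0 0 - lam) (b := m 0 1) (c := m 1 1 - lam)
    (a' := b 0 0) (b' := b 0 1) (c' := b 1 1) (fun x y => ?_) (fun x y => ?_)
  · simp only [Fin.sum_univ_two, hm 1 0, hb 1 0]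
    linarith
  · have := hm1 ![x, y]
    simp only [Fin.sum_univ_two, hm 1 0, Matrix.cons_val_zero, Matrix.cons_val_one] at this
    linarith
  · have := hb1 ![x, y]
    simp only [Fin.sum_univ_two, hb 1 0, Matrix.cons_val_zero, Matrix.cons_val_one] at this
    linarith

end Trace

/-! ### The evolution inequality for |A|² in graph coordinates. -/

section GraphEstimates

namespace GraphSystem

variable {Sy : GraphSystem} {O : Set SpaceTime} {u : Fin 2 → SpaceTime → ℝ} {B : ℝ}
  {K : Set Jet} {z : SpaceTime}

variable (Sy) in
/-- Ellipticity of the coefficients on `K`. -/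
structure Elliptic (K : Set Jet) : Prop where
  gi : ∀ J ∈ K, ∀ x : Fin 2 → ℝ, (1 / 2) * ∑ k, x k ^ 2 ≤ ∑ k, ∑ l, Sy.gi k l J * (x k * x l)
  nf : ∀ J ∈ K, ∀ x : HessIndex → ℝ,
    (1 / 2) * ∑ I, x I ^ 2 ≤ ∑ I, ∑ I', Sy.nf I I' J * (x I * x I')

theorem norm_sq_le_sum_sq {ι : Type*} [Fintype ι] (x : ι → ℝ) : ‖x‖ ^ 2 ≤ ∑ i, x i ^ 2 := by
  have h0 : 0 ≤ ∑ i, x i ^ 2 := Finset.sum_nonneg fun i _ => sq_nonneg _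
  rw [← Real.le_sqrt (norm_nonneg _) h0]
  refine (pi_norm_le_iff_of_nonneg (Real.sqrt_nonneg _)).2 fun i => ?_
  exact Real.abs_le_sqrt (Finset.single_le_sum (fun i _ => sq_nonneg (x i)) (Finset.mem_univ i))

theorem IsSolution.smooth_Q (h : Sy.IsSolution O u) : ContDiffOn ℝ ∞ (Sy.Q u) O :=
  ContDiffOn.sum fun I _ => ContDiffOn.sum fun I' _ =>
    (h.smooth_comp (Sy.smooth_nf I I')).mul ((h.smooth_V I).mul (h.smooth_V I'))

/-- The formula isolates the last sum, quadratic in ∂V: for elliptic `m` and `nf` it is the good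
negative term. Everything else is an error, at most linear in third derivatives. -/
theorem IsSolution.heat_Q (h : Sy.IsSolution O u) (hz : z ∈ O) {m : Fin 2 → Fin 2 → ℝ}
    (hm : ∀ k l, m k l = m l k) :
    heat m (Sy.Q u) z = ∑ I, ∑ I', (heat m (fun z => Sy.nf I I' (jet u z)) z
          * (Sy.V u I z * Sy.V u I' z)
        + Sy.nf I I' (jet u z) * (heat m (Sy.V u I) z * Sy.V u I' z
            + Sy.V u I z * heat m (Sy.V u I') z)
        - 2 * ∑ k, ∑ l, m k l * (pder (vs k) (fun z => Sy.nf I I' (jet u z)) z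
            * (pder (vs l) (Sy.V u I) z * Sy.V u I' z + Sy.V u I z * pder (vs l) (Sy.V u I') z)))
      - 2 * ∑ k, ∑ l, m k l * ∑ I, ∑ I', Sy.nf I I' (jet u z)
          * (pder (vs k) (Sy.V u I) z * pder (vs l) (Sy.V u I') z) := by
  have hnf := fun I I' => h.smooth_comp (Sy.smooth_nf I I')
  have hVV := fun I I' => (h.smooth_V I).mul (h.smooth_V I')
  have e1 : ∀ I I', heat m (fun z => Sy.nf I I' (jet u z) * (Sy.V u I z * Sy.V u I' z)) z =
      (heat m (fun z => Sy.nf I I' (jet u z)) z * (Sy.V u I z * Sy.V u I' z)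
        + Sy.nf I I' (jet u z) * (heat m (Sy.V u I) z * Sy.V u I' z
            + Sy.V u I z * heat m (Sy.V u I') z)
        - 2 * ∑ k, ∑ l, m k l * (pder (vs k) (fun z => Sy.nf I I' (jet u z)) z
            * (pder (vs l) (Sy.V u I) z * Sy.V u I' z + Sy.V u I z * pder (vs l) (Sy.V u I') z)))
      - 2 * ∑ k, ∑ l, m k l * (Sy.nf I I' (jet u z)
          * (pder (vs k) (Sy.V u I) z * pder (vs l) (Sy.V u I') z)) := fun I I' => by
    rw [heat_mul h.isOpen (hnf I I') (hVV I I') hz hm,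
      heat_mul h.isOpen (h.smooth_V I) (h.smooth_V I') hz hm]
    simp only [pder_mul (differentiableAt_of_contDiffOn (h.smooth_V I) h.isOpen hz)
      (differentiableAt_of_contDiffOn (h.smooth_V I') h.isOpen hz), Fin.sum_univ_two]
    ring
  have e2 : heat m (Sy.Q u) z = ∑ I, ∑ I', heat m (fun z => Sy.nf I I' (jet u z)
      * (Sy.V u I z * Sy.V u I' z)) z := by
    have hs := fun I I' => (hnf I I').mul (hVV I I')
    change heat m (fun z => ∑ I, ∑ I', Sy.nf I I' (jet u z) * (Sy.V u I z * Sy.V u I' z)) z = _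
    rw [heat_sum _ h.isOpen (fun I => ContDiffOn.sum fun I' _ => hs I I') hz]
    exact Finset.sum_congr rfl fun I _ => heat_sum _ h.isOpen (fun I' => hs I I') hz _
  rw [e2]
  simp only [e1, Finset.sum_sub_distrib]
  congr 1
  simp only [← Finset.mul_sum]
  congr 1
  simp only [Fin.sum_univ_two, Finset.mul_sum, Finset.sum_add_distrib]

theorem abs_sum_hessIndex_le {f : HessIndex → HessIndex → ℝ} {c : ℝ} (hf : ∀ k l, |f k l| ≤ c) :
    |∑ k, ∑ l, f k l| ≤ 64 * c := by
  have h1 : ∀ k, |∑ l, f k l| ≤ 8 * c := fun k => by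
    refine (Finset.abs_sum_le_sum_abs _ _).trans ((Finset.sum_le_sum fun l _ => hf k l).trans ?_)
    simp
  refine (Finset.abs_sum_le_sum_abs _ _).trans ((Finset.sum_le_sum fun l _ => h1 l).trans ?_)
  simp; linarith

/-- The good term controls ∂V and not the third derivatives of u. The difference is the derivative
of `be` along the jet, which is only of order `rho`. -/
theorem sq_third_le (h : Sy.IsSolution O u) (hB : Sy.Bounds B K) (hz : z ∈ O)
    (hJ : jet u z ∈ K) :
    third u z ^ 2 ≤ 2 * (∑ k, ∑ I, pder (vs k) (Sy.V u I) z ^ 2) + 2 * (B ^ 2 * rho u z) ^ 2 := by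
  have h0 : 0 ≤ 2 * (∑ k, ∑ I, pder (vs k) (Sy.V u I) z ^ 2) + 2 * (B ^ 2 * rho u z) ^ 2 := by
    positivity
  rw [← Real.le_sqrt (third_nonneg u z) h0]
  refine (pi_norm_le_iff_of_nonneg (Real.sqrt_nonneg _)).2 fun k =>
    (pi_norm_le_iff_of_nonneg (Real.sqrt_nonneg _)).2 fun I => Real.abs_le_sqrt ?_
  have h1 := h.pder_V (vs k) I hz
  have h2 := abs_pder_comp_le h hB hz hJ (Sy.smooth_be I) (hB.be I) k
  have h3 : pder (vs k) (Sy.V u I) z ^ 2 ≤ ∑ k, ∑ I, pder (vs k) (Sy.V u I) z ^ 2 :=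
    (Finset.single_le_sum (f := fun I => pder (vs k) (Sy.V u I) z ^ 2)
      (fun I _ => sq_nonneg _) (Finset.mem_univ I)).trans
      (Finset.single_le_sum (f := fun k => ∑ I, pder (vs k) (Sy.V u I) z ^ 2)
        (fun k _ => Finset.sum_nonneg fun I _ => sq_nonneg _) (Finset.mem_univ k))
  have h4 : pder (vs k) (fun z => Sy.be I (jet u z)) z ^ 2 ≤ (B ^ 2 * rho u z) ^ 2 :=
    sq_le_sq' (neg_le_of_abs_le h2) (le_of_abs_le h2)
  have h5 : pder (vs k) (hess u I) z = pder (vs k) (Sy.V u I) z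
      - pder (vs k) (fun z => Sy.be I (jet u z)) z := by rw [h1]; ring
  rw [h5]
  nlinarith [sq_nonneg (pder (vs k) (Sy.V u I) z + pder (vs k) (fun z => Sy.be I (jet u z)) z)]

/-- The evolution inequality for the quadratic quantity. -/
theorem heat_Q_le (h : Sy.IsSolution O u) (hB : Sy.Bounds B K) (hE : Sy.Elliptic K) (hz : z ∈ O)
    (hJ : jet u z ∈ K) :
    heat (fun k l => Sy.gi k l (jet u z)) (Sy.Q u) z
      ≤ ((18432 * B ^ 6) ^ 2 + 18432 * B ^ 6 + B ^ 4) * rho u z ^ 4 := by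
  have hB1 := hB.one_le
  have hB0 : 0 ≤ B := by linarith
  have hρ := one_le_rho u z
  have ht := third_nonneg u z
  rw [h.heat_Q hz (fun k l => Sy.symm_gi k l _)]
  set m : Fin 2 → Fin 2 → ℝ := fun k l => Sy.gi k l (jet u z) with hmdef
  set r := rho u z with hr
  set s := third u z with hs
  have hrs : 0 ≤ r * s := by positivity
  -- All error terms have weight r⁴ or r² s; the sum over 64 index pairs then produces 64 · 288 =
  -- 18432.
  have h1 := abs_sum_hessIndex_le (c := 288 * B ^ 6 * (r ^ 4 + r ^ 2 * s))
    (f := fun I I' => (heat m (fun z => Sy.nf I I' (jet u z)) z * (Sy.V u I z * Sy.V u I' z)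
        + Sy.nf I I' (jet u z) * (heat m (Sy.V u I) z * Sy.V u I' z
            + Sy.V u I z * heat m (Sy.V u I') z)
        - 2 * ∑ k, ∑ l, m k l * (pder (vs k) (fun z => Sy.nf I I' (jet u z)) z
            * (pder (vs l) (Sy.V u I) z * Sy.V u I' z
              + Sy.V u I z * pder (vs l) (Sy.V u I') z)))) (fun I I' => by
    have v1 := abs_V_le hB hJ I
    have v2 := abs_V_le hB hJ I'
    have w1 := abs_heat_V_le h hB hz hJ I
    have w2 := abs_heat_V_le h hB hz hJ I'
    have t1 := abs_mul_le_mul (abs_heat_comp_le h hB hz hJ (Sy.smooth_nf I I') (hB.nf I I'))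
      (abs_mul_le_mul v1 v2)
    have t2 := abs_mul_le_mul ((hB.nf I I').val _ hJ)
      ((abs_add_le _ _).trans (add_le_add (abs_mul_le_mul w1 v2) (abs_mul_le_mul v1 w2)))
    have t3 := abs_sum_two_two_le fun k l => abs_mul_le_mul ((hB.gi k l).val _ hJ)
      (abs_mul_le_mul (abs_pder_comp_le h hB hz hJ (Sy.smooth_nf I I') (hB.nf I I') k)
      ((abs_add_le _ _).trans (add_le_add (abs_mul_le_mul (abs_pder_V_le h hB hz hJ l I) v2)
        (abs_mul_le_mul v1 (abs_pder_V_le h hB hz hJ l I')))))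
    refine (abs_sub _ _).trans ?_
    rw [abs_mul 2, abs_two]
    refine (add_le_add ((abs_add_le _ _).trans (add_le_add t1 t2))
      (mul_le_mul_of_nonneg_left t3 (by norm_num))).trans ?_
    have j1 : B ^ 4 * (r ^ 2 * s) ≤ B ^ 6 * (r ^ 2 * s) := by
      have : B ^ 4 ≤ B ^ 6 := pow_le_pow_right₀ hB1 (by norm_num)
      gcongr
    have j2 : B ^ 6 * r ^ 3 ≤ B ^ 6 * r ^ 4 := by
      have : r ^ 3 ≤ r ^ 4 := pow_le_pow_right₀ hρ (by norm_num)
      gcongr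
    have j3 : 0 ≤ B ^ 6 * (r ^ 2 * s) := by positivity
    nlinarith)
  -- The form b_{kl} = nf(∂ₖV, ∂ₗV) is nonnegative by ellipticity of `nf`. Ellipticity of `m` bounds
  -- its trace against `m` from below, and each ellipticity contributes a factor 1/2.
  have h2 : (1 / 4) * ∑ k, ∑ I, pder (vs k) (Sy.V u I) z ^ 2 ≤
      ∑ k, ∑ l, m k l * ∑ I, ∑ I', Sy.nf I I' (jet u z)
          * (pder (vs k) (Sy.V u I) z * pder (vs l) (Sy.V u I') z) := by
    have hsymm : ∀ k l, (∑ I, ∑ I', Sy.nf I I' (jet u z)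
          * (pder (vs k) (Sy.V u I) z * pder (vs l) (Sy.V u I') z)) =
          ∑ I, ∑ I', Sy.nf I I' (jet u z)
          * (pder (vs l) (Sy.V u I) z * pder (vs k) (Sy.V u I') z) := fun k l => by
      rw [Finset.sum_comm]
      refine Finset.sum_congr rfl fun I _ => Finset.sum_congr rfl fun I' _ => ?_
      rw [Sy.symm_nf]; ring
    have h3 := trace_mul_lower (m := m) (lam := 1 / 2) (b := fun k l => ∑ I, ∑ I',
      Sy.nf I I' (jet u z) * (pder (vs k) (Sy.V u I) z * pder (vs l) (Sy.V u I') z))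
      (fun k l => Sy.symm_gi k l _) hsymm (hE.gi _ hJ) (fun x => by
        have h4 := hE.nf _ hJ (fun I => ∑ k, x k * pder (vs k) (Sy.V u I) z)
        have h5 : 0 ≤ (1 / 2 : ℝ) * ∑ I, (∑ k, x k * pder (vs k) (Sy.V u I) z) ^ 2 := by positivity
        refine (h5.trans h4).trans (le_of_eq ?_)
        simp only [Fin.sum_univ_two, Finset.sum_mul, ← Finset.sum_add_distrib]
        refine Finset.sum_congr rfl fun I _ => Finset.sum_congr rfl fun I' _ => ?_
        ring)
    have h6 : ∀ k : Fin 2, (1 / 2) * ∑ I, pder (vs k) (Sy.V u I) z ^ 2 ≤ ∑ I, ∑ I',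
      Sy.nf I I' (jet u z) * (pder (vs k) (Sy.V u I) z * pder (vs k) (Sy.V u I') z) := fun k =>
      hE.nf _ hJ _
    have h60 := h6 0
    have h61 := h6 1
    refine le_trans ?_ h3
    rw [Fin.sum_univ_two, Fin.sum_univ_two]
    linarith
  have h7 := sq_third_le h hB hz hJ
  have h8 := le_of_abs_le h1
  set S2 := ∑ k, ∑ I, pder (vs k) (Sy.V u I) z ^ 2
  have h9 : B ^ 4 * r ^ 2 ≤ B ^ 4 * r ^ 4 := by
    have : r ^ 2 ≤ r ^ 4 := pow_le_pow_right₀ hρ (by norm_num)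
    gcongr
  -- Young's inequality: the mixed error 18432 B⁶ r² s is split into s²/4, absorbed by the good
  -- term, and a multiple of r⁴.
  have h10 := sq_nonneg (s / 2 - 18432 * B ^ 6 * r ^ 2)
  refine (sub_le_sub h8 (mul_le_mul_of_nonneg_left h2 (by norm_num : (0:ℝ) ≤ 2))).trans ?_
  nlinarith

theorem Q_le (hB : Sy.Bounds B K) (hJ : jet u z ∈ K) : Sy.Q u z ≤ 256 * B ^ 3 * rho u z ^ 2 := by
  have := abs_sum_hessIndex_le fun I I' => abs_mul_le_mul ((hB.nf I I').val _ hJ)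
    (abs_mul_le_mul (abs_V_le hB hJ I) (abs_V_le hB hJ I'))
  exact (le_of_abs_le this).trans (le_of_eq (by ring))

/-- Together with `Q_le` this makes `Q` and `rho ^ 2` interchangeable up to constants. The additive
loss comes from V differing from D²u by `be`, bounded by `B`, and from the 1 in `rho`. -/
theorem le_Q (hB : Sy.Bounds B K) (hE : Sy.Elliptic K) (hJ : jet u z ∈ K) :
    rho u z ^ 2 / 8 - (1 + B ^ 2) ≤ Sy.Q u z := by
  have h1 := hE.nf _ hJ (fun I => Sy.V u I z)
  have h2 : ‖fun I => hess u I z‖ ^ 2 ≤ 2 * (∑ I, Sy.V u I z ^ 2) + 2 * B ^ 2 := by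
    have h0 : 0 ≤ 2 * (∑ I, Sy.V u I z ^ 2) + 2 * B ^ 2 := by positivity
    rw [← Real.le_sqrt (norm_nonneg _) h0]
    refine (pi_norm_le_iff_of_nonneg (Real.sqrt_nonneg _)).2 fun I => Real.abs_le_sqrt ?_
    have h3 := Finset.single_le_sum (f := fun I => Sy.V u I z ^ 2)
      (fun I _ => sq_nonneg _) (Finset.mem_univ I)
    have h4 := (hB.be I).val _ hJ
    have h5 : Sy.be I (jet u z) ^ 2 ≤ B ^ 2 := sq_le_sq' (neg_le_of_abs_le h4) (le_of_abs_le h4)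
    have h6 : hess u I z = Sy.V u I z - Sy.be I (jet u z) := by simp [V]
    rw [h6]
    nlinarith [sq_nonneg (Sy.V u I z + Sy.be I (jet u z))]
  have h7 : Sy.Q u z = ∑ I, ∑ I', Sy.nf I I' (jet u z) * (Sy.V u I z * Sy.V u I' z) := rfl
  rw [h7]
  have h8 : rho u z = 1 + ‖fun I => hess u I z‖ := rfl
  rw [h8]
  nlinarith [sq_nonneg (‖fun I => hess u I z‖ - 1)]

end GraphSystem

end GraphEstimates

end SurfaceMCF

end

noncomputable section

namespace SurfaceMCF

/-! ### The angle function and the bound at a maximum. -/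

section GraphEstimates

namespace GraphSystem

variable {Sy : GraphSystem} {O : Set SpaceTime} {u : Fin 2 → SpaceTime → ℝ} {B : ℝ}
  {K : Set Jet} {z : SpaceTime} {eta : Jet → ℝ} {c δ : ℝ}

/-- Strict concavity of `eta` in the derivative variables, uniformly on `K`. -/
def ConcaveOnFibers (c : ℝ) (K : Set Jet) (eta : Jet → ℝ) : Prop :=
  ∀ J ∈ K, ∀ x : Fin 2 → Fin 2 → ℝ,
    pder ((0, 0, x) : Jet) (pder ((0, 0, x) : Jet) eta) J ≤ -(c * ∑ i, ∑ a, x i a ^ 2)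

/-- The positive term is minus the Hessian of `eta`, evaluated on the D²u part of the derivative of
the jet. The gradient of `eta` acts on the heat operator of the jet, which is quadratic in D²u as
well; only the smallness `δ` makes that contribution harmless. -/
theorem le_heat_eta (h : Sy.IsSolution O u) (hB : Sy.Bounds B K) (hE : Sy.Elliptic K)
    (hz : z ∈ O) (hJ : jet u z ∈ K) (hη : ContDiffOn ℝ ∞ eta Sy.dom) (hb : BoundedTwo B K eta)
    (hc : 0 < c) (hcv : ConcaveOnFibers c K eta) (hδ : ‖fderiv ℝ eta (jet u z)‖ ≤ δ) :
    c / 8 * rho u z ^ 2 - (c + 288 * B ^ 8 / c) - 12 * B ^ 3 * δ * rho u z ^ 2 ≤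
      heat (fun k l => Sy.gi k l (jet u z)) (fun z => eta (jet u z)) z := by
  have hB1 := hB.one_le
  have hB0 : 0 ≤ B := by linarith
  have hρ := one_le_rho u z
  have hδ0 : 0 ≤ δ := (norm_nonneg _).trans hδ
  have hη' := contDiffAt_two_of_contDiffOn hη Sy.isOpen_dom (h.mem z hz)
  rw [heat_comp hη' (contDiffAt_two_of_contDiffOn h.smooth_jet h.isOpen hz)]
  have h1 : |fderiv ℝ eta (jet u z) (heat (fun k l => Sy.gi k l (jet u z)) (jet u) z)|
      ≤ δ * (12 * B ^ 3 * rho u z ^ 2) := by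
    refine (abs_clm_apply_le _ _).trans ?_
    gcongr
    exact norm_heat_jet_le h hB hz hJ
  set D := fderiv ℝ (fderiv ℝ eta) (jet u z) with hD
  have hDle : ∀ a b, |D a b| ≤ B * ‖a‖ * ‖b‖ := fun a b => by
    have := hb.snd _ hJ a b
    rwa [pder_pder_eq hη'] at this
  have hDs : ∀ a b, D a b = D b a := fun a b => by
    have := pder_pder_comm hη' a b
    rwa [pder_pder_eq hη', pder_pder_eq hη'] at this
  -- The derivative of the jet splits as A + X: `X` lies in the slope directions, where `eta` is
  -- concave, and `A` is bounded by `B`.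
  set X : Fin 2 → Jet := fun k => (0, 0, fun i a => hess u (k, i, a) z) with hX
  set A : Fin 2 → Jet := fun k => (dir k, fun a => pder (vs k) (u a) z, 0) with hA
  have hXA : ∀ k, pder (vs k) (jet u) z = A k + X k := fun k => by
    rw [h.pder_jet _ hz]
    refine Prod.ext ?_ (Prod.ext ?_ ?_)
    · simp [hX, hA, vs]
    · simp [hX, hA]
    · simp only [hX, hA, Prod.snd_add, zero_add]; rfl
  have hXn : ∀ k, ‖X k‖ ≤ rho u z := fun k => by
    refine max_le (by simp [hX]; linarith) (max_le (by simp [hX]; linarith) ?_)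
    exact (pi_norm_le_iff_of_nonneg (by linarith)).2 fun i =>
      (pi_norm_le_iff_of_nonneg (by linarith)).2 fun a => abs_hess_le u z (k, i, a)
  have hAn : ∀ k, ‖A k‖ ≤ B := fun k => by
    refine max_le (by simp [hA, dir, hB1]) (max_le ?_ (by simpa [hA] using hB0))
    refine (pi_norm_le_iff_of_nonneg hB0).2 fun a => ?_
    have e1 : ‖(jet u z).2.2 k a‖ ≤ ‖jet u z‖ :=
      (norm_le_pi_norm _ a).trans ((norm_le_pi_norm _ k).trans
        ((norm_snd_le _).trans (norm_snd_le _)))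
    exact e1.trans (hB.norm_le _ hJ)
  have hmain : c / 2 * ‖fun I => hess u I z‖ ^ 2 ≤
      ∑ k, ∑ l, Sy.gi k l (jet u z) * -(D (X k) (X l)) := by
    have hcv' : ∀ x : Fin 2 → ℝ, c * ∑ i, ∑ a, (∑ k, x k * hess u (k, i, a) z) ^ 2 ≤
        ∑ k, ∑ l, -(D (X k) (X l)) * (x k * x l) := fun x => by
      have h2 := hcv _ hJ (fun i a => ∑ k, x k * hess u (k, i, a) z)
      rw [pder_pder_eq hη'] at h2
      have h3 : ((0, 0, fun i a => ∑ k, x k * hess u (k, i, a) z) : Jet) =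
          x 0 • X 0 + x 1 • X 1 := by
        refine Prod.ext (by simp [hX]) (Prod.ext (by simp [hX]) ?_)
        funext i a
        simp [hX, Fin.sum_univ_two]
      rw [h3] at h2
      simp only [map_add, map_smul, add_apply, smul_apply, smul_eq_mul] at h2
      have h4 : (∑ k, ∑ l, -(D (X k) (X l)) * (x k * x l)) =
          -(x 0 * (x 0 * D (X 0) (X 0)) + x 1 * (x 0 * D (X 1) (X 0)) +
            (x 0 * (x 1 * D (X 0) (X 1)) + x 1 * (x 1 * D (X 1) (X 1)))) := by
        simp only [Fin.sum_univ_two]; ring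
      rw [h4]
      linarith
    have h3 := trace_mul_lower (m := fun k l => Sy.gi k l (jet u z)) (lam := 1 / 2)
      (b := fun k l => -(D (X k) (X l))) (fun k l => Sy.symm_gi k l _)
      (fun k l => by rw [hDs]) (hE.gi _ hJ)
      (fun x => le_trans (by positivity) (hcv' x))
    refine le_trans ?_ h3
    have e0 := hcv' ![1, 0]
    have e1 := hcv' ![0, 1]
    have e2 := norm_sq_le_sum_sq (fun I => hess u I z)
    simp only [Fin.sum_univ_two, Fintype.sum_prod_type, Matrix.cons_val_zero, Matrix.cons_val_one]
      at e0 e1 e2 ⊢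
    nlinarith
  have hrest : |∑ k, ∑ l, Sy.gi k l (jet u z) * (D (A k) (A l) + D (A k) (X l) + D (X k) (A l))|
      ≤ 4 * (B * (B * B * B + B * B * rho u z + B * rho u z * B)) := by
    refine abs_sum_two_two_le fun k l => abs_mul_le_mul ((hB.gi k l).val _ hJ) ?_
    refine (abs_add_le _ _).trans (add_le_add ((abs_add_le _ _).trans (add_le_add ?_ ?_)) ?_)
    · refine (hDle _ _).trans ?_
      gcongr <;> exact hAn _
    · refine (hDle _ _).trans ?_
      gcongr
      · exact hAn _
      · exact hXn _
    · refine (hDle _ _).trans ?_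
      gcongr
      · exact hXn _
      · exact hAn _
  have hsplit : ∑ k, ∑ l, Sy.gi k l (jet u z) * pder (pder (vs k) (jet u) z)
      (pder (pder (vs l) (jet u) z) eta) (jet u z) =
      (∑ k, ∑ l, Sy.gi k l (jet u z) * (D (A k) (A l) + D (A k) (X l) + D (X k) (A l)))
        - ∑ k, ∑ l, Sy.gi k l (jet u z) * -(D (X k) (X l)) := by
    rw [← Finset.sum_sub_distrib]
    refine Finset.sum_congr rfl fun k _ => ?_
    rw [← Finset.sum_sub_distrib]
    refine Finset.sum_congr rfl fun l _ => ?_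
    rw [pder_pder_eq hη', hXA, hXA]
    simp only [map_add, add_apply, ← hD]
    ring
  rw [hsplit]
  have h5 := neg_le_of_abs_le h1
  have h6 := le_of_abs_le hrest
  have h8 : rho u z = 1 + ‖fun I => hess u I z‖ := rfl
  have h9 : ‖fun I => hess u I z‖ = rho u z - 1 := by rw [h8]; ring
  rw [h9] at hmain
  set r := rho u z
  have h10 : 4 * (B * (B * B * B + B * B * r + B * r * B)) ≤ 12 * B ^ 4 * r := by
    have : B ^ 4 ≤ B ^ 4 * r := le_mul_of_one_le_right (by positivity) hρ
    have : B ^ 3 * r ≤ B ^ 4 * r := by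
      have : B ^ 3 ≤ B ^ 4 := pow_le_pow_right₀ hB1 (by norm_num)
      gcongr
    nlinarith
  -- The terms mixing `A` and `X` are linear in `r`, and Young's inequality charges them to half of
  -- the c/4 · r² kept below in `h16`.
  have h11 : 12 * B ^ 4 * r ≤ c / 8 * r ^ 2 + 288 * B ^ 8 / c := by
    have h12 := sq_nonneg (c * r - 48 * B ^ 4)
    have h13 : 288 * B ^ 8 / c = 288 * B ^ 8 * c⁻¹ := by rw [div_eq_mul_inv]
    have h14 : 0 ≤ (c * r - 48 * B ^ 4) ^ 2 * c⁻¹ := by positivity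
    have h15 : (c * r - 48 * B ^ 4) ^ 2 * c⁻¹ = c * r ^ 2 - 96 * B ^ 4 * r + 8 * (288 * B ^ 8 / c) := by
      field_simp; ring
    linarith
  have h16 : c / 4 * r ^ 2 - c ≤ c / 2 * (r - 1) ^ 2 := by
    nlinarith [mul_nonneg hc.le (sq_nonneg (r - 2))]
  linarith

/-- The factor `δ ^ 2` lets the term p² |∇η|² be beaten even though p has already been fixed. -/
theorem gradient_eta_le (h : Sy.IsSolution O u) (hB : Sy.Bounds B K)
    (hz : z ∈ O) (hJ : jet u z ∈ K) (hη : ContDiffOn ℝ ∞ eta Sy.dom)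
    (hδ : ‖fderiv ℝ eta (jet u z)‖ ≤ δ) :
    ∑ k, ∑ l, Sy.gi k l (jet u z) * (pder (vs k) (fun z => eta (jet u z)) z
      * pder (vs l) (fun z => eta (jet u z)) z) ≤ 4 * B ^ 3 * δ ^ 2 * rho u z ^ 2 := by
  have hη' := contDiffAt_two_of_contDiffOn hη Sy.isOpen_dom (h.mem z hz)
  have hδ0 : 0 ≤ δ := (norm_nonneg _).trans hδ
  have h1 : ∀ k, |pder (vs k) (fun z => eta (jet u z)) z| ≤ δ * (B * rho u z) := fun k => by
    rw [pder_comp (differentiableAt_of_contDiffAt_two hη')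
      (differentiableAt_of_contDiffOn h.smooth_jet h.isOpen hz)]
    refine (abs_clm_apply_le _ _).trans ?_
    gcongr
    exact norm_pder_jet_le h hB hz hJ k
  have h2 := abs_sum_two_two_le fun k l => abs_mul_le_mul ((hB.gi k l).val _ hJ)
    (abs_mul_le_mul (h1 k) (h1 l))
  exact (le_of_abs_le h2).trans (le_of_eq (by ring))

/-- The evolution of the comparison function `-Q₀ exp (p (η - η₀))` at the base point. -/
theorem heat_exp_comp {f : SpaceTime → ℝ} (hf : ContDiffAt ℝ 2 f z) (m : Fin 2 → Fin 2 → ℝ)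
    (q p : ℝ) :
    heat m (fun w => -(q * Real.exp (p * (f w - f z)))) z = -(q * (p * heat m f z
      - p ^ 2 * ∑ k, ∑ l, m k l * (pder (vs k) f z * pder (vs l) f z))) := by
  have hd : ∀ s : ℝ, HasDerivAt (fun s => -(q * Real.exp (p * (s - f z))))
      (-(q * (p * Real.exp (p * (s - f z))))) s := fun s => by
    have h1 : HasDerivAt (fun s => p * (s - f z)) p s := by
      simpa using ((hasDerivAt_id s).sub_const (f z)).const_mul p
    have := (h1.exp.const_mul q).neg
    exact this.congr_deriv (by ring)
  have hd2 : ∀ s : ℝ, HasDerivAt (fun s => -(q * (p * Real.exp (p * (s - f z)))))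
      (-(q * (p * (p * Real.exp (p * (s - f z)))))) s := fun s => by
    have h1 : HasDerivAt (fun s => p * (s - f z)) p s := by
      simpa using ((hasDerivAt_id s).sub_const (f z)).const_mul p
    have := ((h1.exp.const_mul p).const_mul q).neg
    exact this.congr_deriv (by ring)
  have hsm : ContDiff ℝ 2 (fun s : ℝ => -(q * Real.exp (p * (s - f z)))) := by fun_prop
  rw [heat_comp (Ψ := fun s : ℝ => -(q * Real.exp (p * (s - f z)))) hsm.contDiffAt hf]
  have hp1 : ∀ (b : ℝ), pder b (fun s : ℝ => -(q * Real.exp (p * (s - f z)))) =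
      fun s => -(q * (p * Real.exp (p * (s - f z)))) * b := fun b => by
    funext s
    simp only [pder]
    rw [(hd s).hasFDerivAt.fderiv]
    simp [mul_comm]
  have hp2 : ∀ a b : ℝ, pder a (pder b (fun s : ℝ => -(q * Real.exp (p * (s - f z))))) (f z) =
      -(q * p ^ 2) * (a * b) := fun a b => by
    rw [hp1 b]
    simp only [pder]
    rw [((hd2 (f z)).mul_const b).hasFDerivAt.fderiv]
    simp; ring
  have hp3 : fderiv ℝ (fun s : ℝ => -(q * Real.exp (p * (s - f z)))) (f z) (heat m f z) =
      -(q * p) * heat m f z := by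
    rw [(hd (f z)).hasFDerivAt.fderiv]
    simp; ring
  simp only [hp2, hp3, Fin.sum_univ_two]
  ring

/-- The parabolic maximum principle: `∂ₜ f - m^{kl} ∂ₖ∂ₗ f ≥ 0` at a maximum over past times. -/
theorem heat_nonneg_of_max {f : SpaceTime → ℝ} (hf : ContDiffAt ℝ 2 f z)
    {m : Fin 2 → Fin 2 → ℝ} (hm : ∀ k l, m k l = m l k)
    (hm1 : ∀ x : Fin 2 → ℝ, 0 ≤ ∑ k, ∑ l, m k l * (x k * x l))
    (hmax : ∀ᶠ w in nhds z, w.1 ≤ z.1 → f w ≤ f z) : 0 ≤ heat m f z := by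
  have htend : ∀ v : SpaceTime, Filter.Tendsto (fun s : ℝ => z + s • v) (nhds 0) (nhds z) :=
    fun v => by
      have : Continuous fun s : ℝ => z + s • v := by fun_prop
      simpa using this.tendsto 0
  have h1 : 0 ≤ pder vt f z := by
    refine pder_nonneg_of_left_max (differentiableAt_of_contDiffAt_two hf) _ ?_
    have h2 := ((htend vt).eventually hmax).filter_mono (nhdsWithin_le_nhds (s := Set.Iic 0))
    filter_upwards [h2, self_mem_nhdsWithin] with s hs hs0
    refine hs ?_
    simpa [vt] using hs0
  have h3 : ∀ v : E 2, pder ((0, v) : SpaceTime) (pder ((0, v) : SpaceTime) f) z ≤ 0 := fun v => by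
    refine pder_pder_nonpos_of_isLocalMax hf _ ?_
    filter_upwards [(htend (0, v)).eventually hmax] with s hs
    exact hs (by simp)
  -- Minus the spatial Hessian at a maximum is a nonnegative form, so its trace against the
  -- nonnegative `m` is nonnegative.
  have h4 := trace_mul_lower (m := m) (lam := 0)
    (b := fun k l => -pder (vs k) (pder (vs l) f) z) hm
    (fun k l => by rw [pder_pder_comm hf]) (fun x => by simpa using hm1 x) (fun x => by
      have h5 := h3 (x 0 • dir 0 + x 1 • dir 1)
      have e : ((0, x 0 • dir 0 + x 1 • dir 1) : SpaceTime) = x 0 • vs 0 + x 1 • vs 1 := by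
        simp [vs]
      rw [e, pder_pder_eq hf] at h5
      simp only [map_add, map_smul, add_apply, smul_apply, smul_eq_mul] at h5
      simp only [Fin.sum_univ_two, pder_pder_eq hf]
      linarith)
  simp only [heat, smul_eq_mul]
  simp only [zero_mul, mul_neg, Finset.sum_neg_distrib] at h4
  linarith

/-- The order of choices is the point. The parameter p is fixed first, so that p c c₁ beats the
quartic constant; then δ is chosen from p, so that the two δ-terms use up at most half of c. If Q
exceeded R, then r would be large enough to absorb the additive constants, and the quartic terms
would contradict the sign. -/
theorem algebraic_bound {C c c₁ C₁ C₂ : ℝ} (hC : 0 < C) (hc : 0 < c) (hc₁ : 0 < c₁) (hC₁ : 0 < C₁)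
    (hC₂ : 0 ≤ C₂) :
    ∃ p₀ : ℝ, ∀ p ≥ p₀, ∃ δ > 0, ∃ R : ℝ, ∀ r Q Lq Le Ge : ℝ, 1 ≤ r →
      c₁ * r ^ 2 - C₁ ≤ Q → Q ≤ C₂ * r ^ 2 → Lq ≤ C * r ^ 4 →
      c * r ^ 2 - C - C * δ * r ^ 2 ≤ Le → Ge ≤ C * δ ^ 2 * r ^ 2 →
      0 ≤ Lq - Q * (p * Le - p ^ 2 * Ge) → Q ≤ R := by
  -- The comparison at the end needs (c₁/2) · p · (c/4) > C, for which 8C/(c c₁) would suffice.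
  refine ⟨16 * C / (c * c₁) + 1, fun p hp => ?_⟩
  have hp0 : 0 < p := lt_of_lt_of_le (by positivity) hp
  set δ := min (c / (4 * C)) (min 1 (c / (4 * C * p))) with hδ
  have hδ0 : 0 < δ := by positivity
  have d1 : C * δ ≤ c / 4 := by
    have : δ ≤ c / (4 * C) := min_le_left _ _
    calc C * δ ≤ C * (c / (4 * C)) := by gcongr
      _ = c / 4 := by field_simp
  have d2 : p * (C * δ ^ 2) ≤ c / 4 := by
    have h1 : δ ≤ 1 := (min_le_right _ _).trans (min_le_left _ _)
    have h2 : δ ≤ c / (4 * C * p) := (min_le_right _ _).trans (min_le_right _ _)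
    calc p * (C * δ ^ 2) ≤ p * (C * (c / (4 * C * p))) := by
          have : δ ^ 2 ≤ c / (4 * C * p) := by nlinarith
          gcongr
      _ = c / 4 := by field_simp
  -- As Q ≤ C₂ r², exceeding this R forces r² > 2C₁/c₁ + 4C/c, so that C₁ and C are absorbed by c₁
  -- r² / 2 and c r² / 4.
  refine ⟨δ, hδ0, C₂ * (2 * C₁ / c₁ + 4 * C / c), fun r Q Lq Le Ge hr hQ1 hQ2 hq he hg h0 => ?_⟩
  by_contra hcon
  push Not at hcon
  have hr2 : 2 * C₁ / c₁ + 4 * C / c < r ^ 2 := by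
    by_contra h
    push Not at h
    have : C₂ * r ^ 2 ≤ C₂ * (2 * C₁ / c₁ + 4 * C / c) := by gcongr
    linarith
  have hra : 2 * C₁ < c₁ * r ^ 2 := by
    have : 2 * C₁ / c₁ < r ^ 2 := lt_of_le_of_lt (by
      have : 0 ≤ 4 * C / c := by positivity
      linarith) hr2
    rw [div_lt_iff₀ hc₁] at this; linarith
  have hrb : 4 * C < c * r ^ 2 := by
    have : 4 * C / c < r ^ 2 := lt_of_le_of_lt (by
      have : 0 ≤ 2 * C₁ / c₁ := by positivity
      linarith) hr2
    rw [div_lt_iff₀ hc] at this; linarith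
  have hQ3 : c₁ / 2 * r ^ 2 ≤ Q := by linarith
  have hr0 : 0 < r ^ 2 := by positivity
  have e1 : C * δ * r ^ 2 ≤ c / 4 * r ^ 2 := by gcongr
  have e2 : p * Ge ≤ c / 4 * r ^ 2 := by
    calc p * Ge ≤ p * (C * δ ^ 2 * r ^ 2) := by gcongr
      _ = p * (C * δ ^ 2) * r ^ 2 := by ring
      _ ≤ _ := by gcongr
  have e3 : c / 4 * r ^ 2 ≤ Le - p * Ge := by linarith
  have e4 : Q * (p * (c / 4 * r ^ 2)) ≤ Q * (p * Le - p ^ 2 * Ge) := by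
    have hQ0 : 0 ≤ Q := le_trans (by positivity) hQ3
    have : p * (c / 4 * r ^ 2) ≤ p * (Le - p * Ge) := by gcongr
    have h5 : p * (Le - p * Ge) = p * Le - p ^ 2 * Ge := by ring
    rw [← h5]; gcongr
  have e5 : c₁ / 2 * r ^ 2 * (p * (c / 4 * r ^ 2)) ≤ Q * (p * (c / 4 * r ^ 2)) := by gcongr
  have e6 : C * r ^ 4 < c₁ / 2 * r ^ 2 * (p * (c / 4 * r ^ 2)) := by
    have h7 : 16 * C / (c * c₁) < p := by linarith
    rw [div_lt_iff₀ (by positivity)] at h7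
    have h8 : C < c₁ / 2 * p * (c / 4) := by nlinarith
    calc C * r ^ 4 < c₁ / 2 * p * (c / 4) * r ^ 4 := by gcongr
      _ = _ := by ring
  linarith

/-- The a priori bound for `Q` at a maximum of `Q exp (-p η)` over past times. -/
theorem exists_bound_at_max (hB : Sy.Bounds B K) (hE : Sy.Elliptic K)
    (hη : ContDiffOn ℝ ∞ eta Sy.dom) (hb : BoundedTwo B K eta) (hc : 0 < c)
    (hcv : ConcaveOnFibers c K eta) :
    ∃ p₀ : ℝ, ∀ p ≥ p₀, ∃ δ > 0, ∃ R : ℝ, ∀ (O : Set SpaceTime) (u : Fin 2 → SpaceTime → ℝ)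
      (z : SpaceTime), Sy.IsSolution O u → z ∈ O → jet u z ∈ K →
      ‖fderiv ℝ eta (jet u z)‖ ≤ δ →
      (∀ w ∈ O, w.1 ≤ z.1 → Sy.Q u w * Real.exp (-(p * eta (jet u w)))
        ≤ Sy.Q u z * Real.exp (-(p * eta (jet u z)))) → Sy.Q u z ≤ R := by
  have hB1 := hB.one_le
  have hB0 : 0 < B := by linarith
  set C := ((18432 * B ^ 6) ^ 2 + 18432 * B ^ 6 + B ^ 4) + (c + 288 * B ^ 8 / c) + 12 * B ^ 3
  obtain ⟨p₀, hp₀⟩ := algebraic_bound (C := C) (c := c / 8) (c₁ := 1 / 8) (C₁ := 1 + B ^ 2)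
    (C₂ := 256 * B ^ 3) (by positivity) (by positivity) (by positivity) (by positivity)
    (by positivity)
  have k1 : ((18432 * B ^ 6) ^ 2 + 18432 * B ^ 6 + B ^ 4) ≤ C := by
    have : 0 ≤ (c + 288 * B ^ 8 / c) + 12 * B ^ 3 := by positivity
    simp only [C]; linarith
  have k2 : c + 288 * B ^ 8 / c ≤ C := by
    have : 0 ≤ ((18432 * B ^ 6) ^ 2 + 18432 * B ^ 6 + B ^ 4) + 12 * B ^ 3 := by positivity
    simp only [C]; linarith
  have k3 : 12 * B ^ 3 ≤ C := by
    have : 0 ≤ ((18432 * B ^ 6) ^ 2 + 18432 * B ^ 6 + B ^ 4) + (c + 288 * B ^ 8 / c) := by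
      positivity
    simp only [C]; linarith
  refine ⟨p₀, fun p hp => ?_⟩
  obtain ⟨δ, hδ0, R, hR⟩ := hp₀ p hp
  refine ⟨δ, hδ0, R, fun O u z h hz hJ hδ hmax => ?_⟩
  have hs := h.smooth_comp hη
  set f : SpaceTime → ℝ := fun w => eta (jet u w) with hf
  have hfz := contDiffAt_two_of_contDiffOn hs h.isOpen hz
  -- The product Q exp(-pη) need not be differentiated. Its maximality at z says that Q + G is
  -- maximal there, with value zero, and the heat operator of G is explicit.
  set G : SpaceTime → ℝ := fun w => -(Sy.Q u z * Real.exp (p * (f w - f z))) with hG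
  have hGs : ContDiffOn ℝ ∞ G O :=
    (contDiffOn_const.mul ((contDiffOn_const.mul (hs.sub contDiffOn_const)).exp)).neg
  set m : Fin 2 → Fin 2 → ℝ := fun k l => Sy.gi k l (jet u z)
  have h1 : 0 ≤ heat m (fun w => Sy.Q u w + G w) z := by
    refine heat_nonneg_of_max (contDiffAt_two_of_contDiffOn (h.smooth_Q.add hGs) h.isOpen hz)
      (fun k l => Sy.symm_gi k l _) (fun x => le_trans (by positivity) (hE.gi _ hJ x)) ?_
    filter_upwards [h.isOpen.mem_nhds hz] with w hw hwt
    have h2 : Sy.Q u w * Real.exp (-(p * f w)) ≤ Sy.Q u z * Real.exp (-(p * f z)) := hmax w hw hwt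
    have h3 : Sy.Q u w ≤ Sy.Q u z * Real.exp (p * (f w - f z)) := by
      have h4 := mul_le_mul_of_nonneg_right h2 (Real.exp_pos (p * f w)).le
      rw [mul_assoc, ← Real.exp_add, mul_assoc, ← Real.exp_add] at h4
      simp only [neg_add_cancel, Real.exp_zero, mul_one] at h4
      refine h4.trans (le_of_eq ?_)
      congr 2; ring
    simp only [hG, sub_self, mul_zero, Real.exp_zero, mul_one]
    linarith
  rw [heat_add h.isOpen h.smooth_Q hGs hz, heat_exp_comp hfz] at h1
  have hρ := one_le_rho u z
  have hr2 : 0 ≤ rho u z ^ 2 := by positivity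
  refine hR (rho u z) _ (heat m (Sy.Q u) z) (heat m f z)
    (∑ k, ∑ l, m k l * (pder (vs k) f z * pder (vs l) f z)) hρ ?_ (Q_le hB hJ) ?_ ?_ ?_ (by linarith)
  · linarith [le_Q hB hE hJ]
  · refine (heat_Q_le h hB hE hz hJ).trans ?_
    gcongr
  · refine le_trans ?_ (le_heat_eta h hB hE hz hJ hη hb hc hcv hδ)
    have : 12 * B ^ 3 * δ * rho u z ^ 2 ≤ C * δ * rho u z ^ 2 := by gcongr
    linarith
  · refine (gradient_eta_le h hB hz hJ hη hδ).trans ?_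
    have : 4 * B ^ 3 ≤ C := by
      have : 0 ≤ B ^ 3 := by positivity
      linarith
    gcongr

end GraphSystem

end GraphEstimates

end SurfaceMCF

end

noncomputable section

namespace SurfaceMCF

/-! ### Pointwise algebra of surfaces -/

section PlaneAlgebra

variable {m : ℕ} (b : E m →L[ℝ] E m →L[ℝ] ℝ) (T : Fin 2 → E m)

/-- The Gram matrix of two vectors. -/
def gramA : Matrix (Fin 2) (Fin 2) ℝ := Matrix.of fun i j => b (T i) (T j)

/-- The normal projection with respect to the plane spanned by `T`. -/
def norA (v : E m) : E m := v - ∑ k, ∑ l, ((gramA b T)⁻¹ k l * b v (T k)) • T l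

/-- The squared norm of the normal part of the Hessian `h`. -/
def sffNormSqA (h : Fin 2 → Fin 2 → E m) : ℝ :=
  ∑ i, ∑ j, ∑ k, ∑ l, (gramA b T)⁻¹ i j * (gramA b T)⁻¹ k l
    * b (norA b T (h i k)) (norA b T (h j l))

/-- The trace of the normal part of the Hessian `h`. -/
def meanA (h : Fin 2 → Fin 2 → E m) : E m := ∑ k, ∑ l, (gramA b T)⁻¹ k l • norA b T (h k l)

/-- The value of the two-form `w` on the unit two-vector of the plane spanned by `T`. -/
def starA (w : E m →L[ℝ] E m →L[ℝ] ℝ) : ℝ := w (T 0) (T 1) / Real.sqrt (gramA b T).det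

theorem sffNormSq_eq (G : E m → E m →L[ℝ] E m →L[ℝ] ℝ) (f : E 2 → E m) (z : E 2) :
    sffNormSq (fun y a b => G y a b) f z =
      sffNormSqA (G (f z)) (pd f z) (ambientHess (fun y a b => G y a b) f z) := rfl

theorem meanCurv_eq (G : E m → E m →L[ℝ] E m →L[ℝ] ℝ) (f : E 2 → E m) (z : E 2) :
    meanCurv (fun y a b => G y a b) f z =
      meanA (G (f z)) (pd f z) (ambientHess (fun y a b => G y a b) f z) := rfl

theorem starPullback_eq (G W : E m → E m →L[ℝ] E m →L[ℝ] ℝ) (f : E 2 → E m) (z : E 2) :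
    starPullback (fun y a b => G y a b) f (fun y a b => W y a b) z =
      starA (G (f z)) (pd f z) (W (f z)) := rfl

variable {b T}

theorem norA_add (v w : E m) : norA b T (v + w) = norA b T v + norA b T w := by
  simp only [norA, map_add, add_apply, Fin.sum_univ_two]
  module

theorem norA_smul (c : ℝ) (v : E m) : norA b T (c • v) = c • norA b T v := by
  simp only [norA, map_smul, smul_apply, Fin.sum_univ_two, smul_eq_mul]
  module

theorem norA_sum {ι : Type*} (s : Finset ι) (v : ι → E m) :
    norA b T (∑ i ∈ s, v i) = ∑ i ∈ s, norA b T (v i) := by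
  classical
  induction s using Finset.induction_on with
  | empty => simp [norA]
  | insert i s hi ih => rw [Finset.sum_insert hi, Finset.sum_insert hi, norA_add, ih]

theorem norA_tangent (hdet : (gramA b T).det ≠ 0) (k : Fin 2) : norA b T (T k) = 0 := by
  have h := Matrix.mul_nonsing_inv (gramA b T) (isUnit_iff_ne_zero.2 hdet)
  have h1 : ∀ l, ∑ j, (gramA b T)⁻¹ j l * b (T k) (T j) = if k = l then 1 else 0 := fun l => by
    have := congrFun (congrFun h k) l
    rw [Matrix.mul_apply, Matrix.one_apply] at this
    rw [← this]
    exact Finset.sum_congr rfl fun j _ => mul_comm _ _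
  simp only [norA]
  rw [Finset.sum_comm]
  simp only [← Finset.sum_smul, h1]
  fin_cases k <;> simp

/-! ### Independence of the basis of the tangent plane. -/

section BasisChange

variable {P : Matrix (Fin 2) (Fin 2) ℝ} {T' : Fin 2 → E m}

theorem gramA_basisChange (hT : ∀ i, T' i = ∑ k, P i k • T k) :
    gramA b T' = P * gramA b T * Pᵀ := by
  ext i j
  simp only [gramA, Matrix.of_apply, Matrix.mul_apply, hT, Matrix.transpose_apply,
    map_smul, smul_apply, smul_eq_mul, Fin.sum_univ_two, add_apply, map_add]
  ring

theorem det_gramA_basisChange (hT : ∀ i, T' i = ∑ k, P i k • T k) :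
    (gramA b T').det = P.det ^ 2 * (gramA b T).det := by
  rw [gramA_basisChange hT, Matrix.det_mul, Matrix.det_mul, Matrix.det_transpose]; ring

theorem inv_gramA_basisChange (hT : ∀ i, T' i = ∑ k, P i k • T k) (hP : P.det ≠ 0) :
    (gramA b T)⁻¹ = Pᵀ * (gramA b T')⁻¹ * P := by
  have hu : IsUnit P.det := isUnit_iff_ne_zero.2 hP
  rw [gramA_basisChange hT, Matrix.mul_inv_rev, Matrix.mul_inv_rev]
  have h1 : Pᵀ * (Pᵀ)⁻¹ = 1 := Matrix.mul_nonsing_inv _ (by rwa [Matrix.det_transpose])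
  have h2 : P⁻¹ * P = 1 := Matrix.nonsing_inv_mul _ hu
  calc (gramA b T)⁻¹ = 1 * (gramA b T)⁻¹ * 1 := by simp
    _ = (Pᵀ * (Pᵀ)⁻¹) * (gramA b T)⁻¹ * (P⁻¹ * P) := by rw [h1, h2]
    _ = _ := by simp only [Matrix.mul_assoc]

/-- The inverse Gram matrix transforms contravariantly, so its contraction with covariant components
is invariant. Allowing values in any module covers the normal projection, the mean curvature vector
and |A|² at once. -/
theorem contract_basisChange (hT : ∀ i, T' i = ∑ k, P i k • T k) (hP : P.det ≠ 0)
    {W : Type*} [AddCommGroup W] [Module ℝ W] (X : Fin 2 → Fin 2 → W) :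
    ∑ i, ∑ j, (gramA b T')⁻¹ i j • ∑ k, ∑ l, (P i k * P j l) • X k l =
      ∑ k, ∑ l, (gramA b T)⁻¹ k l • X k l := by
  have h := inv_gramA_basisChange (b := b) hT hP
  have h1 : ∀ k l, (gramA b T)⁻¹ k l = ∑ j, (∑ i, P i k * (gramA b T')⁻¹ i j) * P j l :=
    fun k l => by rw [h]; simp [Matrix.mul_apply]
  simp only [h1, Fin.sum_univ_two]
  module

theorem norA_basisChange (hT : ∀ i, T' i = ∑ k, P i k • T k) (hP : P.det ≠ 0) (v : E m) :
    norA b T' v = norA b T v := by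
  have h := contract_basisChange (b := b) hT hP (fun k l => b v (T k) • T l)
  simp only [norA]
  congr 1
  simp only [mul_smul]
  rw [← h]
  refine Finset.sum_congr rfl fun i _ => Finset.sum_congr rfl fun j _ => ?_
  congr 1
  rw [hT i, hT j]
  simp only [map_add, map_smul, Fin.sum_univ_two, smul_eq_mul]
  module

variable {h h' : Fin 2 → Fin 2 → E m} {c : Fin 2 → Fin 2 → Fin 2 → ℝ}

/-- The terms `c i j k • T k` model the second derivatives of a reparametrisation; they are
tangential, hence invisible to the normal projection. -/
theorem norA_hess_basisChange (hT : ∀ i, T' i = ∑ k, P i k • T k) (hP : P.det ≠ 0)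
    (hdet : (gramA b T).det ≠ 0)
    (hh : ∀ i j, h' i j = (∑ k, ∑ l, (P i k * P j l) • h k l) + ∑ k, c i j k • T k) (i j : Fin 2) :
    norA b T' (h' i j) = ∑ k, ∑ l, (P i k * P j l) • norA b T (h k l) := by
  rw [norA_basisChange hT hP, hh, norA_add, norA_sum, norA_sum]
  simp only [norA_sum, norA_smul, norA_tangent hdet, smul_zero, Finset.sum_const_zero, add_zero]

theorem meanA_basisChange (hT : ∀ i, T' i = ∑ k, P i k • T k) (hP : P.det ≠ 0)
    (hdet : (gramA b T).det ≠ 0)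
    (hh : ∀ i j, h' i j = (∑ k, ∑ l, (P i k * P j l) • h k l) + ∑ k, c i j k • T k) :
    meanA b T' h' = meanA b T h := by
  simp only [meanA, norA_hess_basisChange hT hP hdet hh]
  exact contract_basisChange hT hP _

theorem sffNormSqA_eq_contract (h : Fin 2 → Fin 2 → E m) : sffNormSqA b T h =
    ∑ i, ∑ j, (gramA b T)⁻¹ i j • ∑ k, ∑ l, (gramA b T)⁻¹ k l •
      b (norA b T (h i k)) (norA b T (h j l)) := by
  simp only [sffNormSqA, smul_eq_mul, Finset.mul_sum, mul_assoc]

theorem sffNormSqA_basisChange (hT : ∀ i, T' i = ∑ k, P i k • T k) (hP : P.det ≠ 0)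
    (hdet : (gramA b T).det ≠ 0)
    (hh : ∀ i j, h' i j = (∑ k, ∑ l, (P i k * P j l) • h k l) + ∑ k, c i j k • T k) :
    sffNormSqA b T' h' = sffNormSqA b T h := by
  rw [sffNormSqA_eq_contract, sffNormSqA_eq_contract,
    ← contract_basisChange (b := b) hT hP (fun k l => ∑ p, ∑ q, (gramA b T)⁻¹ p q •
      b (norA b T (h k p)) (norA b T (h l q)))]
  refine Finset.sum_congr rfl fun i _ => Finset.sum_congr rfl fun j _ => ?_
  congr 1
  have e : ∀ k l, ∑ p, ∑ q, (gramA b T)⁻¹ p q • b (norA b T (h k p)) (norA b T (h l q)) =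
      ∑ p, ∑ q, (gramA b T')⁻¹ p q • ∑ s, ∑ t, (P p s * P q t) •
        b (norA b T (h k s)) (norA b T (h l t)) := fun k l =>
    (contract_basisChange (b := b) hT hP
      (fun p q => b (norA b T (h k p)) (norA b T (h l q)))).symm
  simp only [e]
  simp only [norA_hess_basisChange hT hP hdet hh, map_smul, smul_apply,
    smul_eq_mul, Fin.sum_univ_two, map_add, add_apply]
  ring

/-- The numerator scales by det P and the denominator by |det P|, so only the absolute value is
invariant under all changes of basis. -/
theorem abs_starA_basisChange (hT : ∀ i, T' i = ∑ k, P i k • T k) (hP : P.det ≠ 0)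
    {w : E m →L[ℝ] E m →L[ℝ] ℝ} (hw : ∀ v, w v v = 0) :
    |starA b T' w| = |starA b T w| := by
  have hw' : ∀ v v', w v' v = -w v v' := fun v v' => by
    have := hw (v + v')
    simp only [map_add, add_apply, hw] at this
    linarith
  have h1 : w (T' 0) (T' 1) = P.det * w (T 0) (T 1) := by
    rw [hT 0, hT 1, Matrix.det_fin_two]
    simp only [Fin.sum_univ_two, map_add, map_smul, add_apply, smul_apply, smul_eq_mul, hw,
      hw' (T 0) (T 1)]
    ring
  rw [starA, starA, det_gramA_basisChange hT, h1, Real.sqrt_mul (sq_nonneg _), Real.sqrt_sq_eq_abs,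
    abs_div, abs_div, abs_mul, abs_mul, abs_abs, mul_div_mul_left _ _ (abs_ne_zero.2 hP)]

end BasisChange

/-! ### Invariance under linear isometries of the ambient space. -/

section TargetChange

variable {b' : E m →L[ℝ] E m →L[ℝ] ℝ} {A : E m →L[ℝ] E m}

theorem gramA_targetChange (hA : ∀ v w, b' (A v) (A w) = b v w) :
    gramA b' (fun i => A (T i)) = gramA b T := by
  ext i j; simp [gramA, hA]

theorem norA_targetChange (hA : ∀ v w, b' (A v) (A w) = b v w) (v : E m) :
    norA b' (fun i => A (T i)) (A v) = A (norA b T v) := by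
  simp only [norA, gramA_targetChange hA, hA, map_sub, map_sum, map_smul]

theorem sffNormSqA_targetChange (hA : ∀ v w, b' (A v) (A w) = b v w)
    (h : Fin 2 → Fin 2 → E m) :
    sffNormSqA b' (fun i => A (T i)) (fun i j => A (h i j)) = sffNormSqA b T h := by
  simp only [sffNormSqA, gramA_targetChange hA, norA_targetChange hA, hA]

theorem starA_targetChange (hA : ∀ v w, b' (A v) (A w) = b v w)
    {w w' : E m →L[ℝ] E m →L[ℝ] ℝ} (hw : ∀ v v', w' (A v) (A v') = w v v') :
    starA b' (fun i => A (T i)) w' = starA b T w := by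
  simp only [starA, gramA_targetChange hA, hw]

end TargetChange

end PlaneAlgebra

end SurfaceMCF

end

noncomputable section

namespace SurfaceMCF

/-! ### Coordinate changes -/

section CoordinateChange

variable {m : ℕ}

/-- Symmetric positive definite bilinear forms. -/
structure IsInner (b : E m →L[ℝ] E m →L[ℝ] ℝ) : Prop where
  symm : ∀ v w, b v w = b w v
  pos : ∀ v, v ≠ 0 → 0 < b v v

/-- A field of continuous bilinear forms as a function of three variables. -/
abbrev unb (G : E m → E m →L[ℝ] E m →L[ℝ] ℝ) : E m → E m → E m → ℝ := fun y a b => G y a b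

theorem sum_apply_dir {n : ℕ} (v : E n) : ∑ i, v i • (dir i : E n) = v := by
  ext j
  simp [dir, Pi.single_apply]

namespace IsInner

variable {b : E m →L[ℝ] E m →L[ℝ] ℝ} (hb : IsInner b)

include hb

theorem ext {v w : E m} (h : ∀ c, b v c = b w c) : v = w := by
  by_contra hne
  have h1 := hb.pos (v - w) (sub_ne_zero.2 hne)
  have h2 : b (v - w) (v - w) = 0 := by
    rw [map_sub b v w, sub_apply, h, sub_self]
  linarith

theorem det_metricMatrix_ne_zero : (Matrix.of fun A B => b (dir A) (dir B)).det ≠ 0 := by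
  intro h0
  obtain ⟨v, hv, h⟩ := Matrix.exists_mulVec_eq_zero_iff.2 h0
  obtain ⟨x, hx⟩ : ∃ x : E m, x = ∑ i, v i • (dir i : E m) := ⟨_, rfl⟩
  have hxi : ∀ i, x i = v i := fun i => by simp [hx, dir, Pi.single_apply]
  have hx0 : x ≠ 0 := fun h => hv (funext fun i => by rw [← hxi, h]; rfl)
  have h1 := hb.pos x hx0
  have h2 : ∀ A, b (dir A) x = 0 := fun A => by
    have := congrFun h A
    simp only [Matrix.mulVec, dotProduct, Matrix.of_apply, Pi.zero_apply] at this
    rw [hx, map_sum]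
    simp only [map_smul, smul_eq_mul]
    rw [← this]
    exact Finset.sum_congr rfl fun i _ => mul_comm _ _
  have h3 : b x x = 0 := by
    have h4 : b x = ∑ i, v i • b (dir i) := by rw [hx]; simp
    rw [h4]
    simp [h2]
  linarith

/-- Strict Cauchy-Schwarz, from positivity at the nonzero vector b(v,v) w - b(v,w) v. -/
theorem inner_sq_lt {v w : E m} (h : LinearIndependent ℝ ![v, w]) :
    0 < b v v * b w w - b v w * b w v := by
  have hv : v ≠ 0 := h.ne_zero 0
  have h1 := hb.pos v hv
  have h2 : b v v • w - b v w • v ≠ 0 := fun h0 => by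
    have := LinearIndependent.pair_iff.1 h (-(b v w)) (b v v) (by rw [← h0]; module)
    exact h1.ne' this.2
  have h3 := hb.pos _ h2
  simp only [map_sub, map_smul, sub_apply, smul_apply, smul_eq_mul, hb.symm w v] at h3
  rw [hb.symm w v]
  have h4 : 0 < b v v * (b v v * b w w - b v w * b v w) := by nlinarith
  exact pos_of_mul_pos_right h4 h1.le

theorem det_gramA_pos {T : Fin 2 → E m} (hT : LinearIndependent ℝ T) : 0 < (gramA b T).det := by
  have h : LinearIndependent ℝ ![T 0, T 1] := by
    convert hT using 1
    funext i; fin_cases i <;> rfl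
  rw [Matrix.det_fin_two]
  simpa [gramA] using hb.inner_sq_lt h

end IsInner

variable {G G' : E m → E m →L[ℝ] E m →L[ℝ] ℝ} {y : E m}

theorem fderiv_apply_apply (hG : DifferentiableAt ℝ G y) (a b c : E m) :
    fderiv ℝ (fun z => G z b c) y a = fderiv ℝ G y a b c := by
  have h1 : DifferentiableAt ℝ (fun z => G z b) y := hG.clm_apply (differentiableAt_const b)
  rw [fderiv_clm_apply h1 (differentiableAt_const c)]
  simp only [add_apply, ContinuousLinearMap.comp_apply, ContinuousLinearMap.flip_apply]
  rw [fderiv_clm_apply hG (differentiableAt_const b)]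
  simp

theorem christoffelLower_eq (hG : DifferentiableAt ℝ G y) (a b c : E m) :
    christoffelLower (unb G) y a b c =
      (fderiv ℝ G y a b c + fderiv ℝ G y b a c - fderiv ℝ G y c a b) / 2 := by
  simp only [christoffelLower, unb, fderiv_apply_apply hG]

/-- Pairing with the metric removes the inverse matrix. Bilinearity and the transformation law can
then be checked against all vectors, using nondegeneracy. -/
theorem inner_christoffel (hG : DifferentiableAt ℝ G y) (hi : IsInner (G y)) (a b c : E m) :
    G y (christoffel (unb G) y a b) c = christoffelLower (unb G) y a b c := by
  set M := metricMatrix (unb G) y with hM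
  have hu : IsUnit M.det := isUnit_iff_ne_zero.2 hi.det_metricMatrix_ne_zero
  have h1 := Matrix.mul_nonsing_inv M hu
  have h2 : ∀ E', G y (christoffel (unb G) y a b) (dir E') =
      christoffelLower (unb G) y a b (dir E') := fun E' => by
    simp only [christoffel, map_sum, map_smul, sum_apply, smul_apply, smul_eq_mul, ← hM]
    have h3 : ∀ C, G y (dir C) (dir E') = M E' C := fun C => by
      rw [hi.symm]; rfl
    simp only [h3, Finset.sum_mul]
    rw [Finset.sum_comm]
    have h4 : ∀ D, ∑ C, M⁻¹ C D * christoffelLower (unb G) y a b (dir D) * M E' C =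
        (if E' = D then 1 else 0) * christoffelLower (unb G) y a b (dir D) := fun D => by
      have := congrFun (congrFun h1 E') D
      rw [Matrix.mul_apply, Matrix.one_apply] at this
      rw [← this, Finset.sum_mul]
      exact Finset.sum_congr rfl fun C _ => by ring
    simp [h4]
  rw [← sum_apply_dir c]
  simp only [christoffelLower_eq hG] at h2 ⊢
  simp only [map_sum, map_smul, h2, sum_apply, smul_apply, smul_eq_mul, ← Finset.sum_add_distrib,
    ← Finset.sum_sub_distrib, Finset.sum_div]
  exact Finset.sum_congr rfl fun C _ => by ring

theorem christoffel_add_left (hG : DifferentiableAt ℝ G y) (hi : IsInner (G y)) (a a' b : E m) :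
    christoffel (unb G) y (a + a') b = christoffel (unb G) y a b + christoffel (unb G) y a' b := by
  refine hi.ext fun c => ?_
  rw [map_add, add_apply, inner_christoffel hG hi, inner_christoffel hG hi,
    inner_christoffel hG hi]
  simp only [christoffelLower_eq hG, map_add, add_apply]
  ring

theorem christoffel_smul_left (hG : DifferentiableAt ℝ G y) (hi : IsInner (G y)) (r : ℝ)
    (a b : E m) : christoffel (unb G) y (r • a) b = r • christoffel (unb G) y a b := by
  refine hi.ext fun c => ?_
  rw [map_smul, smul_apply, inner_christoffel hG hi, inner_christoffel hG hi]
  simp only [christoffelLower_eq hG, map_smul, smul_apply, smul_eq_mul]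
  ring

theorem christoffel_add_right (hG : DifferentiableAt ℝ G y) (hi : IsInner (G y)) (a b b' : E m) :
    christoffel (unb G) y a (b + b') = christoffel (unb G) y a b + christoffel (unb G) y a b' := by
  refine hi.ext fun c => ?_
  rw [map_add, add_apply, inner_christoffel hG hi, inner_christoffel hG hi,
    inner_christoffel hG hi]
  simp only [christoffelLower_eq hG, map_add, add_apply]
  ring

theorem christoffel_smul_right (hG : DifferentiableAt ℝ G y) (hi : IsInner (G y)) (r : ℝ)
    (a b : E m) : christoffel (unb G) y a (r • b) = r • christoffel (unb G) y a b := by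
  refine hi.ext fun c => ?_
  rw [map_smul, smul_apply, inner_christoffel hG hi, inner_christoffel hG hi]
  simp only [christoffelLower_eq hG, map_smul, smul_apply, smul_eq_mul]
  ring

/-- The transformation law of the Christoffel symbols. -/
theorem christoffel_transform {τ : E m → E m} (hτ : ContDiffAt ℝ 2 τ y)
    (hG : DifferentiableAt ℝ G y) (hG' : DifferentiableAt ℝ G' (τ y)) (hi : IsInner (G y))
    (hi' : IsInner (G' (τ y))) (hsurj : Function.Surjective (fderiv ℝ τ y))
    (hrel : ∀ᶠ x in nhds y, ∀ a b, G' (τ x) (fderiv ℝ τ x a) (fderiv ℝ τ x b) = G x a b)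
    (a b : E m) :
    fderiv ℝ τ y (christoffel (unb G) y a b) =
      christoffel (unb G') (τ y) (fderiv ℝ τ y a) (fderiv ℝ τ y b) + pder a (pder b τ) y := by
  set A := fderiv ℝ τ y with hA
  -- Derivative of the isometry relation. In the Koszul combination of three such identities, the
  -- second derivatives of τ cancel except for the one in the directions a, b.
  have hd : ∀ a b c, fderiv ℝ G y c a b = fderiv ℝ G' (τ y) (A c) (A a) (A b)
      + G' (τ y) (pder c (pder a τ) y) (A b) + G' (τ y) (A a) (pder c (pder b τ) y) := by
    intro a b c
    rw [← fderiv_apply_apply hG]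
    have he : (fun x => G x a b) =ᶠ[nhds y]
        fun x => G' (τ x) (fderiv ℝ τ x a) (fderiv ℝ τ x b) := by
      filter_upwards [hrel] with x hx
      exact (hx a b).symm
    rw [he.fderiv_eq]
    have d1 : DifferentiableAt ℝ (fun x => G' (τ x)) y :=
      DifferentiableAt.comp (G := E m →L[ℝ] E m →L[ℝ] ℝ) (g := G') y hG'
        (differentiableAt_of_contDiffAt_two hτ)
    have d2 : ∀ v, DifferentiableAt ℝ (fun x => fderiv ℝ τ x v) y := fun v =>
      (differentiableAt_fderiv hτ).clm_apply (differentiableAt_const v)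
    rw [fderiv_clm_apply (d1.clm_apply (d2 a)) (d2 b)]
    simp only [add_apply, ContinuousLinearMap.comp_apply, ContinuousLinearMap.flip_apply]
    rw [fderiv_clm_apply d1 (d2 a)]
    simp only [add_apply, ContinuousLinearMap.comp_apply, ContinuousLinearMap.flip_apply]
    have e1 := pder_comp (W := E m →L[ℝ] E m →L[ℝ] ℝ) (g := G') hG' (differentiableAt_of_contDiffAt_two hτ) c
    simp only [pder] at e1 ⊢
    rw [e1]
    exact (fun X Y Z => by ring : ∀ X Y Z : ℝ, X + (Y + Z) = Z + Y + X) _ _ _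
  refine hi'.ext fun c' => ?_
  obtain ⟨c, rfl⟩ := hsurj c'
  have h1 : G' (τ y) (A (christoffel (unb G) y a b)) (A c) =
      G y (christoffel (unb G) y a b) c := hrel.self_of_nhds _ _
  rw [h1, inner_christoffel hG hi, map_add, add_apply, inner_christoffel hG' hi',
    christoffelLower_eq hG, christoffelLower_eq hG', hd, hd, hd, pder_pder_comm hτ b a,
    pder_pder_comm hτ c a, pder_pder_comm hτ c b, hi'.symm (A a) _, hi'.symm (A b) _,
    hi'.symm (pder b (pder c τ) y) (A a), hi'.symm (A a) (pder b (pder c τ) y),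
    hi'.symm (pder b (pder c τ) y)]
  ring

theorem ambientHess_eq (f : E 2 → E m) (z : E 2) (i j : Fin 2) :
    ambientHess (unb G) f z i j = pder (dir i) (pder (dir j) f) z
      + christoffel (unb G) (f z) (pder (dir i) f z) (pder (dir j) f z) := rfl

theorem pd_eq (f : E 2 → E m) (z : E 2) (i : Fin 2) : pd f z i = pder (dir i) f z := rfl

/-- The second derivatives of τ produced by the chain rule cancel the inhomogeneous term of the
Christoffel symbols. -/
theorem ambientHess_targetChange {τ : E m → E m} {f : E 2 → E m} {z : E 2}
    (hf : ContDiffAt ℝ 2 f z) (hτ : ContDiffAt ℝ 2 τ (f z))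
    (hG : DifferentiableAt ℝ G (f z)) (hG' : DifferentiableAt ℝ G' (τ (f z)))
    (hi : IsInner (G (f z))) (hi' : IsInner (G' (τ (f z))))
    (hsurj : Function.Surjective (fderiv ℝ τ (f z)))
    (hrel : ∀ᶠ x in nhds (f z), ∀ a b, G' (τ x) (fderiv ℝ τ x a) (fderiv ℝ τ x b) = G x a b)
    (i j : Fin 2) :
    ambientHess (unb G') (fun w => τ (f w)) z i j =
      fderiv ℝ τ (f z) (ambientHess (unb G) f z i j) := by
  have hp : ∀ v, pder v (fun w => τ (f w)) z = fderiv ℝ τ (f z) (pder v f z) := fun v =>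
    pder_comp (differentiableAt_of_contDiffAt_two hτ) (differentiableAt_of_contDiffAt_two hf) v
  rw [ambientHess_eq, ambientHess_eq, pder_pder_comp hτ hf, hp, hp, map_add,
    christoffel_transform hτ hG hG' hi hi' hsurj hrel]
  abel

theorem sffNormSq_targetChange {τ : E m → E m} {f : E 2 → E m} {z : E 2}
    (hf : ContDiffAt ℝ 2 f z) (hτ : ContDiffAt ℝ 2 τ (f z))
    (hG : DifferentiableAt ℝ G (f z)) (hG' : DifferentiableAt ℝ G' (τ (f z)))
    (hi : IsInner (G (f z))) (hi' : IsInner (G' (τ (f z))))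
    (hsurj : Function.Surjective (fderiv ℝ τ (f z)))
    (hrel : ∀ᶠ x in nhds (f z), ∀ a b, G' (τ x) (fderiv ℝ τ x a) (fderiv ℝ τ x b) = G x a b) :
    sffNormSq (unb G') (fun w => τ (f w)) z = sffNormSq (unb G) f z := by
  rw [sffNormSq_eq, sffNormSq_eq]
  have hp : pd (fun w => τ (f w)) z = fun i => fderiv ℝ τ (f z) (pd f z i) := funext fun i =>
    pder_comp (differentiableAt_of_contDiffAt_two hτ) (differentiableAt_of_contDiffAt_two hf) _
  have hh : ambientHess (unb G') (fun w => τ (f w)) z =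
      fun i j => fderiv ℝ τ (f z) (ambientHess (unb G) f z i j) := by
    funext i j
    exact ambientHess_targetChange hf hτ hG hG' hi hi' hsurj hrel i j
  rw [hp, hh]
  exact sffNormSqA_targetChange (fun v w => hrel.self_of_nhds v w) _

theorem starPullback_targetChange {τ : E m → E m} {f : E 2 → E m} {z : E 2}
    {W W' : E m → E m →L[ℝ] E m →L[ℝ] ℝ}
    (hf : DifferentiableAt ℝ f z) (hτ : DifferentiableAt ℝ τ (f z))
    (hrel : ∀ a b, G' (τ (f z)) (fderiv ℝ τ (f z) a) (fderiv ℝ τ (f z) b) = G (f z) a b)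
    (hrelW : ∀ a b, W' (τ (f z)) (fderiv ℝ τ (f z) a) (fderiv ℝ τ (f z) b) = W (f z) a b) :
    starPullback (unb G') (fun w => τ (f w)) (unb W') z = starPullback (unb G) f (unb W) z := by
  rw [starPullback_eq, starPullback_eq]
  have hp : pd (fun w => τ (f w)) z = fun i => fderiv ℝ τ (f z) (pd f z i) := funext fun i =>
    pder_comp hτ hf _
  rw [hp]
  exact starA_targetChange hrel hrelW

/-! ### Reparametrisation of the surface. -/

section DomainChange

variable {f : E 2 → E m} {φ : E 2 → E 2} {w : E 2}

/-- The Jacobian of `φ`, indexed by direction and component. -/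
def jacobian (φ : E 2 → E 2) (w : E 2) : Matrix (Fin 2) (Fin 2) ℝ :=
  Matrix.of fun i k => fderiv ℝ φ w (dir i) k

theorem clm_apply_eq_sum (L : E 2 →L[ℝ] E m) (v : E 2) : L v = ∑ k, v k • L (dir k) := by
  conv_lhs => rw [← sum_apply_dir v]
  simp

theorem pd_domainChange (hf : DifferentiableAt ℝ f (φ w)) (hφ : DifferentiableAt ℝ φ w)
    (i : Fin 2) : pd (fun x => f (φ x)) w i = ∑ k, jacobian φ w i k • pd f (φ w) k := by
  rw [pd_eq, pder_comp hf hφ, clm_apply_eq_sum]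
  rfl

theorem ambientHess_domainChange (hf : ContDiffAt ℝ 2 f (φ w)) (hφ : ContDiffAt ℝ 2 φ w)
    (hG : DifferentiableAt ℝ G (f (φ w))) (hi : IsInner (G (f (φ w)))) (i j : Fin 2) :
    ambientHess (unb G) (fun x => f (φ x)) w i j =
      (∑ k, ∑ l, (jacobian φ w i k * jacobian φ w j l) • ambientHess (unb G) f (φ w) k l)
        + ∑ k, (pder (dir i) (pder (dir j) φ) w) k • pd f (φ w) k := by
  have hf' := differentiableAt_of_contDiffAt_two hf
  have hφ' := differentiableAt_of_contDiffAt_two hφ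
  have e1 : ∀ v, pder v φ w = ∑ k, (fderiv ℝ φ w v) k • dir k := fun v =>
    (sum_apply_dir _).symm
  rw [ambientHess_eq, pder_pder_comp hf hφ, pder_comp hf' hφ', pder_comp hf' hφ',
    pder_pder_eq hf, clm_apply_eq_sum _ (pder (dir i) (pder (dir j) φ) w), e1, e1]
  simp only [ambientHess_eq, pder_pder_eq hf]
  simp only [Fin.sum_univ_two, map_add, map_smul, add_apply,
    smul_apply, christoffel_add_left hG hi, christoffel_add_right hG hi,
    christoffel_smul_left hG hi, christoffel_smul_right hG hi, jacobian, Matrix.of_apply, pd_eq,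
    pder]
  module

variable (hf : ContDiffAt ℝ 2 f (φ w)) (hφ : ContDiffAt ℝ 2 φ w)
  (hG : DifferentiableAt ℝ G (f (φ w))) (hi : IsInner (G (f (φ w))))
  (hdet : (gramA (G (f (φ w))) (pd f (φ w))).det ≠ 0) (hP : (jacobian φ w).det ≠ 0)

include hf hφ hP

theorem abs_starPullback_domainChange {W : E m → E m →L[ℝ] E m →L[ℝ] ℝ}
    (hW : ∀ v, W (f (φ w)) v v = 0) :
    |starPullback (unb G) (fun x => f (φ x)) (unb W) w| =
      |starPullback (unb G) f (unb W) (φ w)| := by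
  rw [starPullback_eq, starPullback_eq]
  exact abs_starA_basisChange (pd_domainChange (differentiableAt_of_contDiffAt_two hf)
    (differentiableAt_of_contDiffAt_two hφ)) hP hW

include hG hi hdet

theorem sffNormSq_domainChange :
    sffNormSq (unb G) (fun x => f (φ x)) w = sffNormSq (unb G) f (φ w) := by
  rw [sffNormSq_eq, sffNormSq_eq]
  exact sffNormSqA_basisChange (pd_domainChange (differentiableAt_of_contDiffAt_two hf)
    (differentiableAt_of_contDiffAt_two hφ)) hP hdet (ambientHess_domainChange hf hφ hG hi)

theorem meanCurv_domainChange :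
    meanCurv (unb G) (fun x => f (φ x)) w = meanCurv (unb G) f (φ w) := by
  rw [meanCurv_eq, meanCurv_eq]
  exact meanA_basisChange (pd_domainChange (differentiableAt_of_contDiffAt_two hf)
    (differentiableAt_of_contDiffAt_two hφ)) hP hdet (ambientHess_domainChange hf hφ hG hi)

end DomainChange

end CoordinateChange

end SurfaceMCF

end

noncomputable section

namespace SurfaceMCF

/-! ### Tensors in charts -/

section Charts

variable {n : ℕ} {X : Type*} [TopologicalSpace X] [ChartedSpace (E n) X]

/-- The derivative of the inverse of the chart around `q`. -/
def chartFrame (q : X) (y : E n) : E n →L[ℝ] E n :=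
  mfderiv 𝓘(ℝ, E n) 𝓘(ℝ, E n) (extChartAt 𝓘(ℝ, E n) q).symm y

/-- A bilinear form on a tangent space, as a form on the model space. -/
def formAt (β : ∀ p : X, TangentSpace 𝓘(ℝ, E n) p →L[ℝ] TangentSpace 𝓘(ℝ, E n) p →L[ℝ] ℝ)
    (p : X) : E n →L[ℝ] E n →L[ℝ] ℝ := β p

/-- The expression of a field of bilinear forms in the chart around `q`, as a continuous
bilinear form. -/
def coordFormL
    (β : ∀ p : X, TangentSpace 𝓘(ℝ, E n) p →L[ℝ] TangentSpace 𝓘(ℝ, E n) p →L[ℝ] ℝ)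
    (q : X) (y : E n) : E n →L[ℝ] E n →L[ℝ] ℝ :=
  (formAt β ((extChartAt 𝓘(ℝ, E n) q).symm y)).bilinearComp (chartFrame q y) (chartFrame q y)

theorem coordForm_eq
    (β : ∀ p : X, TangentSpace 𝓘(ℝ, E n) p →L[ℝ] TangentSpace 𝓘(ℝ, E n) p →L[ℝ] ℝ) (q : X) :
    coordForm β q = unb (coordFormL β q) := rfl

/-- The change of coordinates from the chart around `q` to the chart around `q'`. -/
def transition (q q' : X) (y : E n) : E n :=
  extChartAt 𝓘(ℝ, E n) q' ((extChartAt 𝓘(ℝ, E n) q).symm y)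

/-- The domain of the change of coordinates. -/
def transitionDom (q q' : X) : Set (E n) :=
  (extChartAt 𝓘(ℝ, E n) q).target ∩
    (extChartAt 𝓘(ℝ, E n) q).symm ⁻¹' (extChartAt 𝓘(ℝ, E n) q').source

theorem isOpen_transitionDom (q q' : X) : IsOpen (transitionDom (n := n) q q') :=
  (continuousOn_extChartAt_symm q).isOpen_inter_preimage (isOpen_extChartAt_target q)
    (isOpen_extChartAt_source q')

theorem transition_mem {q q' : X} {y : E n} (hy : y ∈ transitionDom q q') :
    transition q q' y ∈ transitionDom q' q := by
  refine ⟨(extChartAt 𝓘(ℝ, E n) q').map_source hy.2, ?_⟩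
  simp only [Set.mem_preimage, transition]
  rw [(extChartAt 𝓘(ℝ, E n) q').left_inv hy.2]
  exact (extChartAt 𝓘(ℝ, E n) q).map_target hy.1

theorem symm_transition {q q' : X} {y : E n} (hy : y ∈ transitionDom q q') :
    (extChartAt 𝓘(ℝ, E n) q').symm (transition q q' y) = (extChartAt 𝓘(ℝ, E n) q).symm y :=
  (extChartAt 𝓘(ℝ, E n) q').left_inv hy.2

theorem transition_transition {q q' : X} {y : E n} (hy : y ∈ transitionDom q q') :
    transition q' q (transition q q' y) = y := by
  rw [transition, symm_transition hy]
  exact (extChartAt 𝓘(ℝ, E n) q).right_inv hy.1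

variable [IsManifold 𝓘(ℝ, E n) ∞ X]

theorem contDiffOn_transition (q q' : X) :
    ContDiffOn ℝ ∞ (transition (n := n) q q') (transitionDom q q') := by
  rw [← contMDiffOn_iff_contDiffOn]
  refine (contMDiffOn_extChartAt (I := 𝓘(ℝ, E n)) (x := q') (n := ∞)).comp
    ((contMDiffOn_extChartAt_symm q).mono Set.inter_subset_left) ?_
  intro y hy
  have := hy.2
  rwa [extChartAt_source] at this

theorem mdifferentiableAt_symm {q : X} {y : E n} (hy : y ∈ (extChartAt 𝓘(ℝ, E n) q).target) :
    MDifferentiableAt 𝓘(ℝ, E n) 𝓘(ℝ, E n) (extChartAt 𝓘(ℝ, E n) q).symm y :=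
  ((contMDiffOn_extChartAt_symm (n := ∞) q).contMDiffAt
    ((isOpen_extChartAt_target q).mem_nhds hy)).mdifferentiableAt (by simp)

theorem mdifferentiableAt_extChartAt_of_mem {q x : X} (hx : x ∈ (extChartAt 𝓘(ℝ, E n) q).source) :
    MDifferentiableAt 𝓘(ℝ, E n) 𝓘(ℝ, E n) (extChartAt 𝓘(ℝ, E n) q) x :=
  (contMDiffAt_extChartAt' (n := ∞) (by rwa [extChartAt_source] at hx)).mdifferentiableAt (by simp)

theorem chartFrame_injective {q : X} {y : E n} (hy : y ∈ (extChartAt 𝓘(ℝ, E n) q).target) :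
    Function.Injective (chartFrame q y) := by
  have h1 := mdifferentiableAt_symm hy
  have h2 := mdifferentiableAt_extChartAt_of_mem ((extChartAt 𝓘(ℝ, E n) q).map_target hy)
  have h3 := mfderiv_comp y h2 h1
  have h4 : (extChartAt 𝓘(ℝ, E n) q ∘ (extChartAt 𝓘(ℝ, E n) q).symm) =ᶠ[nhds y] id := by
    filter_upwards [(isOpen_extChartAt_target q).mem_nhds hy] with w hw
    exact (extChartAt 𝓘(ℝ, E n) q).right_inv hw
  rw [h4.mfderiv_eq, mfderiv_id] at h3
  intro v w hvw
  have h5 : ∀ v : E n, v = mfderiv 𝓘(ℝ, E n) 𝓘(ℝ, E n) (extChartAt 𝓘(ℝ, E n) q)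
      ((extChartAt 𝓘(ℝ, E n) q).symm y) (chartFrame q y v) := fun v =>
    congrArg (fun L => L v) h3
  rw [h5 v, h5 w, hvw]

theorem chartFrame_transition {q q' : X} {y : E n} (hy : y ∈ transitionDom q q') (v : E n) :
    chartFrame q' (transition q q' y) (fderiv ℝ (transition q q') y v) = chartFrame q y v := by
  have h1 : MDifferentiableAt 𝓘(ℝ, E n) 𝓘(ℝ, E n) (transition q q') y :=
    (((contDiffOn_transition q q').contDiffAt ((isOpen_transitionDom q q').mem_nhds hy)
      ).differentiableAt (by simp)).mdifferentiableAt
  have h2 := mdifferentiableAt_symm (transition_mem hy).1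
  have h3 := mfderiv_comp y h2 h1
  have h4 : ((extChartAt 𝓘(ℝ, E n) q').symm ∘ transition q q') =ᶠ[nhds y]
      (extChartAt 𝓘(ℝ, E n) q).symm := by
    filter_upwards [(isOpen_transitionDom q q').mem_nhds hy] with w hw
    exact symm_transition hw
  rw [h4.mfderiv_eq, mfderiv_eq_fderiv] at h3
  exact (congrArg (fun L : E n →L[ℝ] E n => L v) h3).symm

theorem coordFormL_transition
    (β : ∀ p : X, TangentSpace 𝓘(ℝ, E n) p →L[ℝ] TangentSpace 𝓘(ℝ, E n) p →L[ℝ] ℝ)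
    {q q' : X} {y : E n} (hy : y ∈ transitionDom q q') (a b : E n) :
    coordFormL β q' (transition q q' y) (fderiv ℝ (transition q q') y a)
      (fderiv ℝ (transition q q') y b) = coordFormL β q y a b := by
  -- The base points of the two sides are equal but not definitionally so; generalising over the
  -- equality identifies the fibres.
  have key : ∀ (p p' : X) (_ : p' = p) (v w v' w' : E n), v' = v → w' = w →
      formAt β p' v' w' = formAt β p v w := by
    rintro p _ rfl v w _ _ rfl rfl; rfl
  exact key _ _ (symm_transition hy) _ _ _ _ (chartFrame_transition hy a)
    (chartFrame_transition hy b)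

theorem fderiv_transition_surjective {q q' : X} {y : E n} (hy : y ∈ transitionDom q q') :
    Function.Surjective (fderiv ℝ (transition q q') y) := by
  have hd : ∀ (q q' : X) (y : E n), y ∈ transitionDom q q' →
      DifferentiableAt ℝ (transition q q') y := fun q q' y hy =>
    ((contDiffOn_transition q q').contDiffAt ((isOpen_transitionDom q q').mem_nhds hy)
      ).differentiableAt (by simp)
  have hinj : Function.Injective (fderiv ℝ (transition q q') y) := by
    have h1 := fderiv_comp y (hd _ _ _ (transition_mem hy)) (hd _ _ _ hy)
    have h4 : (transition q' q ∘ transition q q') =ᶠ[nhds y] id := by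
      filter_upwards [(isOpen_transitionDom q q').mem_nhds hy] with w hw
      exact transition_transition hw
    rw [h4.fderiv_eq, fderiv_id] at h1
    intro v w hvw
    have h5 : ∀ v : E n, v = fderiv ℝ (transition q' q) (transition q q' y)
        (fderiv ℝ (transition q q') y v) := fun v => congrArg (fun L : E n →L[ℝ] E n => L v) h1
    rw [h5 v, h5 w, hvw]
  exact LinearMap.surjective_of_injective
    (f := (fderiv ℝ (transition q q') y : E n →ₗ[ℝ] E n)) hinj

theorem isInner_coordFormL (g : Metric n X) {q : X} {y : E n}
    (hy : y ∈ (extChartAt 𝓘(ℝ, E n) q).target) : IsInner (coordFormL g.inner q y) where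
  symm v w := g.symm _ _ _
  pos v hv := by
    have h0 : chartFrame q y v ≠ 0 := fun h =>
      hv (chartFrame_injective hy (h.trans (map_zero (chartFrame q y)).symm))
    exact g.pos ((extChartAt 𝓘(ℝ, E n) q).symm y) (chartFrame q y v) h0

/-- Smoothness is tested on constant vectors: the columns of the chart frame are smooth sections of
the tangent bundle along the inverse chart, and applying the smooth form to two of them gives a
smooth section of a trivial bundle. -/
theorem contDiffOn_coordFormL
    {β : ∀ p : X, TangentSpace 𝓘(ℝ, E n) p →L[ℝ] TangentSpace 𝓘(ℝ, E n) p →L[ℝ] ℝ}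
    (hβ : ContMDiff 𝓘(ℝ, E n) (𝓘(ℝ, E n).prod 𝓘(ℝ, E n →L[ℝ] E n →L[ℝ] ℝ)) ∞
      (fun p => Bundle.TotalSpace.mk' (E n →L[ℝ] E n →L[ℝ] ℝ)
        (E := fun p : X => TangentSpace 𝓘(ℝ, E n) p →L[ℝ] TangentSpace 𝓘(ℝ, E n) p →L[ℝ] ℝ)
        p (β p))) (q : X) :
    ContDiffOn ℝ ∞ (coordFormL β q) (extChartAt 𝓘(ℝ, E n) q).target := by
  have hsymm := contMDiffOn_extChartAt_symm (I := 𝓘(ℝ, E n)) (n := ∞) q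
  have hopen : IsOpen (extChartAt 𝓘(ℝ, E n) q).target := isOpen_extChartAt_target q
  have : IsManifold 𝓘(ℝ, E n) 1 X := IsManifold.of_le (n := ∞) (by simp)
  have hv : ∀ a : E n, ContMDiffOn 𝓘(ℝ, E n) (𝓘(ℝ, E n).prod 𝓘(ℝ, E n)) ∞
      (fun y => Bundle.TotalSpace.mk' (E n) (E := fun p : X => TangentSpace 𝓘(ℝ, E n) p)
        ((extChartAt 𝓘(ℝ, E n) q).symm y) (chartFrame q y a))
      (extChartAt 𝓘(ℝ, E n) q).target := by
    intro a
    have h1 := hsymm.contMDiffOn_tangentMapWithin (m := ∞) (by simp) hopen.uniqueMDiffOn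
    have h2 : ContMDiffOn 𝓘(ℝ, E n) 𝓘(ℝ, E n).tangent ∞
        (fun y => (⟨y, a⟩ : TangentBundle 𝓘(ℝ, E n) (E n))) (extChartAt 𝓘(ℝ, E n) q).target :=
      contMDiffOn_vectorSpace_iff_contDiffOn.2 contDiffOn_const
    have h3 := h1.comp h2 (fun y hy => hy)
    refine h3.congr fun y hy => ?_
    simp only [Function.comp, tangentMapWithin, chartFrame]
    rw [mfderivWithin_of_mem_nhds (hopen.mem_nhds hy)]
    rfl
  refine contDiffOn_clm_apply.2 fun a => contDiffOn_clm_apply.2 fun b => ?_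
  rw [← contMDiffOn_iff_contDiffOn]
  have h4 : ContMDiffOn 𝓘(ℝ, E n) (𝓘(ℝ, E n).prod 𝓘(ℝ, E n →L[ℝ] E n →L[ℝ] ℝ)) ∞
      (fun y => Bundle.TotalSpace.mk' (E n →L[ℝ] E n →L[ℝ] ℝ)
        (E := fun p : X => TangentSpace 𝓘(ℝ, E n) p →L[ℝ] TangentSpace 𝓘(ℝ, E n) p →L[ℝ] ℝ)
        ((extChartAt 𝓘(ℝ, E n) q).symm y) (β ((extChartAt 𝓘(ℝ, E n) q).symm y)))
      (extChartAt 𝓘(ℝ, E n) q).target := hβ.comp_contMDiffOn hsymm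
  intro y hy
  have h5 : ContMDiffWithinAt 𝓘(ℝ, E n) (𝓘(ℝ, E n).prod 𝓘(ℝ)) ∞
      (fun y => Bundle.TotalSpace.mk' ℝ (E := Bundle.Trivial X ℝ)
        ((extChartAt 𝓘(ℝ, E n) q).symm y) (β ((extChartAt 𝓘(ℝ, E n) q).symm y)
          (chartFrame q y a) (chartFrame q y b))) (extChartAt 𝓘(ℝ, E n) q).target y := by
    apply ContMDiffWithinAt.clm_bundle_apply₂ (F₁ := E n) (F₂ := E n)
    · exact h4 y hy
    · exact hv a y hy
    · exact hv b y hy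
  simp only [Bundle.contMDiffWithinAt_totalSpace] at h5
  exact h5.2

end Charts

end SurfaceMCF

end

noncomputable section

namespace SurfaceMCF

/-! ### Independence of the charts -/

section ChartIndependence

/-! ### Dependence on the germ of the parametrisation only. -/

section Germs

variable {m : ℕ} {G W : E m → E m →L[ℝ] E m →L[ℝ] ℝ} {f f' : E 2 → E m} {z : E 2}

theorem pd_congr (h : f =ᶠ[nhds z] f') : pd f z = pd f' z := by
  funext i; simp only [pd, h.fderiv_eq]

theorem ambientHess_congr (h : f =ᶠ[nhds z] f') :
    ambientHess (unb G) f z = ambientHess (unb G) f' z := by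
  funext i j
  have h1 : (fun w => pd f w j) =ᶠ[nhds z] fun w => pd f' w j := by
    filter_upwards [h.eventually_nhds] with w hw
    rw [pd_congr hw]
  simp only [ambientHess, h1.fderiv_eq, pd_congr h, h.self_of_nhds]

theorem sffNormSq_congr (h : f =ᶠ[nhds z] f') :
    sffNormSq (unb G) f z = sffNormSq (unb G) f' z := by
  rw [sffNormSq_eq, sffNormSq_eq, ambientHess_congr h, pd_congr h, h.self_of_nhds]

theorem meanCurv_congr (h : f =ᶠ[nhds z] f') :
    meanCurv (unb G) f z = meanCurv (unb G) f' z := by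
  rw [meanCurv_eq, meanCurv_eq, ambientHess_congr h, pd_congr h, h.self_of_nhds]

theorem starPullback_congr (h : f =ᶠ[nhds z] f') :
    starPullback (unb G) f (unb W) z = starPullback (unb G) f' (unb W) z := by
  rw [starPullback_eq, starPullback_eq, pd_congr h, h.self_of_nhds]

theorem linearIndependent_pd (h : Function.Injective (fderiv ℝ f z)) :
    LinearIndependent ℝ (pd f z) := by
  have h1 : LinearIndependent ℝ (fun i : Fin 2 => (dir i : E 2)) := by
    refine Fintype.linearIndependent_iff.2 fun c hc i => ?_
    have := congrArg (fun x : E 2 => x i) hc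
    fin_cases i <;> simpa [dir, Pi.single_apply] using this
  exact h1.map' (fderiv ℝ f z : E 2 →ₗ[ℝ] E m) (LinearMap.ker_eq_bot.2 h)

end Germs

variable {M : Type*} [TopologicalSpace M] [ChartedSpace (E 4) M] [IsManifold 𝓘(ℝ, E 4) ∞ M]
  {S : Type*} [TopologicalSpace S] [ChartedSpace (E 2) S] [IsManifold 𝓘(ℝ, E 2) ∞ S]
  {F : S → M}

theorem mfderiv_extChartAt_injective {n : ℕ} {X : Type*} [TopologicalSpace X]
    [ChartedSpace (E n) X] [IsManifold 𝓘(ℝ, E n) ∞ X] {q x : X}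
    (hx : x ∈ (extChartAt 𝓘(ℝ, E n) q).source) :
    Function.Injective (mfderiv 𝓘(ℝ, E n) 𝓘(ℝ, E n) (extChartAt 𝓘(ℝ, E n) q) x) := by
  have hy := (extChartAt 𝓘(ℝ, E n) q).map_source hx
  have h1 := mdifferentiableAt_symm hy
  have h2 := mdifferentiableAt_extChartAt_of_mem hx
  have h3 := mfderiv_comp x h1 h2
  have h4 : ((extChartAt 𝓘(ℝ, E n) q).symm ∘ extChartAt 𝓘(ℝ, E n) q) =ᶠ[nhds x] id := by
    filter_upwards [(isOpen_extChartAt_source q).mem_nhds hx] with w hw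
    exact (extChartAt 𝓘(ℝ, E n) q).left_inv hw
  rw [h4.mfderiv_eq, mfderiv_id] at h3
  intro v w hvw
  have h5 : ∀ v : E n, v = mfderiv 𝓘(ℝ, E n) 𝓘(ℝ, E n) (extChartAt 𝓘(ℝ, E n) q).symm
      (extChartAt 𝓘(ℝ, E n) q x) (mfderiv 𝓘(ℝ, E n) 𝓘(ℝ, E n) (extChartAt 𝓘(ℝ, E n) q) x v) :=
    fun v => congrArg (fun L : E n →L[ℝ] E n => L v) h3
  have h6 := h5 v
  rw [hvw] at h6
  exact h6.trans (h5 w).symm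

theorem contDiffAt_coordMap (hF : ContMDiff 𝓘(ℝ, E 2) 𝓘(ℝ, E 4) ∞ F) {p x : S} {q : M}
    (hx : x ∈ (extChartAt 𝓘(ℝ, E 2) p).source) (hq : F x ∈ (extChartAt 𝓘(ℝ, E 4) q).source) :
    ContDiffAt ℝ ∞ (coordMap F p q) (extChartAt 𝓘(ℝ, E 2) p x) := by
  have hz := (extChartAt 𝓘(ℝ, E 2) p).map_source hx
  have hxz := (extChartAt 𝓘(ℝ, E 2) p).left_inv hx
  rw [← contMDiffAt_iff_contDiffAt]
  have h1 : ContMDiffAt 𝓘(ℝ, E 2) 𝓘(ℝ, E 2) ∞ (extChartAt 𝓘(ℝ, E 2) p).symm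
      (extChartAt 𝓘(ℝ, E 2) p x) := (contMDiffOn_extChartAt_symm p).contMDiffAt
    ((isOpen_extChartAt_target p).mem_nhds hz)
  have h2 : ContMDiffAt 𝓘(ℝ, E 4) 𝓘(ℝ, E 4) ∞ (extChartAt 𝓘(ℝ, E 4) q)
      (F ((extChartAt 𝓘(ℝ, E 2) p).symm (extChartAt 𝓘(ℝ, E 2) p x))) := by
    rw [hxz]
    exact contMDiffAt_extChartAt' (by rwa [extChartAt_source] at hq)
  exact h2.comp (extChartAt 𝓘(ℝ, E 2) p x)
    (ContMDiffAt.comp (extChartAt 𝓘(ℝ, E 2) p x) hF.contMDiffAt h1)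

theorem fderiv_coordMap_injective (hF : ContMDiff 𝓘(ℝ, E 2) 𝓘(ℝ, E 4) ∞ F) {p x : S} {q : M}
    (hx : x ∈ (extChartAt 𝓘(ℝ, E 2) p).source) (hq : F x ∈ (extChartAt 𝓘(ℝ, E 4) q).source)
    (himm : Function.Injective (mfderiv 𝓘(ℝ, E 2) 𝓘(ℝ, E 4) F x)) :
    Function.Injective (fderiv ℝ (coordMap F p q) (extChartAt 𝓘(ℝ, E 2) p x)) := by
  have hz := (extChartAt 𝓘(ℝ, E 2) p).map_source hx
  have hxz := (extChartAt 𝓘(ℝ, E 2) p).left_inv hx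
  set z := extChartAt 𝓘(ℝ, E 2) p x with hzdef
  have d1 := mdifferentiableAt_symm hz
  have d2 : MDifferentiableAt 𝓘(ℝ, E 2) 𝓘(ℝ, E 4) F ((extChartAt 𝓘(ℝ, E 2) p).symm z) :=
    hF.mdifferentiable (by simp) _
  have hq' : F ((extChartAt 𝓘(ℝ, E 2) p).symm z) ∈ (extChartAt 𝓘(ℝ, E 4) q).source := by
    rwa [hxz]
  have d3 := mdifferentiableAt_extChartAt_of_mem hq'
  have e1 := mfderiv_comp z d2 d1
  have e2 := mfderiv_comp z d3 (d2.comp z d1)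
  have i3 := mfderiv_extChartAt_injective hq'
  have i1 : Function.Injective (mfderiv 𝓘(ℝ, E 2) 𝓘(ℝ, E 2) (extChartAt 𝓘(ℝ, E 2) p).symm z) :=
    chartFrame_injective hz
  have i2 : Function.Injective (mfderiv 𝓘(ℝ, E 2) 𝓘(ℝ, E 4) F
      ((extChartAt 𝓘(ℝ, E 2) p).symm z)) := by rw [hxz]; exact himm
  rw [← mfderiv_eq_fderiv]
  have e3 : mfderiv 𝓘(ℝ, E 2) 𝓘(ℝ, E 4) (coordMap F p q) z = _ := e2
  rw [e3, e1]
  exact i3.comp (i2.comp i1)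

theorem linearIndependent_pd_coordMap (hF : ContMDiff 𝓘(ℝ, E 2) 𝓘(ℝ, E 4) ∞ F) {p x : S} {q : M}
    (hx : x ∈ (extChartAt 𝓘(ℝ, E 2) p).source) (hq : F x ∈ (extChartAt 𝓘(ℝ, E 4) q).source)
    (himm : Function.Injective (mfderiv 𝓘(ℝ, E 2) 𝓘(ℝ, E 4) F x)) :
    LinearIndependent ℝ (pd (coordMap F p q) (extChartAt 𝓘(ℝ, E 2) p x)) :=
  linearIndependent_pd (fderiv_coordMap_injective hF hx hq himm)

theorem det_jacobian_ne_zero {φ : E 2 → E 2} {w : E 2}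
    (h : Function.Injective (fderiv ℝ φ w)) : (jacobian φ w).det ≠ 0 := by
  intro h0
  have h1 : (jacobian φ w)ᵀ.det = 0 := by rwa [Matrix.det_transpose]
  obtain ⟨v, hv, h2⟩ := Matrix.exists_mulVec_eq_zero_iff.2 h1
  apply hv
  have h3 : fderiv ℝ φ w (∑ i, v i • dir i) = 0 := by
    ext k
    have := congrFun h2 k
    simp only [Matrix.mulVec, dotProduct, Matrix.transpose_apply, jacobian, Matrix.of_apply,
      Pi.zero_apply] at this
    simp only [map_sum, map_smul, WithLp.ofLp_sum, WithLp.ofLp_smul, Finset.sum_apply,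
      Pi.smul_apply, smul_eq_mul]
    rw [Finset.sum_congr rfl fun i _ => mul_comm _ _]
    simpa using this
  have h4 : (∑ i, v i • dir i : E 2) = 0 := h (h3.trans (map_zero _).symm)
  funext i
  have := congrArg (fun x : E 2 => x i) h4
  fin_cases i <;> simpa [dir, Pi.single_apply] using this

variable (g : Metric 4 M)

/-- This factorisation splits an arbitrary change of charts into one change of the domain and one of
the target, for which invariance is known separately. -/
theorem coordMap_eventuallyEq (hF : ContMDiff 𝓘(ℝ, E 2) 𝓘(ℝ, E 4) ∞ F) {p x : S} {q : M}
    (hx : x ∈ (extChartAt 𝓘(ℝ, E 2) p).source) (hq : F x ∈ (extChartAt 𝓘(ℝ, E 4) q).source) :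
    coordMap F x (F x) =ᶠ[nhds (extChartAt 𝓘(ℝ, E 2) x x)]
      fun w => transition q (F x) (coordMap F p q (transition x p w)) := by
  have hxx : extChartAt 𝓘(ℝ, E 2) x x ∈ transitionDom x p := by
    refine ⟨mem_extChartAt_target x, ?_⟩
    simpa using hx
  have hsymm : ContinuousAt (extChartAt 𝓘(ℝ, E 2) x).symm (extChartAt 𝓘(ℝ, E 2) x x) :=
    continuousAt_extChartAt_symm x
  have hFc : ContinuousAt (fun w => F ((extChartAt 𝓘(ℝ, E 2) x).symm w))
      (extChartAt 𝓘(ℝ, E 2) x x) := hF.continuous.continuousAt.comp hsymm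
  have hq' : ∀ᶠ w in nhds (extChartAt 𝓘(ℝ, E 2) x x),
      F ((extChartAt 𝓘(ℝ, E 2) x).symm w) ∈ (extChartAt 𝓘(ℝ, E 4) q).source := by
    refine hFc.eventually ((isOpen_extChartAt_source q).mem_nhds ?_)
    simpa using hq
  filter_upwards [hq', (isOpen_transitionDom x p).mem_nhds hxx] with w hw1 hw2
  simp only [transition, coordMap]
  rw [(extChartAt 𝓘(ℝ, E 2) p).left_inv hw2.2, (extChartAt 𝓘(ℝ, E 4) q).left_inv hw1]

/-- The squared norm of the second fundamental form may be computed in any charts. -/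
theorem sffNormSq_chart (hF : ContMDiff 𝓘(ℝ, E 2) 𝓘(ℝ, E 4) ∞ F) {p x : S} {q : M}
    (hx : x ∈ (extChartAt 𝓘(ℝ, E 2) p).source) (hq : F x ∈ (extChartAt 𝓘(ℝ, E 4) q).source)
    (himm : Function.Injective (mfderiv 𝓘(ℝ, E 2) 𝓘(ℝ, E 4) F x)) :
    sffNormSq (coordForm g.inner (F x)) (coordMap F x (F x)) (extChartAt 𝓘(ℝ, E 2) x x) =
      sffNormSq (coordForm g.inner q) (coordMap F p q) (extChartAt 𝓘(ℝ, E 2) p x) := by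
  have hxx : extChartAt 𝓘(ℝ, E 2) x x ∈ transitionDom x p := ⟨mem_extChartAt_target x, by simpa using hx⟩
  have hφx : transition x p (extChartAt 𝓘(ℝ, E 2) x x) = extChartAt 𝓘(ℝ, E 2) p x := by
    simp [transition]
  set w := extChartAt 𝓘(ℝ, E 2) x x with hw
  set f := coordMap F p q with hf
  have hfx : f (transition x p w) = extChartAt 𝓘(ℝ, E 4) q (F x) := by
    rw [hφx, hf, coordMap, (extChartAt 𝓘(ℝ, E 2) p).left_inv hx]
  have hfd : ContDiffAt ℝ 2 f (transition x p w) := by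
    rw [hφx]; exact (contDiffAt_coordMap hF hx hq).of_le (WithTop.coe_le_coe.2 le_top)
  have hφd : ContDiffAt ℝ 2 (transition (n := 2) x p) w :=
    contDiffAt_two_of_contDiffOn (contDiffOn_transition x p) (isOpen_transitionDom x p) hxx
  have hyt : f (transition x p w) ∈ (extChartAt 𝓘(ℝ, E 4) q).target := by
    rw [hfx]; exact (extChartAt 𝓘(ℝ, E 4) q).map_source hq
  have hydom : f (transition x p w) ∈ transitionDom q (F x) := by
    refine ⟨hyt, ?_⟩
    rw [Set.mem_preimage, hfx, (extChartAt 𝓘(ℝ, E 4) q).left_inv hq]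
    exact mem_extChartAt_source (F x)
  have hτd : ContDiffAt ℝ 2 (transition q (F x)) (f (transition x p w)) :=
    contDiffAt_two_of_contDiffOn (contDiffOn_transition q (F x)) (isOpen_transitionDom q (F x)) hydom
  have hGd : ∀ (q : M) (y : E 4), y ∈ (extChartAt 𝓘(ℝ, E 4) q).target →
      DifferentiableAt ℝ (coordFormL g.inner q) y := fun q y hy =>
    differentiableAt_of_contDiffAt_two (contDiffAt_two_of_contDiffOn
      (contDiffOn_coordFormL g.contMDiff q) (isOpen_extChartAt_target q) hy)
  have hli := linearIndependent_pd_coordMap hF hx hq himm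
  rw [coordForm_eq, coordForm_eq, sffNormSq_congr (coordMap_eventuallyEq hF hx hq),
    sffNormSq_targetChange (G := coordFormL g.inner q) (f := fun w => f (transition x p w))
      (hfd.comp w hφd) hτd (hGd _ _ hyt) (hGd _ _ (transition_mem hydom).1)
      (isInner_coordFormL g hyt) (isInner_coordFormL g (transition_mem hydom).1)
      (fderiv_transition_surjective hydom) ?_,
    sffNormSq_domainChange hfd hφd (hGd _ _ hyt) (isInner_coordFormL g hyt) ?_ ?_, hφx]
  · rw [hφx] at hyt ⊢
    exact ((isInner_coordFormL g hyt).det_gramA_pos hli).ne'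
  · refine det_jacobian_ne_zero ?_
    exact LinearMap.injective_iff_surjective.2 (fderiv_transition_surjective hxx)
  · filter_upwards [(isOpen_transitionDom q (F x)).mem_nhds hydom] with y hy a b
    exact coordFormL_transition g.inner hy a b

/-- The absolute value of `*(F^* α)` may be computed in any charts. -/
theorem abs_starPullback_chart (α : TwoForm 4 M) (hF : ContMDiff 𝓘(ℝ, E 2) 𝓘(ℝ, E 4) ∞ F)
    {p x : S} {q : M}
    (hx : x ∈ (extChartAt 𝓘(ℝ, E 2) p).source) (hq : F x ∈ (extChartAt 𝓘(ℝ, E 4) q).source) :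
    |starPullback (coordForm g.inner (F x)) (coordMap F x (F x)) (coordForm α.val (F x))
        (extChartAt 𝓘(ℝ, E 2) x x)| =
      |starPullback (coordForm g.inner q) (coordMap F p q) (coordForm α.val q)
        (extChartAt 𝓘(ℝ, E 2) p x)| := by
  have hxx : extChartAt 𝓘(ℝ, E 2) x x ∈ transitionDom x p := ⟨mem_extChartAt_target x, by simpa using hx⟩
  have hφx : transition x p (extChartAt 𝓘(ℝ, E 2) x x) = extChartAt 𝓘(ℝ, E 2) p x := by
    simp [transition]
  set w := extChartAt 𝓘(ℝ, E 2) x x with hw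
  set f := coordMap F p q with hf
  have hfx : f (transition x p w) = extChartAt 𝓘(ℝ, E 4) q (F x) := by
    rw [hφx, hf, coordMap, (extChartAt 𝓘(ℝ, E 2) p).left_inv hx]
  have hfd : ContDiffAt ℝ 2 f (transition x p w) := by
    rw [hφx]; exact (contDiffAt_coordMap hF hx hq).of_le (WithTop.coe_le_coe.2 le_top)
  have hφd : ContDiffAt ℝ 2 (transition (n := 2) x p) w :=
    contDiffAt_two_of_contDiffOn (contDiffOn_transition x p) (isOpen_transitionDom x p) hxx
  have hyt : f (transition x p w) ∈ (extChartAt 𝓘(ℝ, E 4) q).target := by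
    rw [hfx]; exact (extChartAt 𝓘(ℝ, E 4) q).map_source hq
  have hydom : f (transition x p w) ∈ transitionDom q (F x) := by
    refine ⟨hyt, ?_⟩
    rw [Set.mem_preimage, hfx, (extChartAt 𝓘(ℝ, E 4) q).left_inv hq]
    exact mem_extChartAt_source (F x)
  have hτd : ContDiffAt ℝ 2 (transition q (F x)) (f (transition x p w)) :=
    contDiffAt_two_of_contDiffOn (contDiffOn_transition q (F x)) (isOpen_transitionDom q (F x)) hydom
  rw [coordForm_eq, coordForm_eq, coordForm_eq, coordForm_eq,
    starPullback_congr (coordMap_eventuallyEq hF hx hq),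
    starPullback_targetChange (G := coordFormL g.inner q) (W := coordFormL α.val q)
      (f := fun w => f (transition x p w))
      (differentiableAt_of_contDiffAt_two (hfd.comp w hφd)) (differentiableAt_of_contDiffAt_two hτd)
      (coordFormL_transition g.inner hydom) (coordFormL_transition α.val hydom),
    abs_starPullback_domainChange hfd hφd ?_ (fun v => α.alternating _ _), hφx]
  refine det_jacobian_ne_zero ?_
  exact LinearMap.injective_iff_surjective.2 (fderiv_transition_surjective hxx)

end ChartIndependence

end SurfaceMCF

end

noncomputable section

namespace SurfaceMCF

/-! ### Graphs over a plane -/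

section SmoothMatrix

variable {X : Type*} [NormedAddCommGroup X] [NormedSpace ℝ X] {s : Set X} {n : ℕ}
  {A : X → Matrix (Fin n) (Fin n) ℝ}

theorem contDiffOn_det (hA : ∀ i j, ContDiffOn ℝ ∞ (fun x => A x i j) s) :
    ContDiffOn ℝ ∞ (fun x => (A x).det) s := by
  simp only [Matrix.det_apply']
  exact ContDiffOn.sum fun σ _ => contDiffOn_const.mul (contDiffOn_prod fun i _ => hA _ _)

/-- Cramer's rule writes each entry as a quotient of determinants. -/
theorem contDiffOn_matrix_inv (hA : ∀ i j, ContDiffOn ℝ ∞ (fun x => A x i j) s)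
    (hdet : ∀ x ∈ s, (A x).det ≠ 0) (i j : Fin n) : ContDiffOn ℝ ∞ (fun x => (A x)⁻¹ i j) s := by
  have h : ∀ x, (A x)⁻¹ i j = (A x).det⁻¹ * ((A x).updateRow j (Pi.single i 1)).det := fun x => by
    rw [Matrix.inv_def, Matrix.smul_apply, Matrix.adjugate_apply, Ring.inverse_eq_inv', smul_eq_mul]
  simp only [h]
  refine ((contDiffOn_det hA).inv hdet).mul (contDiffOn_det fun k l => ?_)
  by_cases hk : k = j
  · subst hk
    simpa using contDiffOn_const
  · simpa [Matrix.updateRow_ne hk] using hA k l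

end SmoothMatrix

/-- Bases of `ℝ⁴` split into two halves. -/
abbrev SplitBasis := Module.Basis (Fin 2 ⊕ Fin 2) ℝ (E 4)

section Graph

variable (b : SplitBasis)

/-- The point of the graph determined by a jet. -/
def graphPt (J : Jet) : E 4 := ∑ i, J.1 i • b (Sum.inl i) + ∑ a, J.2.1 a • b (Sum.inr a)

/-- The coordinate tangent vectors of the graph determined by a jet. -/
def graphTan (J : Jet) (i : Fin 2) : E 4 := b (Sum.inl i) + ∑ a, J.2.2 i a • b (Sum.inr a)

/-- The vertical part of a vector along the tangent plane of the graph. -/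
def vert (J : Jet) (v : E 4) (a : Fin 2) : ℝ :=
  b.repr v (Sum.inr a) - ∑ k, b.repr v (Sum.inl k) * J.2.2 k a

theorem contDiff_graphPt : ContDiff ℝ ∞ (graphPt b) := by
  unfold graphPt
  fun_prop

theorem contDiff_graphTan (i : Fin 2) : ContDiff ℝ ∞ (fun J => graphTan b J i) := by
  unfold graphTan
  fun_prop

variable {b}

theorem repr_graphTan_inl (J : Jet) (i k : Fin 2) :
    b.repr (graphTan b J i) (Sum.inl k) = if i = k then 1 else 0 := by
  simp [graphTan, Finsupp.single_apply]

theorem repr_graphTan_inr (J : Jet) (i a : Fin 2) :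
    b.repr (graphTan b J i) (Sum.inr a) = J.2.2 i a := by
  fin_cases a <;> simp [graphTan]

theorem linearIndependent_graphTan (J : Jet) : LinearIndependent ℝ (graphTan b J) := by
  rw [Fintype.linearIndependent_iff]
  intro c hc k
  have := congrArg (fun v => b.repr v (Sum.inl k)) hc
  fin_cases k <;> simpa [repr_graphTan_inl] using this

theorem vert_add (J : Jet) (v w : E 4) : vert b J (v + w) = vert b J v + vert b J w := by
  funext a
  simp only [vert, map_add, Finsupp.add_apply, Pi.add_apply, Fin.sum_univ_two]
  ring

theorem vert_smul (J : Jet) (c : ℝ) (v : E 4) : vert b J (c • v) = c • vert b J v := by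
  funext a
  simp only [vert, map_smul, Finsupp.smul_apply, Pi.smul_apply, Fin.sum_univ_two, smul_eq_mul]
  ring

variable (b) in
/-- The vertical part as a linear map. -/
def vertL (J : Jet) : E 4 →ₗ[ℝ] (Fin 2 → ℝ) where
  toFun := vert b J
  map_add' := vert_add J
  map_smul' := vert_smul J

theorem vertL_apply (J : Jet) (v : E 4) : vertL b J v = vert b J v := rfl

theorem vert_graphTan (J : Jet) (i : Fin 2) : vertL b J (graphTan b J i) = 0 := by
  funext a
  simp [vertL_apply, vert, repr_graphTan_inl, repr_graphTan_inr]

theorem vert_inr (J : Jet) (a : Fin 2) : vertL b J (b (Sum.inr a)) = Pi.single a 1 := by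
  funext c
  simp [vertL_apply, vert, Finsupp.single_apply, Pi.single_apply, eq_comm]

theorem sub_vert (J : Jet) (v : E 4) : v - ∑ a, vert b J v a • b (Sum.inr a) =
    ∑ k, b.repr v (Sum.inl k) • graphTan b J k := by
  conv_lhs => rw [← b.sum_repr v]
  simp only [Fintype.sum_sum_type, Fin.sum_univ_two, vert, graphTan, map_add, map_smul,
    Module.Basis.repr_self, Finsupp.add_apply, Finsupp.smul_apply, Finsupp.single_apply]
  simp
  module

/-- A vector differs from its vertical part by a tangent vector, which the normal projection kills.
Hence |A|² becomes a quadratic form in the vertical parts V, with coefficients depending only on the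
jet. -/
theorem norA_eq_of_vert {β : E 4 →L[ℝ] E 4 →L[ℝ] ℝ} {J : Jet}
    (hdet : (gramA β (graphTan b J)).det ≠ 0) (v : E 4) :
    norA β (graphTan b J) v = ∑ a, vert b J v a • norA β (graphTan b J) (b (Sum.inr a)) := by
  have h : v = ∑ a, vert b J v a • b (Sum.inr a) + ∑ k, b.repr v (Sum.inl k) • graphTan b J k := by
    rw [← sub_vert J v]; abel
  conv_lhs => rw [h]
  rw [norA_add, norA_sum, norA_sum]
  simp [norA_smul, norA_tangent hdet]

/-- Conversely, the vertical part along the tangent plane does not see the normal projection, so the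
equation for ∂ₜu can be read off the mean curvature vector. -/
theorem vert_norA {β : E 4 →L[ℝ] E 4 →L[ℝ] ℝ} {J : Jet} (v : E 4) :
    vertL b J (norA β (graphTan b J) v) = vertL b J v := by
  simp only [norA, map_sub, map_sum, map_smul, vert_graphTan]
  simp

end Graph

/-! ### Coefficients of the graph system. -/

section System

variable (b : SplitBasis) (G : E 4 → E 4 →L[ℝ] E 4 →L[ℝ] ℝ)

/-- The inverse induced metric of a graph. -/
def graphInv (k l : Fin 2) (J : Jet) : ℝ := (gramA (G (graphPt b J)) (graphTan b J))⁻¹ k l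

/-- The zeroth-order part of the vertical Hessian of a graph. -/
def graphBe (I : HessIndex) (J : Jet) : ℝ :=
  vert b J (christoffel (unb G) (graphPt b J) (graphTan b J I.1) (graphTan b J I.2.1)) I.2.2

/-- The metric on the normal bundle of a graph, in the vertical frame. -/
def graphNor (a c : Fin 2) (J : Jet) : ℝ :=
  G (graphPt b J) (norA (G (graphPt b J)) (graphTan b J) (b (Sum.inr a)))
    (norA (G (graphPt b J)) (graphTan b J) (b (Sum.inr c)))

/-- The quadratic form giving the squared norm of the second fundamental form. -/
def graphNf (I I' : HessIndex) (J : Jet) : ℝ :=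
  graphInv b G I.1 I'.1 J * graphInv b G I.2.1 I'.2.1 J * graphNor b G I.2.2 I'.2.2 J

variable {b G} {Ω : Set (E 4)}

theorem contDiffOn_apply_apply {X : Type*} [NormedAddCommGroup X] [NormedSpace ℝ X] {s : Set X}
    {β : X → E 4 →L[ℝ] E 4 →L[ℝ] ℝ} {v w : X → E 4} (hβ : ContDiffOn ℝ ∞ β s)
    (hv : ContDiffOn ℝ ∞ v s) (hw : ContDiffOn ℝ ∞ w s) :
    ContDiffOn ℝ ∞ (fun x => β x (v x) (w x)) s :=
  (hβ.clm_apply hv).clm_apply hw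

section

variable (hG : ContDiffOn ℝ ∞ G Ω) (hi : ∀ y ∈ Ω, IsInner (G y))

include hG

theorem contDiffOn_metric_graphPt :
    ContDiffOn ℝ ∞ (fun J => G (graphPt b J)) (graphPt b ⁻¹' Ω) :=
  ContDiffOn.comp (g := G) hG (contDiff_graphPt b).contDiffOn fun _ h => h

theorem contDiffOn_gramA_graphTan (i j : Fin 2) : ContDiffOn ℝ ∞
    (fun J => gramA (G (graphPt b J)) (graphTan b J) i j) (graphPt b ⁻¹' Ω) :=
  contDiffOn_apply_apply (contDiffOn_metric_graphPt hG) (contDiff_graphTan b i).contDiffOn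
    (contDiff_graphTan b j).contDiffOn

include hi

theorem contDiffOn_graphInv (k l : Fin 2) :
    ContDiffOn ℝ ∞ (graphInv b G k l) (graphPt b ⁻¹' Ω) :=
  contDiffOn_matrix_inv (contDiffOn_gramA_graphTan hG)
    (fun J hJ => ((hi _ hJ).det_gramA_pos (linearIndependent_graphTan J)).ne') k l

theorem contDiffOn_norA_graphTan (v : E 4) : ContDiffOn ℝ ∞
    (fun J => norA (G (graphPt b J)) (graphTan b J) v) (graphPt b ⁻¹' Ω) := by
  simp only [norA]
  exact contDiffOn_const.sub (ContDiffOn.sum fun k _ => ContDiffOn.sum fun l _ =>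
    ((contDiffOn_graphInv hG hi k l).mul (contDiffOn_apply_apply (contDiffOn_metric_graphPt hG)
      contDiffOn_const (contDiff_graphTan b k).contDiffOn)).smul
      (contDiff_graphTan b l).contDiffOn)

theorem contDiffOn_graphNor (a c : Fin 2) :
    ContDiffOn ℝ ∞ (graphNor b G a c) (graphPt b ⁻¹' Ω) :=
  contDiffOn_apply_apply (contDiffOn_metric_graphPt hG) (contDiffOn_norA_graphTan hG hi _)
    (contDiffOn_norA_graphTan hG hi _)

theorem contDiffOn_graphNf (I I' : HessIndex) :
    ContDiffOn ℝ ∞ (graphNf b G I I') (graphPt b ⁻¹' Ω) :=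
  ((contDiffOn_graphInv hG hi _ _).mul (contDiffOn_graphInv hG hi _ _)).mul
    (contDiffOn_graphNor hG hi _ _)

theorem contDiffOn_christoffel {X : Type*} [NormedAddCommGroup X] [NormedSpace ℝ X] {s : Set X}
    {y v w : X → E 4} (hΩ : IsOpen Ω) (hy : ContDiffOn ℝ ∞ y s) (hyΩ : Set.MapsTo y s Ω)
    (hv : ContDiffOn ℝ ∞ v s) (hw : ContDiffOn ℝ ∞ w s) :
    ContDiffOn ℝ ∞ (fun x => christoffel (unb G) (y x) (v x) (w x)) s := by
  have hGd : ∀ x ∈ s, DifferentiableAt ℝ G (y x) := fun x hx =>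
    (hG.contDiffAt (hΩ.mem_nhds (hyΩ hx))).differentiableAt (by simp)
  have hGy : ContDiffOn ℝ ∞ (fun x => G (y x)) s := ContDiffOn.comp (g := G) hG hy hyΩ
  have hd3 : ∀ {p q r : X → E 4}, ContDiffOn ℝ ∞ p s → ContDiffOn ℝ ∞ q s → ContDiffOn ℝ ∞ r s →
      ContDiffOn ℝ ∞ (fun x => fderiv ℝ G (y x) (p x) (q x) (r x)) s := fun {p q r} hp hq hr => by
    -- Expanding the direction in coordinates reduces the claim to derivatives of the metric in
    -- constant directions.
    have h1 : ∀ x, fderiv ℝ G (y x) (p x) (q x) (r x) =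
        ∑ k, p x k * pder (dir k) G (y x) (q x) (r x) := fun x => by
      conv_lhs => rw [← sum_apply_dir (p x)]
      simp only [map_sum, map_smul, sum_apply, smul_apply, smul_eq_mul, pder]
    simp only [h1]
    refine ContDiffOn.sum fun k _ => ContDiffOn.mul ?_ (contDiffOn_apply_apply ?_ hq hr)
    · exact (EuclideanSpace.proj (𝕜 := ℝ) k).contDiff.comp_contDiffOn hp
    · exact ContDiffOn.comp (g := pder (dir k) G) (contDiffOn_pder hG hΩ (dir k)) hy hyΩ
  simp only [christoffel]
  refine ContDiffOn.sum fun C _ => ContDiffOn.fun_smul (ContDiffOn.sum fun D _ => ContDiffOn.mul ?_ ?_)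
    contDiffOn_const
  · exact contDiffOn_matrix_inv (A := fun x => metricMatrix (unb G) (y x))
      (fun i j => contDiffOn_apply_apply hGy contDiffOn_const contDiffOn_const)
      (fun x hx => (hi _ (hyΩ hx)).det_metricMatrix_ne_zero) C D
  · refine ContDiffOn.congr (f := fun x => (fderiv ℝ G (y x) (v x) (w x) (dir D)
      + fderiv ℝ G (y x) (w x) (v x) (dir D) - fderiv ℝ G (y x) (dir D) (v x) (w x)) / 2) ?_
      fun x hx => christoffelLower_eq (hGd x hx) _ _ _
    exact (((hd3 hv hw contDiffOn_const).add (hd3 hw hv contDiffOn_const)).sub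
      (hd3 contDiffOn_const hv hw)).div_const 2

theorem contDiffOn_graphBe (hΩ : IsOpen Ω) (I : HessIndex) :
    ContDiffOn ℝ ∞ (graphBe b G I) (graphPt b ⁻¹' Ω) := by
  have h := contDiffOn_christoffel hG hi hΩ (contDiff_graphPt b).contDiffOn
    (s := graphPt b ⁻¹' Ω) (fun _ h => h) (contDiff_graphTan b I.1).contDiffOn
    (contDiff_graphTan b I.2.1).contDiffOn
  have hc : ∀ c : Fin 2 ⊕ Fin 2, ContDiff ℝ ∞ fun v : E 4 => b.repr v c := fun c =>
    (LinearMap.toContinuousLinearMap (b.coord c)).contDiff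
  have hP : ∀ k, ContDiff ℝ ∞ fun J : Jet => J.2.2 k I.2.2 := fun k => by fun_prop
  unfold graphBe vert
  exact ((hc _).comp_contDiffOn h).sub (ContDiffOn.sum fun k _ =>
    ((hc _).comp_contDiffOn h).mul (hP k).contDiffOn)

end

theorem graphInv_symm (hs : ∀ y v w, G y v w = G y w v) (k l : Fin 2) (J : Jet) :
    graphInv b G k l J = graphInv b G l k J := by
  have h : (gramA (G (graphPt b J)) (graphTan b J)).IsSymm := by
    ext i j; simp [gramA, hs _ (graphTan b J i) (graphTan b J j)]
  have h2 : ((gramA (G (graphPt b J)) (graphTan b J))⁻¹)ᵀ =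
      (gramA (G (graphPt b J)) (graphTan b J))⁻¹ := by
    rw [Matrix.transpose_nonsing_inv, h]
  exact congrFun (congrFun h2 l) k

/-- The system satisfied by graphs moving by mean curvature in the metric `G`. -/
def graphSystem (b : SplitBasis) (G : E 4 → E 4 →L[ℝ] E 4 →L[ℝ] ℝ) (Ω : Set (E 4))
    (hΩ : IsOpen Ω) (hG : ContDiffOn ℝ ∞ G Ω) (hi : ∀ y ∈ Ω, IsInner (G y))
    (hs : ∀ y v w, G y v w = G y w v) : GraphSystem where
  dom := graphPt b ⁻¹' Ω
  isOpen_dom := hΩ.preimage (contDiff_graphPt b).continuous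
  gi := graphInv b G
  be := graphBe b G
  nf := graphNf b G
  smooth_gi := contDiffOn_graphInv hG hi
  smooth_be := contDiffOn_graphBe hG hi hΩ
  smooth_nf := contDiffOn_graphNf hG hi
  symm_gi := graphInv_symm hs
  symm_nf I I' J := by
    simp only [graphNf, graphNor, graphInv_symm hs I.1, graphInv_symm hs I.2.1]
    rw [hs]

end System

end SurfaceMCF

end

noncomputable section

namespace SurfaceMCF

/-! ### Geometry of graphs in terms of jets -/

section GraphGeometry

variable (b : SplitBasis) (u : Fin 2 → SpaceTime → ℝ)

/-- The graph of `u` at time `t`. -/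
def graphMap (t : ℝ) (w : E 2) : E 4 := graphPt b (jet u (t, w))

/-- The value of a two-form on the unit tangent two-vector of a graph. -/
def graphStar (G W : E 4 → E 4 →L[ℝ] E 4 →L[ℝ] ℝ) (J : Jet) : ℝ :=
  starA (G (graphPt b J)) (graphTan b J) (W (graphPt b J))

variable {b u} {O : Set SpaceTime} {t : ℝ} {w : E 2}

theorem pder_slice {W : Type*} [NormedAddCommGroup W] [NormedSpace ℝ W] {f : SpaceTime → W}
    (hf : DifferentiableAt ℝ f (t, w)) (i : Fin 2) :
    pder (dir i) (fun x => f (t, x)) w = pder (vs i) f (t, w) := by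
  have hc : HasFDerivAt (fun x : E 2 => ((t, x) : SpaceTime))
      ((0 : E 2 →L[ℝ] ℝ).prod (ContinuousLinearMap.id ℝ (E 2))) w :=
    (hasFDerivAt_const t w).prodMk (hasFDerivAt_id w)
  have h := pder_comp (g := f) (f := fun x : E 2 => ((t, x) : SpaceTime)) hf
    hc.differentiableAt (dir i)
  rw [h]
  simp only [pder, hc.fderiv]
  rfl

section

variable (hO : IsOpen O) (hu : ∀ a, ContDiffOn ℝ ∞ (u a) O) (hz : (t, w) ∈ O)

include hO hu hz

theorem pd_graphMap (i : Fin 2) : pd (graphMap b u t) w i = graphTan b (jet u (t, w)) i := by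
  have hd : ∀ a, DifferentiableAt ℝ (u a) (t, w) := fun a =>
    ((hu a).contDiffAt (hO.mem_nhds hz)).differentiableAt (by simp)
  have hs : ∀ a, HasFDerivAt (fun x : E 2 => u a (t, x))
      (fderiv ℝ (fun x : E 2 => u a (t, x)) w) w := fun a =>
    (DifferentiableAt.comp (g := u a) w (hd a)
      ((differentiableAt_const t).prodMk differentiableAt_id)).hasFDerivAt
  have h1 : HasFDerivAt (graphMap b u t)
      (∑ k, (EuclideanSpace.proj (𝕜 := ℝ) k).smulRight (b (Sum.inl k)) +
        ∑ a, (fderiv ℝ (fun x : E 2 => u a (t, x)) w).smulRight (b (Sum.inr a))) w := by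
    refine HasFDerivAt.add (HasFDerivAt.fun_sum fun k _ => ?_) (HasFDerivAt.fun_sum fun a _ => ?_)
    · exact (EuclideanSpace.proj (𝕜 := ℝ) (ι := Fin 2) k).hasFDerivAt.smul_const _
    · exact (hs a).smul_const _
  have h2 : ∀ a, fderiv ℝ (fun x : E 2 => u a (t, x)) w (dir i) = pder (vs i) (u a) (t, w) :=
    fun a => pder_slice (hd a) i
  rw [pd, h1.fderiv]
  simp only [add_apply, sum_apply, ContinuousLinearMap.smulRight_apply, h2, graphTan, jet]
  congr 1
  simp [dir]

theorem pder_pder_graphMap (i j : Fin 2) : pder (dir i) (pder (dir j) (graphMap b u t)) w =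
    ∑ a, GraphSystem.hess u (i, j, a) (t, w) • b (Sum.inr a) := by
  have hev : ∀ᶠ x in nhds w, (t, x) ∈ O :=
    (Continuous.continuousAt (by fun_prop : Continuous fun x : E 2 => ((t, x) : SpaceTime))).eventually
      (hO.mem_nhds hz)
  have he : pder (dir j) (graphMap b u t) =ᶠ[nhds w] fun x =>
      b (Sum.inl j) + ∑ a, pder (vs j) (u a) (t, x) • b (Sum.inr a) := by
    filter_upwards [hev] with x hx
    exact pd_graphMap hO hu hx j
  have hd : ∀ a, DifferentiableAt ℝ (pder (vs j) (u a)) (t, w) := fun a =>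
    ((contDiffOn_pder (hu a) hO (vs j)).contDiffAt (hO.mem_nhds hz)).differentiableAt (by simp)
  have hs : ∀ a, HasFDerivAt (fun x : E 2 => pder (vs j) (u a) (t, x))
      (fderiv ℝ (fun x : E 2 => pder (vs j) (u a) (t, x)) w) w := fun a =>
    (DifferentiableAt.comp (g := pder (vs j) (u a)) w (hd a)
      ((differentiableAt_const t).prodMk differentiableAt_id)).hasFDerivAt
  have h1 : HasFDerivAt (fun x => b (Sum.inl j) + ∑ a, pder (vs j) (u a) (t, x) • b (Sum.inr a))
      (∑ a, (fderiv ℝ (fun x : E 2 => pder (vs j) (u a) (t, x)) w).smulRight (b (Sum.inr a))) w :=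
    (HasFDerivAt.fun_sum fun a _ => (hs a).smul_const _).const_add _
  have h2 : ∀ a, fderiv ℝ (fun x : E 2 => pder (vs j) (u a) (t, x)) w (dir i) =
      pder (vs i) (pder (vs j) (u a)) (t, w) := fun a => pder_slice (hd a) i
  rw [pder_def, he.fderiv_eq, h1.fderiv]
  simp only [sum_apply, ContinuousLinearMap.smulRight_apply, h2]
  rfl

variable {G : E 4 → E 4 →L[ℝ] E 4 →L[ℝ] ℝ}

theorem ambientHess_graphMap (i j : Fin 2) : ambientHess (unb G) (graphMap b u t) w i j =
    ∑ a, GraphSystem.hess u (i, j, a) (t, w) • b (Sum.inr a) +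
      christoffel (unb G) (graphPt b (jet u (t, w))) (graphTan b (jet u (t, w)) i)
        (graphTan b (jet u (t, w)) j) := by
  rw [ambientHess_eq, pder_pder_graphMap hO hu hz, ← pd_eq, ← pd_eq, pd_graphMap hO hu hz,
    pd_graphMap hO hu hz]
  rfl

theorem vert_ambientHess_graphMap (i j a : Fin 2) :
    vertL b (jet u (t, w)) (ambientHess (unb G) (graphMap b u t) w i j) a =
      GraphSystem.hess u (i, j, a) (t, w) + graphBe b G (i, j, a) (jet u (t, w)) := by
  rw [ambientHess_graphMap hO hu hz, map_add, map_sum]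
  simp only [map_smul, vert_inr, Pi.add_apply, Finset.sum_apply, Pi.smul_apply, Pi.single_apply]
  simp [vertL_apply, graphBe]

theorem starPullback_graphMap {W : E 4 → E 4 →L[ℝ] E 4 →L[ℝ] ℝ} :
    starPullback (unb G) (graphMap b u t) (unb W) w = graphStar b G W (jet u (t, w)) := by
  rw [starPullback_eq, funext (pd_graphMap (b := b) hO hu hz)]
  rfl

variable {Ω : Set (E 4)} (hΩ : IsOpen Ω) (hG : ContDiffOn ℝ ∞ G Ω)
  (hi : ∀ y ∈ Ω, IsInner (G y)) (hs : ∀ y v w, G y v w = G y w v)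

theorem vert_meanCurv_graphMap (a : Fin 2) :
    vertL b (jet u (t, w)) (meanCurv (unb G) (graphMap b u t) w) a =
      ∑ k, ∑ l, (graphSystem b G Ω hΩ hG hi hs).gi k l (jet u (t, w)) *
        (graphSystem b G Ω hΩ hG hi hs).V u (k, l, a) (t, w) := by
  rw [meanCurv_eq, funext (pd_graphMap (b := b) hO hu hz), meanA]
  simp only [map_sum, map_smul, Finset.sum_apply, Pi.smul_apply, vert_norA,
    vert_ambientHess_graphMap hO hu hz]
  rfl

theorem sffNormSq_graphMap (hJ : graphPt b (jet u (t, w)) ∈ Ω) :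
    sffNormSq (unb G) (graphMap b u t) w = (graphSystem b G Ω hΩ hG hi hs).Q u (t, w) := by
  have hdet := ((hi _ hJ).det_gramA_pos (linearIndependent_graphTan (b := b) (jet u (t, w)))).ne'
  rw [sffNormSq_eq, funext (pd_graphMap (b := b) hO hu hz), sffNormSqA]
  simp only [show G (graphMap b u t w) = G (graphPt b (jet u (t, w))) from rfl]
  simp only [norA_eq_of_vert hdet (ambientHess (unb G) (graphMap b u t) w _ _),
    ← vertL_apply, vert_ambientHess_graphMap hO hu hz]
  have e : ∀ i j a, GraphSystem.hess u (i, j, a) (t, w) + graphBe b G (i, j, a) (jet u (t, w)) =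
      (graphSystem b G Ω hΩ hG hi hs).V u (i, j, a) (t, w) := fun _ _ _ => rfl
  simp only [e, GraphSystem.Q, Fintype.sum_prod_type]
  generalize (graphSystem b G Ω hΩ hG hi hs).V u = V
  have hn : ∀ I I', (graphSystem b G Ω hΩ hG hi hs).nf I I' (jet u (t, w)) =
    (gramA (G (graphPt b (jet u (t, w)))) (graphTan b (jet u (t, w))))⁻¹ I.1 I'.1 *
    (gramA (G (graphPt b (jet u (t, w)))) (graphTan b (jet u (t, w))))⁻¹ I.2.1 I'.2.1 *
    (G (graphPt b (jet u (t, w))) (norA (G (graphPt b (jet u (t, w)))) (graphTan b (jet u (t, w)))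
      (b (Sum.inr I.2.2))) (norA (G (graphPt b (jet u (t, w)))) (graphTan b (jet u (t, w)))
      (b (Sum.inr I'.2.2)))) := fun _ _ => rfl
  simp only [hn]
  generalize (gramA (G (graphPt b (jet u (t, w)))) (graphTan b (jet u (t, w))))⁻¹ = m
  generalize norA (G (graphPt b (jet u (t, w)))) (graphTan b (jet u (t, w))) = n
  generalize G (graphPt b (jet u (t, w))) = β
  simp only [Fin.sum_univ_two, map_add, map_smul, add_apply, smul_apply, smul_eq_mul]
  ring

end

end GraphGeometry

end SurfaceMCF

end

noncomputable section

namespace SurfaceMCF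

/-! ### Calibrated planes in an orthonormal frame -/

section Calibrated

variable {m : ℕ}

/-- The comass of the two-form `θ` for the inner product `β` is at most one. -/
def ComassLE (β θ : E m →L[ℝ] E m →L[ℝ] ℝ) : Prop :=
  ∀ u v, θ u v ^ 2 ≤ β u u * β v v - β u v ^ 2

theorem ComassLE.abs_starA_le {β θ : E m →L[ℝ] E m →L[ℝ] ℝ} (h : ComassLE β θ) (hβ : IsInner β)
    {T : Fin 2 → E m} (hT : LinearIndependent ℝ T) : |starA β T θ| ≤ 1 := by
  have hd := hβ.det_gramA_pos hT
  have h1 := h (T 0) (T 1)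
  have h2 : θ (T 0) (T 1) ^ 2 ≤ (gramA β T).det := by
    rw [Matrix.det_fin_two]
    simp only [gramA, Matrix.of_apply, hβ.symm (T 1) (T 0)]
    linarith
  rw [starA, abs_div, abs_of_pos (Real.sqrt_pos.2 hd), div_le_one (Real.sqrt_pos.2 hd)]
  exact Real.abs_le_sqrt h2

/-- The basis is orthonormal for `β`. -/
def IsOrthonormal (b : SplitBasis) (β : E 4 →L[ℝ] E 4 →L[ℝ] ℝ) : Prop :=
  ∀ c d, β (b c) (b d) = if c = d then 1 else 0

/-- The first half of the basis is calibrated by `θ`, which is in normal form. -/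
structure IsCalibratedBy (b : SplitBasis) (θ : E 4 →L[ℝ] E 4 →L[ℝ] ℝ) : Prop where
  alt : ∀ v, θ v v = 0
  one : θ (b (Sum.inl 0)) (b (Sum.inl 1)) = 1
  cross : ∀ i a, θ (b (Sum.inl i)) (b (Sum.inr a)) = 0
  le_one : |θ (b (Sum.inr 0)) (b (Sum.inr 1))| ≤ 1

theorem antisymm_of_alternating {θ : E m →L[ℝ] E m →L[ℝ] ℝ} (h : ∀ v, θ v v = 0) (v w : E m) :
    θ v w = -θ w v := by
  have := h (v + w)
  simp only [map_add, add_apply, h] at this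
  linarith

/-- First-order growth in s cannot be dominated by second-order growth; the single value s = a
already gives (1 + a²)² ≤ 1 + a². -/
theorem eq_zero_of_sq_le {a : ℝ} (h : ∀ s : ℝ, (1 + s * a) ^ 2 ≤ 1 + s ^ 2) : a = 0 := by
  have h1 := h a
  nlinarith [sq_nonneg a, sq_nonneg (a ^ 2)]

variable {b : SplitBasis} {β θ : E 4 →L[ℝ] E 4 →L[ℝ] ℝ}

/-- First variation: tilting a calibrated plane towards a normal vector cannot raise the form above
the comass, so the mixed components vanish. The last bound is the comass on the normal plane. -/
theorem IsOrthonormal.isCalibratedBy (hb : IsOrthonormal b β) (hθ : ∀ v, θ v v = 0)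
    (hc : ComassLE β θ) (h1 : θ (b (Sum.inl 0)) (b (Sum.inl 1)) = 1) : IsCalibratedBy b θ := by
  have h10 : θ (b (Sum.inl 1)) (b (Sum.inl 0)) = -1 := by rw [antisymm_of_alternating hθ, h1]
  refine ⟨hθ, h1, fun i a => ?_, ?_⟩
  · fin_cases i
    · refine eq_zero_of_sq_le fun s => ?_
      have := hc (b (Sum.inl 0)) (b (Sum.inl 1) + s • b (Sum.inr a))
      simp only [map_add, map_smul, add_apply, smul_apply, smul_eq_mul, hb _ _, h1] at this
      simp at this
      simp only [Fin.zero_eta, Fin.isValue]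
      nlinarith
    · refine eq_zero_of_sq_le fun s => ?_
      have := hc (b (Sum.inl 1)) (b (Sum.inl 0) - s • b (Sum.inr a))
      simp only [map_sub, map_smul, sub_apply, smul_apply, smul_eq_mul, hb _ _, h10] at this
      simp at this
      simp only [Fin.mk_one, Fin.isValue]
      nlinarith
  · have := hc (b (Sum.inr 0)) (b (Sum.inr 1))
    simp only [hb _ _] at this
    simp at this
    exact this

/-- The sum of two calibrations is strictly concave in the slope at a calibrated plane. -/
theorem sum_starA_slope_le {ω' ω'' : E 4 →L[ℝ] E 4 →L[ℝ] ℝ} (hb : IsOrthonormal b β)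
    (h' : IsCalibratedBy b ω') (h'' : IsCalibratedBy b ω'')
    (hc : ω' (b (Sum.inr 0)) (b (Sum.inr 1)) * ω'' (b (Sum.inr 0)) (b (Sum.inr 1)) < 0)
    {J : Jet} (hJ : ∑ i, ∑ a, J.2.2 i a ^ 2 ≤ 1 / 2) :
    starA β (graphTan b J) ω' + starA β (graphTan b J) ω'' ≤
      2 - 1 / 4 * ∑ i, ∑ a, J.2.2 i a ^ 2 := by
  set P := J.2.2 with hP
  set D := P 0 0 * P 1 1 - P 0 1 * P 1 0 with hD
  set q := ∑ i, ∑ a, P i a ^ 2 with hq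
  have hq' : q = P 0 0 ^ 2 + P 0 1 ^ 2 + (P 1 0 ^ 2 + P 1 1 ^ 2) := by
    simp [hq, Fin.sum_univ_two]
  have hq0 : 0 ≤ q := by rw [hq']; positivity
  have hw : ∀ {θ}, IsCalibratedBy b θ → θ (graphTan b J 0) (graphTan b J 1) =
      1 + θ (b (Sum.inr 0)) (b (Sum.inr 1)) * D := fun {θ} h => by
    have e1 : ∀ i a, θ (b (Sum.inr a)) (b (Sum.inl i)) = 0 := fun i a => by
      rw [antisymm_of_alternating h.alt, h.cross, neg_zero]
    simp only [graphTan, Fin.sum_univ_two, map_add, map_smul, add_apply, smul_apply, smul_eq_mul,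
      h.one, h.cross, e1, h.alt, antisymm_of_alternating h.alt (b (Sum.inr 1)) (b (Sum.inr 0)), hD]
    ring
  have hg : (gramA β (graphTan b J)).det = 1 + q + D ^ 2 := by
    rw [Matrix.det_fin_two]
    simp only [gramA, Matrix.of_apply, graphTan, Fin.sum_univ_two, map_add, map_smul, add_apply,
      smul_apply, smul_eq_mul, hb _ _]
    simp [hq', hD]
    ring
  -- The slope 2/5 < 1/2 is admissible because (1 + 2q/5)² ≤ 1 + q for q ≤ 1/2.
  have hs : 1 + 2 / 5 * q ≤ Real.sqrt (1 + q + D ^ 2) := by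
    apply Real.le_sqrt_of_sq_le
    nlinarith [sq_nonneg D]
  -- Two numbers of opposite signs in [-1,1] have their sum in [-1,1]. Without the sign condition
  -- the sum could be 2 and the strict concavity would fail.
  have hc2 : |ω' (b (Sum.inr 0)) (b (Sum.inr 1)) + ω'' (b (Sum.inr 0)) (b (Sum.inr 1))| ≤ 1 := by
    have a1 := abs_le.1 h'.le_one
    have a2 := abs_le.1 h''.le_one
    rw [abs_le]
    rcases mul_neg_iff.1 hc with ⟨p, n⟩ | ⟨p, n⟩ <;> constructor <;> linarith
  have hDq : |D| ≤ q / 2 := by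
    rw [abs_le, hq', hD]
    constructor <;> nlinarith [sq_nonneg (P 0 0 + P 1 1), sq_nonneg (P 0 1 + P 1 0),
      sq_nonneg (P 0 0 - P 1 1), sq_nonneg (P 0 1 - P 1 0)]
  rw [starA, starA, hw h', hw h'', hg, ← add_div]
  have hs0 : 0 < Real.sqrt (1 + q + D ^ 2) := by linarith
  rw [div_le_iff₀ hs0]
  have hprod : (ω' (b (Sum.inr 0)) (b (Sum.inr 1)) + ω'' (b (Sum.inr 0)) (b (Sum.inr 1))) * D
      ≤ q / 2 := by
    refine (le_abs_self _).trans ?_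
    rw [abs_mul]
    calc _ ≤ 1 * |D| := by gcongr
      _ ≤ _ := by linarith
  -- The remaining inequality is 2 + q/2 ≤ (2 - q/4)(1 + 2q/5), valid for 0 ≤ q ≤ 1/2.
  nlinarith [mul_le_mul_of_nonneg_left hs (by linarith : 0 ≤ 2 - 1 / 4 * q)]

end Calibrated

/-! ### Uniform estimates on compact sets of jets -/

section CompactJets

theorem exists_boundedTwo {K D : Set Jet} (hK : IsCompact K) (hD : IsOpen D) (hKD : K ⊆ D)
    {Ψ : Jet → ℝ} (hΨ : ContDiffOn ℝ ∞ Ψ D) : ∃ B, ∀ B' ≥ B, BoundedTwo B' K Ψ := by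
  have h1 : ContDiffOn ℝ ∞ (fderiv ℝ Ψ) D := hΨ.fderiv_of_isOpen hD (m := ∞) (by simp)
  have h2 : ContDiffOn ℝ ∞ (fderiv ℝ (fderiv ℝ Ψ)) D := h1.fderiv_of_isOpen hD (m := ∞) (by simp)
  obtain ⟨B0, hB0⟩ := hK.exists_bound_of_continuousOn (hΨ.continuousOn.mono hKD)
  obtain ⟨B1, hB1⟩ := hK.exists_bound_of_continuousOn (h1.continuousOn.mono hKD)
  obtain ⟨B2, hB2⟩ := hK.exists_bound_of_continuousOn
    (f := fun J => (fderiv ℝ (fderiv ℝ Ψ) J : Jet →L[ℝ] Jet →L[ℝ] ℝ)) (h2.continuousOn.mono hKD)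
  refine ⟨max B0 (max B1 B2), fun B' hB' => ⟨fun J hJ => ?_, fun J hJ => ?_, fun J hJ a b => ?_⟩⟩
  · exact (hB0 J hJ).trans ((le_max_left _ _).trans hB')
  · exact (hB1 J hJ).trans (((le_max_left _ _).trans (le_max_right _ _)).trans hB')
  · rw [pder_pder_eq (contDiffAt_two_of_contDiffOn hΨ hD (hKD hJ))]
    have hB2' := (hB2 J hJ).trans (((le_max_right B1 B2).trans (le_max_right B0 _)).trans hB')
    calc |fderiv ℝ (fderiv ℝ Ψ) J a b| ≤ ‖fderiv ℝ (fderiv ℝ Ψ) J‖ * ‖a‖ * ‖b‖ :=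
        (fderiv ℝ (fderiv ℝ Ψ) J).le_opNorm₂ a b
      _ ≤ _ := by gcongr

theorem GraphSystem.exists_bounds (Sy : GraphSystem) {K : Set Jet} (hK : IsCompact K)
    (hKD : K ⊆ Sy.dom) : ∃ B, ∀ B' ≥ B, Sy.Bounds B' K := by
  choose B1 h1 using fun k l => exists_boundedTwo hK Sy.isOpen_dom hKD (Sy.smooth_gi k l)
  choose B2 h2 using fun I => exists_boundedTwo hK Sy.isOpen_dom hKD (Sy.smooth_be I)
  choose B3 h3 using fun I I' => exists_boundedTwo hK Sy.isOpen_dom hKD (Sy.smooth_nf I I')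
  obtain ⟨B0, hB0⟩ := hK.isBounded.exists_norm_le
  have e : ∀ᶠ B' : ℝ in Filter.atTop, 1 ≤ B' ∧ B0 ≤ B' ∧ (∀ k l, B1 k l ≤ B') ∧
      (∀ I, B2 I ≤ B') ∧ (∀ I I', B3 I I' ≤ B') := by
    simp only [Filter.eventually_and, Filter.eventually_all]
    exact ⟨Filter.eventually_ge_atTop _, Filter.eventually_ge_atTop _,
      fun _ _ => Filter.eventually_ge_atTop _, fun _ => Filter.eventually_ge_atTop _,
      fun _ _ => Filter.eventually_ge_atTop _⟩
  obtain ⟨B, hB⟩ := Filter.eventually_atTop.1 e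
  refine ⟨B, fun B' hB' => ?_⟩
  obtain ⟨a1, a2, a3, a4, a5⟩ := hB B' hB'
  exact ⟨a1, hKD, fun J hJ => (hB0 J hJ).trans a2, fun k l => h1 k l _ (a3 k l),
    fun I => h2 I _ (a4 I), fun I I' => h3 I I' _ (a5 I I')⟩

/-- Each entry of the deviation from the identity is charged to (xᵢ² + xⱼ²)/2. Over all pairs the
charges add up to half of ∑ xᵢ². -/
theorem half_sum_sq_le {ι : Type*} [Fintype ι] [DecidableEq ι] {m : ι → ι → ℝ}
    (hm : ∀ i j, |m i j - if i = j then 1 else 0| ≤ (2 * (Fintype.card ι : ℝ))⁻¹) (x : ι → ℝ) :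
    1 / 2 * ∑ i, x i ^ 2 ≤ ∑ i, ∑ j, m i j * (x i * x j) := by
  rcases isEmpty_or_nonempty ι with hι | hι
  · simp
  set c : ℝ := (2 * (Fintype.card ι : ℝ))⁻¹ with hc
  have hcard : (0 : ℝ) < Fintype.card ι := by exact_mod_cast Fintype.card_pos
  have h1 : ∀ i j, (if i = j then 1 else 0) * (x i * x j) - c * ((x i ^ 2 + x j ^ 2) / 2) ≤
      m i j * (x i * x j) := fun i j => by
    have h2 := abs_le.1 (hm i j)
    have h3 : |(m i j - if i = j then 1 else 0) * (x i * x j)| ≤ c * ((x i ^ 2 + x j ^ 2) / 2) := by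
      rw [abs_mul]
      refine mul_le_mul (hm i j) ?_ (abs_nonneg _) (by positivity)
      rw [abs_le]
      constructor <;> nlinarith [sq_nonneg (x i + x j), sq_nonneg (x i - x j)]
    have h4 := abs_le.1 h3
    nlinarith [h4.1]
  have h2 := Finset.sum_le_sum fun i (_ : i ∈ Finset.univ) =>
    Finset.sum_le_sum fun j (_ : j ∈ Finset.univ) => h1 i j
  refine le_trans (le_of_eq ?_) h2
  have e1 : ∀ i, ∑ j, (if i = j then (1 : ℝ) else 0) * (x i * x j) = x i ^ 2 := fun i => by
    simp [sq]
  simp only [Finset.sum_sub_distrib, e1, ← Finset.mul_sum, ← Finset.sum_div, Finset.sum_add_distrib,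
    Finset.sum_const, Finset.card_univ, nsmul_eq_mul]
  rw [hc]
  field_simp
  ring

/-- Quadratic bounds at a maximum: a function with values at most two, attained only where both
summands are one, has small derivative where both summands are nearly one. -/
theorem exists_norm_fderiv_le {K D : Set Jet} (hK : IsCompact K) (hD : IsOpen D) (hKD : K ⊆ D)
    {φ' φ'' : Jet → ℝ} (h' : ContDiffOn ℝ ∞ φ' D) (h'' : ContDiffOn ℝ ∞ φ'' D)
    (hle' : ∀ J ∈ D, φ' J ≤ 1) (hle'' : ∀ J ∈ D, φ'' J ≤ 1) {δ : ℝ} (hδ : 0 < δ) :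
    ∃ ε > 0, ∀ J ∈ K, 1 - ε < φ' J → 1 - ε < φ'' J →
      ‖fderiv ℝ (fun J => φ' J + φ'' J) J‖ ≤ δ := by
  have hη : ContDiffOn ℝ ∞ (fun J => φ' J + φ'' J) D := h'.add h''
  have hd : ContinuousOn (fun J => ‖fderiv ℝ (fun J => φ' J + φ'' J) J‖) K :=
    ((hη.fderiv_of_isOpen hD (m := ∞) (by simp)).continuousOn.mono hKD).norm
  -- On this compact set of bad jets the minimum of the two functions stays away from 1, and the gap
  -- is the required ε.
  set Z : Set Jet := K ∩ {J | δ ≤ ‖fderiv ℝ (fun J => φ' J + φ'' J) J‖} with hZ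
  have hZc : IsCompact Z := by
    have := hd.preimage_isClosed_of_isClosed hK.isClosed (isClosed_Ici (a := δ))
    exact hK.of_isClosed_subset this Set.inter_subset_left
  rcases Z.eq_empty_or_nonempty with he | hne
  · refine ⟨1, one_pos, fun J hJ _ _ => ?_⟩
    by_contra hcon
    have : J ∈ Z := ⟨hJ, (not_le.1 hcon).le⟩
    rw [he] at this
    exact this
  have hcont : ContinuousOn (fun J => min (φ' J) (φ'' J)) Z :=
    ContinuousOn.inf ((h'.continuousOn.mono hKD).mono Set.inter_subset_left)
      ((h''.continuousOn.mono hKD).mono Set.inter_subset_left)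
  obtain ⟨J1, hJ1, hmax⟩ := hZc.exists_isMaxOn hne hcont
  have hlt : min (φ' J1) (φ'' J1) < 1 := by
    by_contra hcon
    have h1 := le_min_iff.1 (not_lt.1 hcon)
    -- If both functions were 1 at `J1`, the sum would attain its upper bound 2 there and its
    -- derivative would vanish, contradicting membership in `Z`.
    have hloc : IsLocalMax (fun J => φ' J + φ'' J) J1 := by
      filter_upwards [hD.mem_nhds (hKD hJ1.1)] with J hJ
      linarith [hle' J hJ, hle'' J hJ, h1.1, h1.2]
    have h2 : δ ≤ ‖fderiv ℝ (fun J => φ' J + φ'' J) J1‖ := hJ1.2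
    rw [hloc.fderiv_eq_zero, norm_zero] at h2
    linarith
  refine ⟨1 - min (φ' J1) (φ'' J1), by linarith, fun J hJ g' g'' => ?_⟩
  by_contra hcon
  have hJZ : J ∈ Z := ⟨hJ, (not_le.1 hcon).le⟩
  have := hmax hJZ
  simp only [Set.mem_ofPred_eq] at this
  rcases min_le_iff.1 (le_refl (min (φ' J) (φ'' J))) with h | h <;> linarith

end CompactJets

end SurfaceMCF

end

noncomputable section

namespace SurfaceMCF

/-! ### The curvature estimate for graphs with nearly calibrated tangent planes -/

section JetEstimate

variable (b : SplitBasis)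

/-- The jet at `y` of the horizontal plane. -/
def baseJet (y : E 4) : Jet :=
  (WithLp.toLp 2 fun i => b.repr y (Sum.inl i), fun a => b.repr y (Sum.inr a), 0)

variable {b} {G W' W'' : E 4 → E 4 →L[ℝ] E 4 →L[ℝ] ℝ} {Ω : Set (E 4)} {y₀ : E 4}

theorem graphPt_baseJet (y : E 4) : graphPt b (baseJet b y) = y := by
  have h := b.sum_repr y
  rw [Fintype.sum_sum_type] at h
  exact h

/-- Changing only the slope leaves the point fixed, so along such lines the metric and the forms
remain those at one point and the linear algebra of calibrated planes applies. -/
theorem graphPt_add (y : E 4) (x : Fin 2 → Fin 2 → ℝ) :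
    graphPt b (baseJet b y + ((0, 0, x) : Jet)) = y := by
  conv_rhs => rw [← graphPt_baseJet (b := b) y]
  simp [graphPt, baseJet]

theorem graphTan_baseJet (y : E 4) (i : Fin 2) : graphTan b (baseJet b y) i = b (Sum.inl i) := by
  simp [graphTan, baseJet]

theorem contDiffOn_graphStar (hG : ContDiffOn ℝ ∞ G Ω) (hi : ∀ y ∈ Ω, IsInner (G y))
    (hW : ContDiffOn ℝ ∞ W' Ω) : ContDiffOn ℝ ∞ (graphStar b G W') (graphPt b ⁻¹' Ω) := by
  unfold graphStar starA
  have hpos : ∀ J ∈ graphPt b ⁻¹' Ω, 0 < (gramA (G (graphPt b J)) (graphTan b J)).det := fun J hJ =>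
    (hi _ hJ).det_gramA_pos (linearIndependent_graphTan J)
  refine (contDiffOn_apply_apply (contDiffOn_metric_graphPt hW)
    (contDiff_graphTan b 0).contDiffOn (contDiff_graphTan b 1).contDiffOn).div
    ((contDiffOn_det (contDiffOn_gramA_graphTan hG)).sqrt fun J hJ => (hpos J hJ).ne')
    fun J hJ => (Real.sqrt_pos.2 (hpos J hJ)).ne'

theorem pder_pder_slope_sq (x : Fin 2 → Fin 2 → ℝ) (J : Jet) :
    pder ((0, 0, x) : Jet) (pder ((0, 0, x) : Jet) (fun J : Jet => ∑ i, ∑ a, J.2.2 i a ^ 2)) J =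
      2 * ∑ i, ∑ a, x i a ^ 2 := by
  have hl : ∀ i a, ∀ J : Jet, HasFDerivAt (fun J : Jet => J.2.2 i a)
      (((ContinuousLinearMap.proj a).comp (ContinuousLinearMap.proj i)).comp
        ((ContinuousLinearMap.snd ℝ (Fin 2 → ℝ) (Fin 2 → Fin 2 → ℝ)).comp
          (ContinuousLinearMap.snd ℝ (E 2) _)) : Jet →L[ℝ] ℝ) J := fun i a J =>
    (((ContinuousLinearMap.proj a).comp (ContinuousLinearMap.proj i)).comp
        ((ContinuousLinearMap.snd ℝ (Fin 2 → ℝ) (Fin 2 → Fin 2 → ℝ)).comp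
          (ContinuousLinearMap.snd ℝ (E 2) _)) : Jet →L[ℝ] ℝ).hasFDerivAt
  have h1 : pder ((0, 0, x) : Jet) (fun J : Jet => ∑ i, ∑ a, J.2.2 i a ^ 2) =
      fun J => ∑ i, ∑ a, 2 * x i a * J.2.2 i a := by
    funext J
    have : HasFDerivAt (fun J : Jet => ∑ i, ∑ a, J.2.2 i a ^ 2) _ J :=
      HasFDerivAt.fun_sum fun i _ => HasFDerivAt.fun_sum fun a _ => (hl i a J).pow 2
    rw [pder, this.fderiv]
    simp
    ring
  rw [h1]
  have : HasFDerivAt (fun J : Jet => ∑ i, ∑ a, 2 * x i a * J.2.2 i a) _ J :=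
    HasFDerivAt.fun_sum fun i _ => HasFDerivAt.fun_sum fun a _ => (hl i a J).const_mul (2 * x i a)
  rw [pder, this.fderiv]
  simp
  ring

theorem norm_sq_le_sum_sum_sq (x : Fin 2 → Fin 2 → ℝ) : ‖x‖ ^ 2 ≤ ∑ i, ∑ a, x i a ^ 2 := by
  have h0 : 0 ≤ ∑ i, ∑ a, x i a ^ 2 := by positivity
  rw [← Real.le_sqrt (norm_nonneg _) h0]
  refine (pi_norm_le_iff_of_nonneg (Real.sqrt_nonneg _)).2 fun i =>
    (pi_norm_le_iff_of_nonneg (Real.sqrt_nonneg _)).2 fun a => Real.abs_le_sqrt ?_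
  exact (Finset.single_le_sum (f := fun a => x i a ^ 2) (fun a _ => sq_nonneg _)
    (Finset.mem_univ a)).trans (Finset.single_le_sum (f := fun i => ∑ a, x i a ^ 2)
      (fun i _ => by positivity) (Finset.mem_univ i))

theorem eventually_norm_sub_lt_of_continuousAt {X Y : Type*} [TopologicalSpace X]
    [NormedAddCommGroup Y] {f : X → Y} {x : X} (hf : ContinuousAt f x) {c : ℝ} (hc : 0 < c) :
    ∀ᶠ y in nhds x, ‖f y - f x‖ < c :=
  (tendsto_iff_norm_sub_tendsto_zero.1 hf).eventually_lt_const hc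

theorem eventually_norm_sub_fderiv_fderiv_lt {X : Type*} [NormedAddCommGroup X] [NormedSpace ℝ X]
    {f : X → ℝ} {D : Set X} (hf : ContDiffOn ℝ ∞ f D) (hD : IsOpen D) {x : X} (hx : x ∈ D) {c : ℝ}
    (hc : 0 < c) : ∀ᶠ y in nhds x, ‖fderiv ℝ (fderiv ℝ f) y - fderiv ℝ (fderiv ℝ f) x‖ < c := by
  have h2 : ContDiffOn ℝ ∞ (fderiv ℝ (fderiv ℝ f)) D :=
    (hf.fderiv_of_isOpen hD (m := ∞) (by simp)).fderiv_of_isOpen hD (m := ∞) (by simp)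
  have hcont : ContinuousAt (fderiv ℝ (fderiv ℝ f)) x :=
    h2.continuousOn.continuousAt (hD.mem_nhds hx)
  exact eventually_norm_sub_lt_of_continuousAt (Y := X →L[ℝ] X →L[ℝ] ℝ) hcont hc

/-! ### Coefficients and angle function near the jet of the calibrated plane. -/

section AtBase

variable (hb : IsOrthonormal b (G y₀))

include hb

theorem gramA_baseJet : gramA (G (graphPt b (baseJet b y₀))) (graphTan b (baseJet b y₀)) = 1 := by
  ext i j
  simp [gramA, graphPt_baseJet, graphTan_baseJet, hb _ _, Matrix.one_apply]

theorem graphInv_baseJet (k l : Fin 2) :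
    graphInv b G k l (baseJet b y₀) = if k = l then 1 else 0 := by
  rw [graphInv, gramA_baseJet hb, inv_one, Matrix.one_apply]

theorem graphNor_baseJet (a c : Fin 2) :
    graphNor b G a c (baseJet b y₀) = if a = c then 1 else 0 := by
  have h : ∀ a, norA (G (graphPt b (baseJet b y₀))) (graphTan b (baseJet b y₀)) (b (Sum.inr a)) =
      b (Sum.inr a) := fun a => by
    simp [norA, graphPt_baseJet, graphTan_baseJet, hb _ _]
  rw [graphNor, h, h, graphPt_baseJet, hb]
  simp

theorem graphNf_baseJet (I I' : HessIndex) :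
    graphNf b G I I' (baseJet b y₀) = if I = I' then 1 else 0 := by
  obtain ⟨i, j, a⟩ := I
  obtain ⟨k, l, c⟩ := I'
  simp only [graphNf, graphInv_baseJet hb, graphNor_baseJet hb, Prod.mk.injEq]
  split_ifs <;> simp_all

theorem graphStar_baseJet (h : IsCalibratedBy b (W' y₀)) : graphStar b G W' (baseJet b y₀) = 1 := by
  rw [graphStar, starA, gramA_baseJet hb, graphPt_baseJet, graphTan_baseJet, graphTan_baseJet, h.one]
  simp

/-- At the base jet both coefficient matrices are the identity, and continuity does the rest. The
singletons `{J}` make ellipticity a pointwise property, to be intersected with others before a ball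
is chosen. -/
theorem eventually_elliptic (hΩ : IsOpen Ω) (hG : ContDiffOn ℝ ∞ G Ω)
    (hi : ∀ y ∈ Ω, IsInner (G y)) (hs : ∀ y v w, G y v w = G y w v) (hy : y₀ ∈ Ω) :
    ∀ᶠ J in nhds (baseJet b y₀), (graphSystem b G Ω hΩ hG hi hs).Elliptic {J} := by
  set Sy := graphSystem b G Ω hΩ hG hi hs
  have hmem : Sy.dom ∈ nhds (baseJet b y₀) := Sy.isOpen_dom.mem_nhds (by
    change graphPt b _ ∈ Ω
    rwa [graphPt_baseJet])
  have close : ∀ {Ψ : Jet → ℝ} {v c : ℝ}, ContDiffOn ℝ ∞ Ψ Sy.dom → Ψ (baseJet b y₀) = v → 0 < c →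
      ∀ᶠ J in nhds (baseJet b y₀), |Ψ J - v| ≤ c := fun {Ψ v c} hΨ hv hc => by
    have h1 : ContinuousAt Ψ (baseJet b y₀) := hΨ.continuousOn.continuousAt hmem
    have h2 := h1.eventually (Metric.ball_mem_nhds _ hc)
    filter_upwards [h2] with J hJ
    rw [hv] at hJ
    exact (Metric.mem_ball.1 hJ).le
  have h1 : ∀ᶠ J in nhds (baseJet b y₀), ∀ k l : Fin 2,
      |Sy.gi k l J - if k = l then 1 else 0| ≤ (2 * (Fintype.card (Fin 2) : ℝ))⁻¹ := by
    simp only [Filter.eventually_all]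
    exact fun k l => close (Sy.smooth_gi k l) (graphInv_baseJet hb k l) (by simp)
  have h2 : ∀ᶠ J in nhds (baseJet b y₀), ∀ I I' : HessIndex,
      |Sy.nf I I' J - if I = I' then 1 else 0| ≤ (2 * (Fintype.card HessIndex : ℝ))⁻¹ := by
    simp only [Filter.eventually_all]
    exact fun I I' => close (Sy.smooth_nf I I') (graphNf_baseJet hb I I') (by simp)
  filter_upwards [h1, h2] with J g1 g2
  refine ⟨?_, ?_⟩
  · rintro J rfl x
    exact half_sum_sq_le g1 x
  · rintro J rfl x
    exact half_sum_sq_le g2 x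

variable (h' : IsCalibratedBy b (W' y₀)) (h'' : IsCalibratedBy b (W'' y₀))
  (hc : W' y₀ (b (Sum.inr 0)) (b (Sum.inr 1)) * W'' y₀ (b (Sum.inr 0)) (b (Sum.inr 1)) < 0)

include h' h'' hc

/-- By `sum_starA_slope_le`, the function η + |P|²/4 has a local maximum, with value 2, at the base
jet along every slope line. Its second derivative is nonpositive, and |P|²/4 accounts for |x|²/2. -/
theorem pder_pder_graphStar_le {D : Set Jet} (hD : IsOpen D)
    (hη : ContDiffOn ℝ ∞ (fun J => graphStar b G W' J + graphStar b G W'' J) D)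
    (hJ : baseJet b y₀ ∈ D) (x : Fin 2 → Fin 2 → ℝ) :
    pder ((0, 0, x) : Jet) (pder ((0, 0, x) : Jet)
      (fun J => graphStar b G W' J + graphStar b G W'' J)) (baseJet b y₀) ≤
      -(1 / 2 * ∑ i, ∑ a, x i a ^ 2) := by
  set η : Jet → ℝ := fun J => graphStar b G W' J + graphStar b G W'' J
  set q : Jet → ℝ := fun J => ∑ i, ∑ a, J.2.2 i a ^ 2 with hq
  have hqs : ContDiff ℝ ∞ q := by rw [hq]; fun_prop
  have h1 : ContDiffOn ℝ ∞ (fun J => η J + 1 / 4 * q J) D :=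
    hη.add (contDiff_const.mul hqs).contDiffOn
  have hη2 := contDiffAt_two_of_contDiffOn hη hD hJ
  have hq2 : ContDiffAt ℝ 2 (fun J => 1 / 4 * q J) (baseJet b y₀) :=
    contDiffAt_two_of_contDiffOn (contDiff_const.mul hqs).contDiffOn isOpen_univ (Set.mem_univ _)
  set v : Jet := (0, 0, x)
  have hmax : ∀ᶠ s in nhds (0 : ℝ), η (baseJet b y₀ + s • v) + 1 / 4 * q (baseJet b y₀ + s • v) ≤
      η (baseJet b y₀) + 1 / 4 * q (baseJet b y₀) := by
    have hcq : Continuous fun s : ℝ => q (baseJet b y₀ + s • v) :=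
      hqs.continuous.comp (by fun_prop)
    have hq0 : q (baseJet b y₀) = 0 := by simp [hq, baseJet]
    have hev := hcq.continuousAt.eventually_lt (x₀ := (0 : ℝ)) continuousAt_const
      (show q (baseJet b y₀ + (0 : ℝ) • v) < 1 / 2 by simp [hq0])
    filter_upwards [hev] with s hs
    have hpt : graphPt b (baseJet b y₀ + s • v) = y₀ := by
      have : s • v = ((0, 0, s • x) : Jet) := by simp [v]
      rw [this, graphPt_add]
    have hle := sum_starA_slope_le hb h' h'' hc hs.le
    have e0 : η (baseJet b y₀) = 2 := by
      simp only [η, graphStar_baseJet hb h', graphStar_baseJet hb h'']; norm_num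
    rw [e0, hq0]
    have e1 : η (baseJet b y₀ + s • v) = starA (G y₀) (graphTan b (baseJet b y₀ + s • v)) (W' y₀) +
        starA (G y₀) (graphTan b (baseJet b y₀ + s • v)) (W'' y₀) := by
      simp only [η, graphStar, hpt]
    rw [e1]
    simp only [hq] at hle ⊢
    linarith
  have h2 := pder_pder_nonpos_of_isLocalMax (contDiffAt_two_of_contDiffOn h1 hD hJ) v hmax
  have e2 : pder v (fun J => η J + 1 / 4 * q J) =ᶠ[nhds (baseJet b y₀)]
      fun J => pder v η J + pder v (fun J => 1 / 4 * q J) J := by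
    filter_upwards [hD.mem_nhds hJ] with J hJ
    exact pder_add ((hη.contDiffAt (hD.mem_nhds hJ)).differentiableAt (by simp))
      ((contDiff_const.mul hqs).differentiable (by simp) J) v
  have hη1 : DifferentiableAt ℝ (pder v η) (baseJet b y₀) :=
    ((contDiffOn_pder hη hD v).contDiffAt (hD.mem_nhds hJ)).differentiableAt (by simp)
  have hqd : ContDiff ℝ ∞ (pder v q) :=
    contDiffOn_univ.1 (contDiffOn_pder hqs.contDiffOn isOpen_univ v)
  have e3 : pder v (fun J => 1 / 4 * q J) = fun J => 1 / 4 * pder v q J := by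
    funext J
    have hd := hqs.differentiable (by simp) J
    rw [pder_mul (differentiableAt_const _) hd]
    simp
  have e4 : pder v (fun J => 1 / 4 * pder v q J) (baseJet b y₀) = 1 / 4 * pder v (pder v q) (baseJet b y₀) := by
    have hd := hqd.differentiable (by simp) (baseJet b y₀)
    rw [pder_mul (differentiableAt_const _) hd]
    simp
  rw [pder_def, e2.fderiv_eq, ← pder_def, pder_add hη1 (by
    rw [e3]; exact (hqd.differentiable (by simp) _).const_mul _), e3, e4,
    pder_pder_slope_sq] at h2
  linarith

/-- Continuity of the second derivative costs half of the constant 1/2 available at the base jet. -/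
theorem eventually_concave {D : Set Jet} (hD : IsOpen D)
    (hη : ContDiffOn ℝ ∞ (fun J => graphStar b G W' J + graphStar b G W'' J) D)
    (hJ : baseJet b y₀ ∈ D) : ∀ᶠ J in nhds (baseJet b y₀), GraphSystem.ConcaveOnFibers (1 / 4) {J}
      (fun J => graphStar b G W' J + graphStar b G W'' J) := by
  set η : Jet → ℝ := fun J => graphStar b G W' J + graphStar b G W'' J with hηd
  have hev : ∀ᶠ J in nhds (baseJet b y₀),
      ‖fderiv ℝ (fderiv ℝ η) J - fderiv ℝ (fderiv ℝ η) (baseJet b y₀)‖ < 1 / 4 :=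
    eventually_norm_sub_fderiv_fderiv_lt hη hD hJ (by norm_num)
  filter_upwards [hev, hD.mem_nhds hJ] with J h1 hJD
  rintro J rfl x
  have h3 := pder_pder_graphStar_le hb h' h'' hc hD hη hJ x
  rw [pder_pder_eq (contDiffAt_two_of_contDiffOn hη hD hJ)] at h3
  rw [pder_pder_eq (contDiffAt_two_of_contDiffOn hη hD hJD)]
  set v : Jet := (0, 0, x) with hv
  have hvn : ‖v‖ = ‖x‖ := by simp [hv, Prod.norm_def]
  set A := fderiv ℝ (fderiv ℝ η) J
  set A₀ := fderiv ℝ (fderiv ℝ η) (baseJet b y₀)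
  have h4 : ‖A - A₀‖ ≤ 1 / 4 := h1.le
  have h5 : (A - A₀) v v ≤ 1 / 4 * ∑ i, ∑ a, x i a ^ 2 := by
    calc (A - A₀) v v ≤ |(A - A₀) v v| := le_abs_self _
      _ ≤ ‖A - A₀‖ * ‖v‖ * ‖v‖ := (A - A₀).le_opNorm₂ v v
      _ ≤ 1 / 4 * ‖v‖ * ‖v‖ := by gcongr
      _ = 1 / 4 * ‖x‖ ^ 2 := by rw [hvn]; ring
      _ ≤ _ := by gcongr; exact norm_sq_le_sum_sum_sq x
  have h6 : A v v = A₀ v v + (A - A₀) v v := by simp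
  rw [h6]
  linarith

/-- The curvature estimate at an interior maximum, for solutions of the graph system. -/
theorem exists_jet_estimate (hΩ : IsOpen Ω) (hG : ContDiffOn ℝ ∞ G Ω)
    (hi : ∀ y ∈ Ω, IsInner (G y)) (hs : ∀ y v w, G y v w = G y w v) (hy : y₀ ∈ Ω)
    (hW' : ContDiffOn ℝ ∞ W' Ω) (hW'' : ContDiffOn ℝ ∞ W'' Ω)
    (hm' : ∀ y ∈ Ω, ComassLE (G y) (W' y)) (hm'' : ∀ y ∈ Ω, ComassLE (G y) (W'' y)) :
    ∃ r > 0, ∃ p₀ : ℝ, ∀ p ≥ p₀, ∃ ε > 0, ∃ R : ℝ, ∀ (O : Set SpaceTime)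
      (u : Fin 2 → SpaceTime → ℝ) (z : SpaceTime),
      (graphSystem b G Ω hΩ hG hi hs).IsSolution O u → z ∈ O →
      jet u z ∈ Metric.ball (baseJet b y₀) r →
      1 - ε < |graphStar b G W' (jet u z)| → 1 - ε < |graphStar b G W'' (jet u z)| →
      (∀ w ∈ O, w.1 ≤ z.1 → (graphSystem b G Ω hΩ hG hi hs).Q u w *
          Real.exp (-(p * (|graphStar b G W' (jet u w)| + |graphStar b G W'' (jet u w)|)))
        ≤ (graphSystem b G Ω hΩ hG hi hs).Q u z *
          Real.exp (-(p * (|graphStar b G W' (jet u z)| + |graphStar b G W'' (jet u z)|)))) →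
      (graphSystem b G Ω hΩ hG hi hs).Q u z ≤ R := by
  set Sy := graphSystem b G Ω hΩ hG hi hs with hSy
  have hJ : baseJet b y₀ ∈ Sy.dom := by
    change graphPt b _ ∈ Ω
    rwa [graphPt_baseJet]
  have s' : ContDiffOn ℝ ∞ (graphStar b G W') Sy.dom := contDiffOn_graphStar hG hi hW'
  have s'' : ContDiffOn ℝ ∞ (graphStar b G W'') Sy.dom := contDiffOn_graphStar hG hi hW''
  set η : Jet → ℝ := fun J => graphStar b G W' J + graphStar b G W'' J with hηd
  have hη : ContDiffOn ℝ ∞ η Sy.dom := s'.add s''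
  -- On `U` the absolute values are redundant, so the weight is the smooth function η of the jet.
  set U : Set Jet := {J | J ∈ Sy.dom ∧ 0 < graphStar b G W' J ∧ 0 < graphStar b G W'' J} with hU
  have hUo : IsOpen U := by
    have e : U = (Sy.dom ∩ graphStar b G W' ⁻¹' Set.Ioi 0) ∩
        (Sy.dom ∩ graphStar b G W'' ⁻¹' Set.Ioi 0) := by
      ext J
      simp only [hU, Set.mem_inter_iff, Set.mem_preimage, Set.mem_Ioi]
      exact ⟨fun h => ⟨⟨h.1, h.2.1⟩, h.1, h.2.2⟩, fun h => ⟨h.1.1, h.1.2, h.2.2⟩⟩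
    rw [e]
    exact (s'.continuousOn.isOpen_inter_preimage Sy.isOpen_dom isOpen_Ioi).inter
      (s''.continuousOn.isOpen_inter_preimage Sy.isOpen_dom isOpen_Ioi)
  have hJU : baseJet b y₀ ∈ U := by
    refine ⟨hJ, ?_, ?_⟩
    · rw [graphStar_baseJet hb h']; exact one_pos
    · rw [graphStar_baseJet hb h'']; exact one_pos
  have hev := ((eventually_elliptic hb hΩ hG hi hs hy).and
    (eventually_concave hb h' h'' hc Sy.isOpen_dom hη hJ)).and (hUo.mem_nhds hJU)
  obtain ⟨r, hr, hball⟩ := Metric.nhds_basis_closedBall.eventually_iff.1 hev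
  set K := Metric.closedBall (baseJet b y₀) r with hK
  have hKc : IsCompact K := isCompact_closedBall _ _
  have hKU : K ⊆ U := fun J hJ => (hball hJ).2
  have hKD : K ⊆ Sy.dom := fun J hJ => (hKU hJ).1
  have hE : Sy.Elliptic K := ⟨fun J hJ => (hball hJ).1.1.gi J rfl,
    fun J hJ => (hball hJ).1.1.nf J rfl⟩
  have hcv : GraphSystem.ConcaveOnFibers (1 / 4) K η := fun J hJ => (hball hJ).1.2 J rfl
  obtain ⟨B1, hB1⟩ := Sy.exists_bounds hKc hKD
  obtain ⟨B2, hB2⟩ := exists_boundedTwo hKc Sy.isOpen_dom hKD hη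
  obtain ⟨p₀, hp₀⟩ := GraphSystem.exists_bound_at_max (hB1 (max B1 B2) (le_max_left _ _)) hE hη
    (hB2 (max B1 B2) (le_max_right _ _)) (by norm_num) hcv
  refine ⟨r, hr, p₀, fun p hp => ?_⟩
  obtain ⟨δ, hδ, R, hR⟩ := hp₀ p hp
  have hle' : ∀ J ∈ Sy.dom, graphStar b G W' J ≤ 1 := fun J hJ =>
    (le_abs_self _).trans ((hm' _ hJ).abs_starA_le (hi _ hJ) (linearIndependent_graphTan J))
  have hle'' : ∀ J ∈ Sy.dom, graphStar b G W'' J ≤ 1 := fun J hJ =>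
    (le_abs_self _).trans ((hm'' _ hJ).abs_starA_le (hi _ hJ) (linearIndependent_graphTan J))
  obtain ⟨ε, hε, hεd⟩ := exists_norm_fderiv_le hKc Sy.isOpen_dom hKD s' s'' hle' hle'' hδ
  refine ⟨ε, hε, R, fun O u z hsol hz hzr g' g'' hmax => ?_⟩
  have hzK : jet u z ∈ K := Metric.ball_subset_closedBall hzr
  -- A maximum over O remains one over the smaller open set where all jets stay in `U`.
  set O' := O ∩ jet u ⁻¹' U with hO'
  have hO'o : IsOpen O' := hsol.smooth_jet.continuousOn.isOpen_inter_preimage hsol.isOpen hUo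
  have hsol' : Sy.IsSolution O' u := ⟨hO'o, fun a => (hsol.smooth a).mono Set.inter_subset_left,
    fun z hz => hsol.mem z hz.1, fun z hz => hsol.eqn z hz.1⟩
  have habs : ∀ J ∈ U, |graphStar b G W' J| + |graphStar b G W'' J| = η J := fun J hJ => by
    rw [abs_of_pos hJ.2.1, abs_of_pos hJ.2.2]
  refine hR O' u z hsol' ⟨hz, hKU hzK⟩ hzK (hεd _ hzK ?_ ?_) fun w hw hwt => ?_
  · rwa [abs_of_pos (hKU hzK).2.1] at g'
  · rwa [abs_of_pos (hKU hzK).2.2] at g''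
  · have := hmax w hw.1 hwt
    rwa [habs _ hw.2, habs _ (hKU hzK)] at this

end AtBase

end JetEstimate

end SurfaceMCF

end

noncomputable section

namespace SurfaceMCF

/-! ### Orthonormal frames and planes -/

section Frames

variable {m : ℕ} {β θ : E m →L[ℝ] E m →L[ℝ] ℝ}

/-- Gram-Schmidt orthonormalization of a pair of vectors. -/
theorem IsInner.exists_orthonormal_pair (hβ : IsInner β) {T : Fin 2 → E m}
    (hT : LinearIndependent ℝ T) : ∃ P : Matrix (Fin 2) (Fin 2) ℝ, 0 < P.det ∧
      gramA β (fun i => ∑ k, P i k • T k) = 1 := by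
  have h0 : 0 < β (T 0) (T 0) := hβ.pos _ (hT.ne_zero 0)
  set s := β (T 0) (T 1) / β (T 0) (T 0) with hs
  have hs' : s * β (T 0) (T 0) = β (T 0) (T 1) := div_mul_cancel₀ _ h0.ne'
  set n := T 1 - s • T 0 with hn
  have hn0 : n ≠ 0 := fun h => by
    have := Fintype.linearIndependent_iff.1 hT ![-s, 1] (by
      simp only [Fin.sum_univ_two, Matrix.cons_val_zero, Matrix.cons_val_one]
      rw [← h, hn]; module) 1
    simp at this
  have h1 : 0 < β n n := hβ.pos _ hn0
  have h2 : β (T 0) n = 0 := by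
    rw [hn, map_sub, map_smul, smul_eq_mul, hs', sub_self]
  have h3 : β n (T 0) = 0 := by rw [hβ.symm, h2]
  set a := (Real.sqrt (β (T 0) (T 0)))⁻¹ with ha
  set c := (Real.sqrt (β n n))⁻¹ with hc
  have ha2 : a * a * β (T 0) (T 0) = 1 := by
    rw [ha, ← mul_inv, Real.mul_self_sqrt h0.le, inv_mul_cancel₀ h0.ne']
  have hc2 : c * c * β n n = 1 := by
    rw [hc, ← mul_inv, Real.mul_self_sqrt h1.le, inv_mul_cancel₀ h1.ne']
  have ha0 : 0 < a := inv_pos.2 (Real.sqrt_pos.2 h0)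
  have hc0 : 0 < c := inv_pos.2 (Real.sqrt_pos.2 h1)
  refine ⟨!![a, 0; -c * s, c], by simp [Matrix.det_fin_two_of]; positivity, ?_⟩
  have e : (fun i => ∑ k, !![a, 0; -c * s, c] i k • T k) = ![a • T 0, c • n] := by
    funext i
    fin_cases i
    · simp
    · simp only [hn, Fin.sum_univ_two, Matrix.of_apply]
      simp
      module
  rw [e]
  ext i j
  fin_cases i <;> fin_cases j <;>
    simp [gramA, h2, h3, ← mul_assoc, ha2, hc2]

theorem alternating_sum (hθ : ∀ v, θ v v = 0) (P : Matrix (Fin 2) (Fin 2) ℝ) (T : Fin 2 → E m) :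
    θ (∑ k, P 0 k • T k) (∑ k, P 1 k • T k) = P.det * θ (T 0) (T 1) := by
  rw [Matrix.det_fin_two]
  simp only [Fin.sum_univ_two, map_add, map_smul, add_apply, smul_apply, smul_eq_mul, hθ,
    antisymm_of_alternating hθ (T 1) (T 0)]
  ring

theorem starA_basisChange {T : Fin 2 → E m} (hθ : ∀ v, θ v v = 0) {P : Matrix (Fin 2) (Fin 2) ℝ}
    (hP : 0 < P.det) : starA β (fun i => ∑ k, P i k • T k) θ = starA β T θ := by
  rw [starA, starA, det_gramA_basisChange (b := β) (T := T) (P := P) (fun _ => rfl),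
    alternating_sum hθ, Real.sqrt_mul (sq_nonneg _), Real.sqrt_sq hP.le,
    mul_div_mul_left _ _ hP.ne']

/-- For independent vectors, Gram-Schmidt reduces to an orthonormal pair, both sides scaling by the
square of the determinant; exchanging the two vectors gives the lower bound. For dependent vectors
both sides vanish. -/
theorem comassLE_of_orthonormal (hβ : IsInner β) (hθ : ∀ v, θ v v = 0)
    (h : ∀ u v, β u u = 1 → β v v = 1 → β u v = 0 → θ u v ≤ 1) : ComassLE β θ := by
  intro u v
  by_cases hli : LinearIndependent ℝ ![u, v]
  · obtain ⟨P, hP, hg⟩ := hβ.exists_orthonormal_pair hli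
    have hd := det_gramA_basisChange (b := β) (T := ![u, v]) (P := P)
      (T' := fun i => ∑ k, P i k • ![u, v] k) (fun _ => rfl)
    have hw := alternating_sum hθ P ![u, v]
    have e : ∀ i j, β (∑ k, P i k • ![u, v] k) (∑ k, P j k • ![u, v] k) =
        (1 : Matrix (Fin 2) (Fin 2) ℝ) i j := fun i j => congrFun (congrFun hg i) j
    have e00 := (e 0 0).trans (by simp : (1 : Matrix (Fin 2) (Fin 2) ℝ) 0 0 = 1)
    have e11 := (e 1 1).trans (by simp : (1 : Matrix (Fin 2) (Fin 2) ℝ) 1 1 = 1)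
    have e01 := (e 0 1).trans (by simp : (1 : Matrix (Fin 2) (Fin 2) ℝ) 0 1 = 0)
    have e10 := (e 1 0).trans (by simp : (1 : Matrix (Fin 2) (Fin 2) ℝ) 1 0 = 0)
    have h1 := h _ _ e00 e11 e01
    have h2 := h _ _ e11 e00 e10
    rw [antisymm_of_alternating hθ] at h2
    rw [hw] at h1 h2
    rw [hg, Matrix.det_one, Matrix.det_fin_two (gramA β ![u, v])] at hd
    simp only [gramA, Matrix.of_apply, Matrix.cons_val_zero, Matrix.cons_val_one,
      hβ.symm v u] at hd h1 h2
    have h3 : (P.det * θ u v) ^ 2 ≤ 1 := by nlinarith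
    have hP2 : 0 < P.det ^ 2 := by positivity
    by_contra hcon
    nlinarith [mul_lt_mul_of_pos_left (not_le.1 hcon) hP2]
  · rw [LinearIndependent.pair_iff] at hli
    push Not at hli
    obtain ⟨s, t, hst, hne⟩ := hli
    by_cases ht : t = 0
    · have hs : s ≠ 0 := fun h => hne h ht
      have hu : u = 0 := by
        rw [ht, zero_smul, add_zero] at hst
        exact (smul_eq_zero.1 hst).resolve_left hs
      simp [hu]
    · have hv : v = (-(s / t)) • u := by
        have : t • v = -(s • u) := by rw [eq_neg_iff_add_eq_zero, add_comm]; exact hst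
        calc v = t⁻¹ • (t • v) := by rw [smul_smul, inv_mul_cancel₀ ht, one_smul]
          _ = _ := by rw [this]; module
      rw [hv]
      simp only [map_smul, smul_apply, smul_eq_mul, hθ]
      nlinarith

theorem IsInner.linearIndependent_of_orthonormal {ι : Type*} [Fintype ι] [DecidableEq ι]
    {e : ι → E m} (he : ∀ i j, β (e i) (e j) = if i = j then 1 else 0) :
    LinearIndependent ℝ e := by
  rw [Fintype.linearIndependent_iff]
  intro c hc i
  have := congrArg (fun v => β (e i) v) hc
  simpa [he] using this

theorem IsInner.exists_unit_orthogonal (hβ : IsInner β) {k : ℕ} (hk : k < m) (e : Fin k → E m) :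
    ∃ x, β x x = 1 ∧ ∀ i, β (e i) x = 0 := by
  set L : E m →ₗ[ℝ] (Fin k → ℝ) := LinearMap.pi fun i => (β (e i) : E m →ₗ[ℝ] ℝ) with hL
  have hker : LinearMap.ker L ≠ ⊥ := by
    apply LinearMap.ker_ne_bot_of_finrank_lt
    simpa using hk
  obtain ⟨x, hx, hx0⟩ := (Submodule.ne_bot_iff _).1 hker
  have hp := hβ.pos x hx0
  have hx' : ∀ i, β (e i) x = 0 := fun i => congrFun (LinearMap.mem_ker.1 hx) i
  refine ⟨(Real.sqrt (β x x))⁻¹ • x, ?_, fun i => by simp [hx']⟩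
  simp only [map_smul, smul_apply, smul_eq_mul]
  rw [← mul_assoc, ← mul_inv, Real.mul_self_sqrt hp.le, inv_mul_cancel₀ hp.ne']

variable {β θ : E 4 →L[ℝ] E 4 →L[ℝ] ℝ}

theorem IsInner.exists_splitBasis (hβ : IsInner β) {u v : E 4} (hu : β u u = 1) (hv : β v v = 1)
    (huv : β u v = 0) : ∃ b : SplitBasis, IsOrthonormal b β ∧ b (Sum.inl 0) = u ∧
      b (Sum.inl 1) = v := by
  obtain ⟨x, hx, hxo⟩ := hβ.exists_unit_orthogonal (by norm_num) ![u, v]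
  obtain ⟨y, hy, hyo⟩ := hβ.exists_unit_orthogonal (by norm_num) ![u, v, x]
  have h1 : β u x = 0 := hxo 0
  have h2 : β v x = 0 := hxo 1
  have h3 : β u y = 0 := hyo 0
  have h4 : β v y = 0 := hyo 1
  have h5 : β x y = 0 := hyo 2
  set e : Fin 2 ⊕ Fin 2 → E 4 := Sum.elim ![u, v] ![x, y] with he
  have ho : ∀ c d, β (e c) (e d) = if c = d then 1 else 0 := by
    rintro (i | i) (j | j) <;> fin_cases i <;> fin_cases j <;>
      simp [he, hu, hv, hx, hy, huv, h1, h2, h3, h4, h5, hβ.symm v u, hβ.symm x u, hβ.symm x v,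
        hβ.symm y u, hβ.symm y v, hβ.symm y x]
  have hli := IsInner.linearIndependent_of_orthonormal ho
  refine ⟨basisOfLinearIndependentOfCardEqFinrank hli (by simp), ?_, ?_, ?_⟩
  · intro c d
    simp only [coe_basisOfLinearIndependentOfCardEqFinrank, ho]
  · simp [he]
  · simp [he]

end Frames

/-! ### Slopes of planes and uniqueness of the common calibrated plane. -/

section Slope

variable (b : SplitBasis)

/-- The horizontal parts of two vectors. -/
def horMatrix (T : Fin 2 → E 4) : Matrix (Fin 2) (Fin 2) ℝ :=
  Matrix.of fun i k => b.repr (T i) (Sum.inl k)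

/-- The vertical parts of two vectors. -/
def verMatrix (T : Fin 2 → E 4) : Matrix (Fin 2) (Fin 2) ℝ :=
  Matrix.of fun i a => b.repr (T i) (Sum.inr a)

/-- The jet of the plane spanned by `T` at `y`, for planes that are graphs. -/
def planeJet (y : E 4) (T : Fin 2 → E 4) : Jet :=
  (WithLp.toLp 2 fun i => b.repr y (Sum.inl i), fun a => b.repr y (Sum.inr a),
    fun i a => ((horMatrix b T)⁻¹ * verMatrix b T) i a)

variable {b}

theorem horMatrix_sum (P : Matrix (Fin 2) (Fin 2) ℝ) (T : Fin 2 → E 4) :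
    horMatrix b (fun i => ∑ k, P i k • T k) = P * horMatrix b T := by
  ext i j
  simp [horMatrix, Matrix.mul_apply]

theorem verMatrix_sum (P : Matrix (Fin 2) (Fin 2) ℝ) (T : Fin 2 → E 4) :
    verMatrix b (fun i => ∑ k, P i k • T k) = P * verMatrix b T := by
  ext i j
  simp [verMatrix, Matrix.mul_apply]

/-- The matrix P cancels in (PH)⁻¹(PV), so the slope depends only on the plane. -/
theorem planeJet_basisChange {P : Matrix (Fin 2) (Fin 2) ℝ} (hP : P.det ≠ 0) (y : E 4)
    (T : Fin 2 → E 4) : planeJet b y (fun i => ∑ k, P i k • T k) = planeJet b y T := by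
  have h : (horMatrix b (fun i => ∑ k, P i k • T k))⁻¹ * verMatrix b (fun i => ∑ k, P i k • T k) =
      (horMatrix b T)⁻¹ * verMatrix b T := by
    rw [horMatrix_sum, verMatrix_sum, Matrix.mul_inv_rev, Matrix.mul_assoc, ← Matrix.mul_assoc P⁻¹,
      Matrix.nonsing_inv_mul _ (isUnit_iff_ne_zero.2 hP), Matrix.one_mul]
  simp only [planeJet, h]

theorem planeJet_graphTan (y : E 4) (J : Jet) : (planeJet b y (graphTan b J)).2.2 = J.2.2 := by
  have h : horMatrix b (graphTan b J) = 1 := by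
    ext i k
    simp [horMatrix, repr_graphTan_inl, Matrix.one_apply]
  funext i a
  simp [planeJet, h, verMatrix, repr_graphTan_inr]

variable {β θ' θ'' : E 4 →L[ℝ] E 4 →L[ℝ] ℝ}

theorem eq_zero_of_sum_four_sq {p q r s : ℝ} (h : p ^ 2 + q ^ 2 + r ^ 2 + s ^ 2 = 0) :
    p = 0 ∧ q = 0 ∧ r = 0 ∧ s = 0 := by
  have hp := sq_nonneg p
  have hq := sq_nonneg q
  have hr := sq_nonneg r
  have hs := sq_nonneg s
  refine ⟨?_, ?_, ?_, ?_⟩ <;> apply pow_eq_zero_iff two_ne_zero |>.1 <;> linarith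

/-- The common calibrated plane of two forms determining opposite orientations is unique. -/
theorem planeJet_of_calibrated (hb : IsOrthonormal b β) (hβ : IsInner β)
    (h' : IsCalibratedBy b θ') (h'' : IsCalibratedBy b θ'')
    (hc : θ' (b (Sum.inr 0)) (b (Sum.inr 1)) * θ'' (b (Sum.inr 0)) (b (Sum.inr 1)) < 0)
    {T : Fin 2 → E 4} (hT : LinearIndependent ℝ T) (h1' : starA β T θ' = 1)
    (h1'' : starA β T θ'' = 1) (y : E 4) :
    (horMatrix b T).det ≠ 0 ∧ planeJet b y T = baseJet b y := by
  set x := b.repr (T 0) with hx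
  set z := b.repr (T 1) with hz
  have e0 : T 0 = x (Sum.inl 0) • b (Sum.inl 0) + x (Sum.inl 1) • b (Sum.inl 1) +
      (x (Sum.inr 0) • b (Sum.inr 0) + x (Sum.inr 1) • b (Sum.inr 1)) := by
    have := b.sum_repr (T 0)
    rw [Fintype.sum_sum_type, Fin.sum_univ_two, Fin.sum_univ_two] at this
    exact this.symm
  have e1 : T 1 = z (Sum.inl 0) • b (Sum.inl 0) + z (Sum.inl 1) • b (Sum.inl 1) +
      (z (Sum.inr 0) • b (Sum.inr 0) + z (Sum.inr 1) • b (Sum.inr 1)) := by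
    have := b.sum_repr (T 1)
    rw [Fintype.sum_sum_type, Fin.sum_univ_two, Fin.sum_univ_two] at this
    exact this.symm
  have hdet := hβ.det_gramA_pos hT
  set x0 := x (Sum.inl 0)
  set x1 := x (Sum.inl 1)
  set x2 := x (Sum.inr 0)
  set x3 := x (Sum.inr 1)
  set z0 := z (Sum.inl 0)
  set z1 := z (Sum.inl 1)
  set z2 := z (Sum.inr 0)
  set z3 := z (Sum.inr 1)
  have hw : ∀ {θ}, IsCalibratedBy b θ → θ (T 0) (T 1) = (x0 * z1 - x1 * z0) +
      θ (b (Sum.inr 0)) (b (Sum.inr 1)) * (x2 * z3 - x3 * z2) := fun {θ} h => by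
    have e1' : ∀ i a, θ (b (Sum.inr a)) (b (Sum.inl i)) = 0 := fun i a => by
      rw [antisymm_of_alternating h.alt, h.cross, neg_zero]
    rw [e0, e1]
    simp only [map_add, map_smul, add_apply, smul_apply, smul_eq_mul,
      h.one, h.cross, e1', h.alt, antisymm_of_alternating h.alt (b (Sum.inr 1)) (b (Sum.inr 0)),
      antisymm_of_alternating h.alt (b (Sum.inl 1)) (b (Sum.inl 0))]
    ring
  have hg : (gramA β T).det = (x0 * z1 - x1 * z0) ^ 2 + (x0 * z2 - x2 * z0) ^ 2 +
      (x0 * z3 - x3 * z0) ^ 2 + (x1 * z2 - x2 * z1) ^ 2 + (x1 * z3 - x3 * z1) ^ 2 +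
      (x2 * z3 - x3 * z2) ^ 2 := by
    rw [Matrix.det_fin_two]
    simp only [gramA, Matrix.of_apply]
    rw [e0, e1]
    simp only [map_add, map_smul, add_apply, smul_apply, smul_eq_mul, hb _ _]
    simp
    ring
  have hN := Real.sqrt_pos.2 hdet
  rw [starA, div_eq_one_iff_eq hN.ne'] at h1' h1''
  rw [hw h'] at h1'
  rw [hw h''] at h1''
  have hne : θ' (b (Sum.inr 0)) (b (Sum.inr 1)) ≠ θ'' (b (Sum.inr 0)) (b (Sum.inr 1)) := fun h => by
    rw [h] at hc
    nlinarith [mul_self_nonneg (θ'' (b (Sum.inr 0)) (b (Sum.inr 1)))]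
  -- Subtracting the two calibration equations leaves (λ' - λ'') times the Plücker coordinate of the
  -- vertical plane, and λ' ≠ λ'' since their signs are opposite.
  have h23 : x2 * z3 - x3 * z2 = 0 := by
    have : (θ' (b (Sum.inr 0)) (b (Sum.inr 1)) - θ'' (b (Sum.inr 0)) (b (Sum.inr 1))) *
        (x2 * z3 - x3 * z2) = 0 := by linarith
    exact (mul_eq_zero.1 this).resolve_left (sub_ne_zero.2 hne)
  rw [h23, mul_zero, add_zero] at h1'
  have hsq : (x0 * z1 - x1 * z0) ^ 2 = (gramA β T).det := by rw [h1', Real.sq_sqrt hdet.le]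
  -- In an orthonormal basis the Gram determinant is the sum of the squares of the six Plücker
  -- coordinates. The horizontal one already exhausts it, so the mixed ones vanish.
  have hsum : (x0 * z2 - x2 * z0) ^ 2 + (x0 * z3 - x3 * z0) ^ 2 + (x1 * z2 - x2 * z1) ^ 2 +
      (x1 * z3 - x3 * z1) ^ 2 = 0 := by
    rw [hg, h23] at hsq; linarith
  obtain ⟨k02, k03, k12, k13⟩ := eq_zero_of_sum_four_sq hsum
  have hhor : (horMatrix b T).det = x0 * z1 - x1 * z0 := by
    rw [Matrix.det_fin_two]; rfl
  refine ⟨by rw [hhor, h1']; exact hN.ne', ?_⟩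
  have hslope : (horMatrix b T)⁻¹ * verMatrix b T = 0 := by
    have hH : horMatrix b T = !![x0, x1; z0, z1] := by
      ext i j; fin_cases i <;> fin_cases j <;> rfl
    have hV : verMatrix b T = !![x2, x3; z2, z3] := by
      ext i j; fin_cases i <;> fin_cases j <;> rfl
    rw [Matrix.inv_def, hH, hV, Matrix.smul_mul, Matrix.adjugate_fin_two_of]
    have : !![z1, -x1; -z0, x0] * !![x2, x3; z2, z3] = (0 : Matrix (Fin 2) (Fin 2) ℝ) := by
      ext i j
      fin_cases i <;> fin_cases j <;> simp [Matrix.mul_apply] <;> linarith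
    rw [this, smul_zero]
  simp only [planeJet, hslope, baseJet]
  rfl

end Slope

end SurfaceMCF

end

noncomputable section

namespace SurfaceMCF

/-! ### Planes close to a calibrated plane -/

section NearPlanes

/-- The Euclidean inner product. -/
def euclL (m : ℕ) : E m →L[ℝ] E m →L[ℝ] ℝ := innerSL ℝ

theorem euclL_apply {m : ℕ} (v w : E m) : euclL m v w = inner ℝ v w := rfl

theorem isInner_euclL (m : ℕ) : IsInner (euclL m) where
  symm v w := by rw [euclL_apply, euclL_apply, real_inner_comm]
  pos v hv := by rw [euclL_apply]; exact real_inner_self_pos.2 hv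

theorem linearIndependent_of_gramA_eq_one {m : ℕ} {T : Fin 2 → E m}
    (hT : gramA (euclL _) T = 1) : LinearIndependent ℝ T :=
  IsInner.linearIndependent_of_orthonormal (β := euclL _) fun i j => by
    have := congrFun (congrFun hT i) j
    simpa [gramA, Matrix.one_apply] using this

theorem isCompact_orthonormalPairs (m : ℕ) :
    IsCompact {T : Fin 2 → E m | gramA (euclL _) T = 1} := by
  refine Metric.isCompact_of_isClosed_isBounded ?_ ?_
  · refine isClosed_eq ?_ continuous_const
    refine continuous_matrix fun i j => ?_
    simp only [gramA, Matrix.of_apply, euclL_apply]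
    fun_prop
  · refine (Metric.isBounded_iff_subset_closedBall 0).2 ⟨1, fun T hT => ?_⟩
    rw [mem_closedBall_zero_iff, pi_norm_le_iff_of_nonneg zero_le_one]
    intro i
    have h1 := congrFun (congrFun (show gramA (euclL _) T = 1 from hT) i) i
    simp only [gramA, Matrix.of_apply, euclL_apply, Matrix.one_apply_eq,
      real_inner_self_eq_norm_sq] at h1
    nlinarith [norm_nonneg (T i)]

variable {G W W' W'' : E 4 → E 4 →L[ℝ] E 4 →L[ℝ] ℝ} {Ω : Set (E 4)} {y₀ : E 4}

theorem continuousOn_apply_apply {X : Type*} [TopologicalSpace X] {s : Set X}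
    {β : X → E 4 →L[ℝ] E 4 →L[ℝ] ℝ} {v w : X → E 4} (hβ : ContinuousOn β s)
    (hv : ContinuousOn v s) (hw : ContinuousOn w s) :
    ContinuousOn (fun x => β x (v x) (w x)) s :=
  (hβ.clm_apply hv).clm_apply hw

theorem continuousOn_starA (hG : ContinuousOn G Ω) (hi : ∀ y ∈ Ω, IsInner (G y))
    (hW : ContinuousOn W Ω) :
    ContinuousOn (fun x : E 4 × (Fin 2 → E 4) => starA (G x.1) x.2 (W x.1))
      {x | x.1 ∈ Ω ∧ LinearIndependent ℝ x.2} := by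
  have hT : ∀ i, Continuous fun x : E 4 × (Fin 2 → E 4) => x.2 i := fun i => by fun_prop
  have hGc : ContinuousOn (fun x : E 4 × (Fin 2 → E 4) => G x.1)
      {x | x.1 ∈ Ω ∧ LinearIndependent ℝ x.2} :=
    hG.comp continuous_fst.continuousOn fun _ h => h.1
  have hWc : ContinuousOn (fun x : E 4 × (Fin 2 → E 4) => W x.1)
      {x | x.1 ∈ Ω ∧ LinearIndependent ℝ x.2} :=
    hW.comp continuous_fst.continuousOn fun _ h => h.1
  simp only [starA]
  refine ContinuousOn.div (continuousOn_apply_apply hWc (hT 0).continuousOn (hT 1).continuousOn)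
    (ContinuousOn.sqrt ?_) fun x hx => (Real.sqrt_pos.2 ((hi _ hx.1).det_gramA_pos hx.2)).ne'
  simp only [Matrix.det_fin_two, gramA, Matrix.of_apply]
  have h : ∀ i j, ContinuousOn (fun x : E 4 × (Fin 2 → E 4) => G x.1 (x.2 i) (x.2 j))
      {x | x.1 ∈ Ω ∧ LinearIndependent ℝ x.2} := fun i j =>
    continuousOn_apply_apply hGc (hT i).continuousOn (hT j).continuousOn
  exact ((h 0 0).mul (h 1 1)).sub ((h 0 1).mul (h 1 0))

/-- A neighbourhood of the common calibrated planes at `y₀` contains all nearly calibrated planes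
at points near `y₀`. -/
theorem exists_nearly_calibrated_mem (hΩ : IsOpen Ω) (hG : ContinuousOn G Ω)
    (hi : ∀ y ∈ Ω, IsInner (G y)) (hy : y₀ ∈ Ω) (hW' : ContinuousOn W' Ω) (hW'' : ContinuousOn W'' Ω)
    (hm' : ∀ y ∈ Ω, ComassLE (G y) (W' y)) (hm'' : ∀ y ∈ Ω, ComassLE (G y) (W'' y))
    {N : Set (E 4 × (Fin 2 → E 4))} (hN : IsOpen N)
    (hcal : ∀ T, LinearIndependent ℝ T → starA (G y₀) T (W' y₀) = 1 →
      starA (G y₀) T (W'' y₀) = 1 → (y₀, T) ∈ N) :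
    ∃ m > 0, ∀ y T, dist y y₀ < m → gramA (euclL _) T = 1 → 1 - m < starA (G y) T (W' y) →
      1 - m < starA (G y) T (W'' y) → (y, T) ∈ N := by
  obtain ⟨r, hr, hball⟩ := Metric.nhds_basis_closedBall.mem_iff.1 (hΩ.mem_nhds hy)
  -- Planes are represented by pairs orthonormal for the fixed Euclidean product, so that the
  -- compact fibre does not vary with the base point.
  set C : Set (E 4 × (Fin 2 → E 4)) :=
    Metric.closedBall y₀ r ×ˢ {T | gramA (euclL _) T = 1} with hC
  have hCc : IsCompact C := (isCompact_closedBall _ _).prod (isCompact_orthonormalPairs 4)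
  have hZc : IsCompact (C \ N) := hCc.diff hN
  have hsub : C ⊆ {x | x.1 ∈ Ω ∧ LinearIndependent ℝ x.2} := fun x hx =>
    ⟨hball hx.1, linearIndependent_of_gramA_eq_one hx.2⟩
  rcases (C \ N).eq_empty_or_nonempty with he | hne
  · refine ⟨r, hr, fun y T hyr hT _ _ => ?_⟩
    by_contra hcon
    have : (y, T) ∈ C \ N := ⟨⟨Metric.mem_closedBall.2 hyr.le, hT⟩, hcon⟩
    rw [he] at this
    exact this
  -- This function is positive unless the base point is y₀ and the plane is calibrated by both
  -- forms. Its minimum over the compact set outside N is the margin m.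
  set φ : E 4 × (Fin 2 → E 4) → ℝ := fun x => max (dist x.1 y₀)
    (max (1 - starA (G x.1) x.2 (W' x.1)) (1 - starA (G x.1) x.2 (W'' x.1))) with hφ
  have hφc : ContinuousOn φ (C \ N) := by
    have h1 := (continuousOn_starA hG hi hW').mono (Set.sdiff_subset.trans hsub : C \ N ⊆ _)
    have h2 := (continuousOn_starA hG hi hW'').mono (Set.sdiff_subset.trans hsub : C \ N ⊆ _)
    have h0 : ContinuousOn (fun x : E 4 × (Fin 2 → E 4) => dist x.1 y₀) (C \ N) := by fun_prop
    exact ContinuousOn.sup h0 (ContinuousOn.sup (continuousOn_const.sub h1) (continuousOn_const.sub h2))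
  obtain ⟨x₁, hx₁, hmin⟩ := hZc.exists_isMinOn hne hφc
  have hpos : 0 < φ x₁ := by
    by_contra hcon
    have h1 := max_le_iff.1 (not_lt.1 hcon)
    have h2 := max_le_iff.1 h1.2
    have hx0 : x₁.1 = y₀ := dist_le_zero.1 h1.1
    have hli := (hsub hx₁.1).2
    have a' := le_abs_self _ |>.trans ((hm' _ hy).abs_starA_le (hi _ hy) hli)
    have a'' := le_abs_self _ |>.trans ((hm'' _ hy).abs_starA_le (hi _ hy) hli)
    rw [hx0] at h2
    have := hcal x₁.2 hli (by linarith [h2.1]) (by linarith [h2.2])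
    rw [← hx0] at this
    exact hx₁.2 this
  refine ⟨min r (φ x₁), lt_min hr hpos, fun y T hyr hT g' g'' => ?_⟩
  by_contra hcon
  have hmem : (y, T) ∈ C \ N :=
    ⟨⟨Metric.mem_closedBall.2 (hyr.le.trans (min_le_left _ _)), hT⟩, hcon⟩
  have h1 : φ x₁ ≤ φ (y, T) := hmin hmem
  have h2 : φ (y, T) < φ x₁ := by
    have := min_le_right r (φ x₁)
    exact max_lt (by linarith) (max_lt (by linarith) (by linarith))
  linarith

theorem continuousOn_planeJet (b : SplitBasis) :
    ContinuousOn (fun x : E 4 × (Fin 2 → E 4) => planeJet b x.1 x.2)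
      {x | (horMatrix b x.2).det ≠ 0} := by
  have hc : ∀ c, Continuous fun v : E 4 => b.repr v c := fun c =>
    (LinearMap.toContinuousLinearMap (b.coord c)).continuous
  have hH : Continuous fun x : E 4 × (Fin 2 → E 4) => horMatrix b x.2 :=
    continuous_matrix fun i k => (hc _).comp (by fun_prop)
  have hV : Continuous fun x : E 4 × (Fin 2 → E 4) => verMatrix b x.2 :=
    continuous_matrix fun i k => (hc _).comp (by fun_prop)
  have hI : ContinuousOn (fun x : E 4 × (Fin 2 → E 4) => (horMatrix b x.2)⁻¹ * verMatrix b x.2)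
      {x | (horMatrix b x.2).det ≠ 0} := by
    simp only [Matrix.inv_def, Ring.inverse_eq_inv']
    exact ((hH.matrix_det.continuousOn.inv₀ fun x hx => hx).smul
      hH.matrix_adjugate.continuousOn).mul hV.continuousOn
  refine ContinuousOn.prodMk ?_ (ContinuousOn.prodMk ?_ ?_)
  · refine Continuous.continuousOn ?_
    exact (PiLp.continuous_toLp 2 _).comp (continuous_pi fun i => (hc _).comp continuous_fst)
  · exact (continuous_pi fun a => (hc _).comp continuous_fst).continuousOn
  · exact continuousOn_pi.2 fun i => continuousOn_pi.2 fun a =>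
      (continuous_apply_apply i a).comp_continuousOn hI

theorem isOpen_planeJet_ball (b : SplitBasis) (J : Jet) (r : ℝ) :
    IsOpen {x : E 4 × (Fin 2 → E 4) | (horMatrix b x.2).det ≠ 0 ∧
      planeJet b x.1 x.2 ∈ Metric.ball J r} := by
  have hc : ∀ c, Continuous fun v : E 4 => b.repr v c := fun c =>
    (LinearMap.toContinuousLinearMap (b.coord c)).continuous
  have hH : Continuous fun x : E 4 × (Fin 2 → E 4) => horMatrix b x.2 :=
    continuous_matrix fun i k => (hc _).comp (by fun_prop)
  have ho : IsOpen {x : E 4 × (Fin 2 → E 4) | (horMatrix b x.2).det ≠ 0} :=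
    isOpen_ne_fun hH.matrix_det continuous_const
  exact (continuousOn_planeJet b).isOpen_inter_preimage ho Metric.isOpen_ball

end NearPlanes

end SurfaceMCF

end

noncomputable section

namespace SurfaceMCF

/-! ### Writing a flow as a moving graph -/

section GraphConversion

variable (b : SplitBasis)

/-- The horizontal coordinates of a point. -/
def horL : E 4 →L[ℝ] E 2 :=
  LinearMap.toContinuousLinearMap
    ((WithLp.linearEquiv 2 ℝ (Fin 2 → ℝ)).symm.toLinearMap ∘ₗ
      LinearMap.pi fun i => b.coord (Sum.inl i))

/-- The vertical coordinates of a point. -/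
def verL (a : Fin 2) : E 4 →L[ℝ] ℝ := LinearMap.toContinuousLinearMap (b.coord (Sum.inr a))

variable {b}

theorem horL_apply (v : E 4) (i : Fin 2) : horL b v i = b.repr v (Sum.inl i) := rfl

theorem verL_apply (v : E 4) (a : Fin 2) : verL b a v = b.repr v (Sum.inr a) := rfl

variable {U : Set SpaceTime} {f : SpaceTime → E 4}

theorem fderiv_spaceTime (f : SpaceTime → E 4) (z v : SpaceTime) :
    fderiv ℝ f z v = v.1 • pder vt f z + ∑ k, v.2 k • pder (vs k) f z := by
  have : v = v.1 • vt + ∑ k, v.2 k • vs k := by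
    refine Prod.ext ?_ ?_
    · simp [vt, vs]
    · simp only [vt, vs, Prod.snd_add, Prod.smul_mk, smul_zero, Prod.snd_sum, zero_add]
      exact (sum_apply_dir v.2).symm
  conv_lhs => rw [this]
  simp only [map_add, map_smul, map_sum, pder]

/-- Local inversion of the horizontal part of a moving surface. -/
theorem exists_horizontal_inverse (hU : IsOpen U) (hf : ContDiffOn ℝ ∞ f U) {z₀ : SpaceTime}
    (hz₀ : z₀ ∈ U) (hdet : (horMatrix b fun i => pder (vs i) f z₀).det ≠ 0) :
    ∃ (O : Set SpaceTime) (ψ : SpaceTime → E 2), IsOpen O ∧ ContDiffOn ℝ ∞ ψ O ∧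
      (∀ w ∈ O, (w.1, ψ w) ∈ U ∧ horL b (f (w.1, ψ w)) = w.2) ∧
      (z₀.1, horL b (f z₀)) ∈ O ∧ ψ (z₀.1, horL b (f z₀)) = z₀.2 := by
  have hdc : ContinuousOn (fun z => (horMatrix b fun i => pder (vs i) f z).det) U := by
    refine (contDiffOn_det fun i j => ?_).continuousOn
    exact (LinearMap.toContinuousLinearMap (b.coord (Sum.inl j))).contDiff.comp_contDiffOn
      (contDiffOn_pder hf hU (vs i))
  set U' : Set SpaceTime := U ∩ (fun z => (horMatrix b fun i => pder (vs i) f z).det) ⁻¹' {0}ᶜ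
    with hU'
  have hU'o : IsOpen U' := hdc.isOpen_inter_preimage hU isOpen_compl_singleton
  -- The time coordinate is kept, so the inverse has the form (t, y) ↦ (t, ψ(t, y)) and time slices
  -- correspond.
  set Φ : SpaceTime → SpaceTime := fun z => (z.1, horL b (f z)) with hΦ
  have hΦs : ContDiffOn ℝ ∞ Φ U :=
    contDiff_fst.contDiffOn.prodMk ((horL b).contDiff.comp_contDiffOn hf)
  have hequiv : ∀ z ∈ U', ∃ L : SpaceTime ≃L[ℝ] SpaceTime,
      HasFDerivAt Φ (L : SpaceTime →L[ℝ] SpaceTime) z := by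
    intro z hz
    have hfz : DifferentiableAt ℝ f z :=
      (hf.contDiffAt (hU.mem_nhds hz.1)).differentiableAt (by simp)
    have hd : HasFDerivAt Φ ((ContinuousLinearMap.fst ℝ ℝ (E 2)).prod
        ((horL b).comp (fderiv ℝ f z))) z :=
      hasFDerivAt_fst.prodMk ((horL b).hasFDerivAt.comp z hfz.hasFDerivAt)
    set D : SpaceTime →L[ℝ] SpaceTime := (ContinuousLinearMap.fst ℝ ℝ (E 2)).prod
        ((horL b).comp (fderiv ℝ f z)) with hD
    have hinj : Function.Injective (D : SpaceTime →ₗ[ℝ] SpaceTime) := by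
      rw [← LinearMap.ker_eq_bot, LinearMap.ker_eq_bot']
      intro v hv
      have h1 : v.1 = 0 := congrArg Prod.fst hv
      have h2 : horL b (fderiv ℝ f z v) = 0 := congrArg Prod.snd hv
      rw [fderiv_spaceTime, h1, zero_smul, zero_add] at h2
      have h3 : Matrix.vecMul (fun k => v.2 k) (horMatrix b fun i => pder (vs i) f z) = 0 := by
        funext j
        have := congrArg (fun x : E 2 => x j) h2
        simp only [horL_apply] at this
        simpa [Matrix.vecMul, dotProduct, horMatrix] using this
      have h4 := Matrix.eq_zero_of_vecMul_eq_zero hz.2 h3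
      refine Prod.ext h1 ?_
      ext k
      exact congrFun h4 k
    set L := (LinearEquiv.ofInjectiveEndo (D : SpaceTime →ₗ[ℝ] SpaceTime) hinj).toContinuousLinearEquiv
    have hL : (L : SpaceTime →L[ℝ] SpaceTime) = D :=
      ContinuousLinearMap.ext fun v => rfl
    exact ⟨L, by rw [hL]; exact hd⟩
  have hz₀' : z₀ ∈ U' := ⟨hz₀, hdet⟩
  obtain ⟨L₀, hL₀⟩ := hequiv z₀ hz₀'
  have hstrict : HasStrictFDerivAt Φ (L₀ : SpaceTime →L[ℝ] SpaceTime) z₀ := by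
    refine ContDiffAt.hasStrictFDerivAt' (hΦs.contDiffAt (hU.mem_nhds hz₀)) hL₀ (by simp)
  -- Restriction to `U'` keeps the derivative invertible at every point, which makes the inverse
  -- smooth on its whole domain.
  set e := (hstrict.toOpenPartialHomeomorph Φ).restrOpen U' hU'o with he
  have hez : ∀ z, e z = Φ z := fun z => rfl
  have hsrc : e.source = (hstrict.toOpenPartialHomeomorph Φ).source ∩ U' := rfl
  have hz₀e : z₀ ∈ e.source := ⟨hstrict.mem_toOpenPartialHomeomorph_source, hz₀'⟩
  have hsymm : ∀ w ∈ e.target, Φ (e.symm w) = w := fun w hw => e.right_inv hw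
  have hfst : ∀ w ∈ e.target, (w.1, (e.symm w).2) = e.symm w := fun w hw =>
    Prod.ext (congrArg Prod.fst (hsymm w hw)).symm rfl
  refine ⟨e.target, fun w => (e.symm w).2, e.open_target, fun w hw => ?_, fun w hw => ?_,
    e.map_source hz₀e, ?_⟩
  · have hmem : e.symm w ∈ U' := (e.map_target hw).2
    obtain ⟨L, hL⟩ := hequiv _ hmem
    have := e.contDiffAt_symm (n := ∞) hw hL (hΦs.contDiffAt (hU.mem_nhds hmem.1))
    exact (contDiffAt_snd.comp w this).contDiffWithinAt
  · simp only [hfst w hw]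
    exact ⟨(e.map_target hw).2.1, congrArg Prod.snd (hsymm w hw)⟩
  · have : e.symm (z₀.1, horL b (f z₀)) = z₀ := e.left_inv hz₀e
    simp only [this]

variable {G : E 4 → E 4 →L[ℝ] E 4 →L[ℝ] ℝ} {Ω : Set (E 4)} (hΩ : IsOpen Ω)
  (hG : ContDiffOn ℝ ∞ G Ω) (hi : ∀ y ∈ Ω, IsInner (G y)) (hs : ∀ y v w, G y v w = G y w v)

/-- A mean curvature flow in coordinates is locally a solution of the graph system. -/
theorem exists_graph_solution (hU : IsOpen U) (hf : ContDiffOn ℝ ∞ f U) (hfΩ : ∀ z ∈ U, f z ∈ Ω)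
    (himm : ∀ z ∈ U, LinearIndependent ℝ fun i => pder (vs i) f z)
    (hflow : ∀ z ∈ U, pder vt f z = meanCurv (unb G) (fun x => f (z.1, x)) z.2)
    {z₀ : SpaceTime} (hz₀ : z₀ ∈ U) (hdet : (horMatrix b fun i => pder (vs i) f z₀).det ≠ 0) :
    ∃ (O : Set SpaceTime) (u : Fin 2 → SpaceTime → ℝ) (z₁ : SpaceTime) (χ : SpaceTime → SpaceTime),
      (graphSystem b G Ω hΩ hG hi hs).IsSolution O u ∧ z₁ ∈ O ∧ χ z₁ = z₀ ∧ z₁.1 = z₀.1 ∧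
      jet u z₁ = planeJet b (f z₀) (fun i => pder (vs i) f z₀) ∧
      ∀ w ∈ O, χ w ∈ U ∧ (χ w).1 = w.1 ∧
        (graphSystem b G Ω hΩ hG hi hs).Q u w =
          sffNormSq (unb G) (fun x => f ((χ w).1, x)) (χ w).2 ∧
        ∀ W : E 4 → E 4 →L[ℝ] E 4 →L[ℝ] ℝ, (∀ y v, W y v v = 0) →
          |graphStar b G W (jet u w)| =
            |starPullback (unb G) (fun x => f ((χ w).1, x)) (unb W) (χ w).2| := by
  obtain ⟨O, ψ, hO, hψ, hψU, hz₁, hψz⟩ := exists_horizontal_inverse hU hf hz₀ hdet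
  set u : Fin 2 → SpaceTime → ℝ := fun a w => verL b a (f (w.1, ψ w)) with hu
  have hχs : ContDiffOn ℝ ∞ (fun w : SpaceTime => ((w.1, ψ w) : SpaceTime)) O :=
    contDiff_fst.contDiffOn.prodMk hψ
  have hfχ : ContDiffOn ℝ ∞ (fun w : SpaceTime => f (w.1, ψ w)) O :=
    hf.comp hχs fun w hw => (hψU w hw).1
  have hus : ∀ a, ContDiffOn ℝ ∞ (u a) O := fun a => (verL b a).contDiff.comp_contDiffOn hfχ
  have hgraph : ∀ w ∈ O, graphPt b (jet u w) = f (w.1, ψ w) := fun w hw => by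
    have h := b.sum_repr (f (w.1, ψ w))
    rw [Fintype.sum_sum_type] at h
    conv_rhs => rw [← h]
    have h2 : ∀ i, w.2 i = b.repr (f (w.1, ψ w)) (Sum.inl i) := fun i => by
      rw [← horL_apply, (hψU w hw).2]
    simp only [graphPt, jet, h2, hu, verL_apply]
  have hslice : ∀ w ∈ O, ∀ᶠ x in nhds w.2, (w.1, x) ∈ O := fun w hw =>
    (Continuous.continuousAt (by fun_prop : Continuous fun x : E 2 =>
      ((w.1, x) : SpaceTime))).eventually (hO.mem_nhds hw)
  have hev : ∀ w ∈ O, graphMap b u w.1 =ᶠ[nhds w.2] fun x => f (w.1, ψ (w.1, x)) := fun w hw => by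
    filter_upwards [hslice w hw] with x hx
    exact hgraph _ hx
  have hf2 : ∀ w ∈ O, ContDiffAt ℝ 2 (fun x => f (w.1, x)) (ψ (w.1, w.2)) := fun w hw => by
    have h1 : ContDiffAt ℝ 2 f (w.1, ψ w) := contDiffAt_two_of_contDiffOn hf hU (hψU w hw).1
    exact ContDiffAt.comp (g := f) (ψ w) h1 (by fun_prop)
  have hψ2 : ∀ w ∈ O, ContDiffAt ℝ 2 (fun x => ψ (w.1, x)) w.2 := fun w hw => by
    have h1 : ContDiffAt ℝ 2 ψ (w.1, w.2) := contDiffAt_two_of_contDiffOn hψ hO hw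
    exact ContDiffAt.comp (g := ψ) w.2 h1 (by fun_prop)
  have hpdf : ∀ w ∈ O, pd (fun x => f (w.1, x)) (ψ w) = fun i => pder (vs i) f (w.1, ψ w) :=
    fun w hw => funext fun i => pder_slice
      ((hf.contDiffAt (hU.mem_nhds (hψU w hw).1)).differentiableAt (by simp)) i
  have hchange : ∀ w ∈ O, ∀ i, graphTan b (jet u w) i =
      ∑ k, jacobian (fun x => ψ (w.1, x)) w.2 i k • pder (vs k) f (w.1, ψ w) := fun w hw i => by
    rw [← pd_graphMap (t := w.1) (w := w.2) hO hus hw i, pd_congr (hev w hw),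
      pd_domainChange (differentiableAt_of_contDiffAt_two (hf2 w hw))
        (differentiableAt_of_contDiffAt_two (hψ2 w hw))]
    have := hpdf w hw
    simp only [Prod.mk.eta, this]
  have hjac : ∀ w ∈ O, (jacobian (fun x => ψ (w.1, x)) w.2).det ≠ 0 := fun w hw h0 => by
    have h1 : horMatrix b (graphTan b (jet u w)) = 1 := by
      ext i k
      simp [horMatrix, repr_graphTan_inl, Matrix.one_apply]
    rw [funext (hchange w hw), horMatrix_sum] at h1
    have h2 := congrArg Matrix.det h1
    rw [Matrix.det_mul, h0, zero_mul, Matrix.det_one] at h2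
    exact zero_ne_one h2
  -- The derivatives of f span the tangent plane of the graph, because the Jacobian of ψ is
  -- invertible, so their vertical parts vanish.
  have hvert : ∀ w ∈ O, ∀ k, vertL b (jet u w) (pder (vs k) f (w.1, ψ w)) = 0 := fun w hw k => by
    funext a
    have h1 : (jacobian (fun x => ψ (w.1, x)) w.2).mulVec
        (fun k => vertL b (jet u w) (pder (vs k) f (w.1, ψ w)) a) = 0 := by
      funext i
      have := congrFun (congrArg (vertL b (jet u w)) (hchange w hw i)) a
      rw [vert_graphTan, map_sum] at this
      simpa [Matrix.mulVec, dotProduct] using this.symm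
    exact congrFun (Matrix.eq_zero_of_mulVec_eq_zero (hjac w hw) h1) k
  have hGd : ∀ z ∈ U, DifferentiableAt ℝ G (f z) := fun z hz =>
    (hG.contDiffAt (hΩ.mem_nhds (hfΩ z hz))).differentiableAt (by simp)
  have hgram : ∀ w ∈ O, (gramA (G (f (w.1, ψ w))) (pd (fun x => f (w.1, x)) (ψ w))).det ≠ 0 :=
    fun w hw => by
      rw [hpdf w hw]
      exact ((hi _ (hfΩ _ (hψU w hw).1)).det_gramA_pos (himm _ (hψU w hw).1)).ne'
  refine ⟨O, u, (z₀.1, horL b (f z₀)), fun w => (w.1, ψ w), ⟨hO, hus, fun w hw => ?_, ?_⟩, hz₁,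
    Prod.ext rfl hψz, rfl, ?_, fun w hw => ⟨(hψU w hw).1, rfl, ?_, fun W hW => ?_⟩⟩
  · change graphPt b (jet u w) ∈ Ω
    rw [hgraph w hw]
    exact hfΩ _ (hψU w hw).1
  · intro w hw a
    have hd : DifferentiableAt ℝ (fun w : SpaceTime => f (w.1, ψ w)) w :=
      (hfχ.contDiffAt (hO.mem_nhds hw)).differentiableAt (by simp)
    have hψd : DifferentiableAt ℝ ψ w := (hψ.contDiffAt (hO.mem_nhds hw)).differentiableAt (by simp)
    have h1 : pder vt (u a) w = verL b a (pder vt (fun w : SpaceTime => f (w.1, ψ w)) w) := by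
      rw [hu]
      exact (pder_comp (g := verL b a) (verL b a).differentiableAt hd vt).trans (by
        rw [(verL b a).fderiv])
    -- At a fixed horizontal position the point of the graph moves only vertically.
    have h2 : horL b (pder vt (fun w : SpaceTime => f (w.1, ψ w)) w) = 0 := by
      have e1 : pder vt (fun w : SpaceTime => horL b (f (w.1, ψ w))) w =
          horL b (pder vt (fun w : SpaceTime => f (w.1, ψ w)) w) :=
        (pder_comp (g := horL b) (horL b).differentiableAt hd vt).trans (by rw [(horL b).fderiv])
      have e2 := pder_congr_of_eqOn hO (f := fun w : SpaceTime => horL b (f (w.1, ψ w)))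
        (g := fun w : SpaceTime => w.2) (fun w hw => (hψU w hw).2) vt hw
      rw [← e1, e2, pder, fderiv_snd]
      rfl
    have h3 : pder vt (u a) w =
        vertL b (jet u w) (pder vt (fun w : SpaceTime => f (w.1, ψ w)) w) a := by
      rw [h1, verL_apply, vertL_apply, vert]
      have : ∀ k, b.repr (pder vt (fun w : SpaceTime => f (w.1, ψ w)) w) (Sum.inl k) = 0 := fun k => by
        rw [← horL_apply, h2]; rfl
      simp [this]
    -- The moving parametrisation adds a tangential velocity to the mean curvature vector. Taking
    -- vertical parts removes it, which leaves the graph system.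
    have h4 : pder vt (fun w : SpaceTime => f (w.1, ψ w)) w = pder vt f (w.1, ψ w) +
        ∑ k, (pder vt ψ w) k • pder (vs k) f (w.1, ψ w) := by
      have hc : DifferentiableAt ℝ (fun w : SpaceTime => ((w.1, ψ w) : SpaceTime)) w :=
        differentiableAt_fst.prodMk hψd
      rw [pder_comp (g := f) (f := fun w : SpaceTime => ((w.1, ψ w) : SpaceTime)) ((hf.contDiffAt (hU.mem_nhds (hψU w hw).1)).differentiableAt
        (by simp)) hc, fderiv_spaceTime]
      have e : pder vt (fun w : SpaceTime => ((w.1, ψ w) : SpaceTime)) w = (1, pder vt ψ w) := by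
        have := (hasFDerivAt_fst (𝕜 := ℝ) (p := w)).prodMk hψd.hasFDerivAt
        rw [pder, this.fderiv]
        rfl
      rw [e, one_smul]
    rw [h3, h4, map_add, map_sum]
    simp only [map_smul, hvert w hw, smul_zero, Finset.sum_const_zero, add_zero]
    rw [hflow _ (hψU w hw).1, ← vert_meanCurv_graphMap (t := w.1) (w := w.2) hO hus hw hΩ hG hi hs a,
      meanCurv_congr (hev w hw)]
    rw [meanCurv_domainChange (f := fun x => f (w.1, x)) (φ := fun x => ψ (w.1, x)) (hf2 w hw)
      (hψ2 w hw) (hGd _ (hψU w hw).1) (hi _ (hfΩ _ (hψU w hw).1)) (hgram w hw) (hjac w hw)]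
  · have h1 := planeJet_graphTan (b := b) (f z₀) (jet u (z₀.1, horL b (f z₀)))
    have hz : ((z₀.1, ψ (z₀.1, horL b (f z₀))) : SpaceTime) = z₀ := Prod.ext rfl hψz
    rw [funext (hchange _ hz₁), planeJet_basisChange (hjac _ hz₁), hz] at h1
    refine Prod.ext rfl (Prod.ext ?_ h1.symm)
    funext a
    change verL b a (f (z₀.1, ψ (z₀.1, horL b (f z₀)))) = _
    rw [hz]
    rfl
  · rw [← sffNormSq_graphMap (t := w.1) (w := w.2) hO hus hw hΩ hG hi hs (by
      rw [hgraph _ hw]; exact hfΩ _ (hψU w hw).1), sffNormSq_congr (hev w hw)]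
    exact sffNormSq_domainChange (f := fun x => f (w.1, x)) (φ := fun x => ψ (w.1, x)) (hf2 w hw)
      (hψ2 w hw) (hGd _ (hψU w hw).1) (hi _ (hfΩ _ (hψU w hw).1)) (hgram w hw) (hjac w hw)
  · rw [← starPullback_graphMap (t := w.1) (w := w.2) (G := G) (W := W) hO hus hw,
      starPullback_congr (hev w hw)]
    exact abs_starPullback_domainChange (f := fun x => f (w.1, x)) (φ := fun x => ψ (w.1, x))
      (hf2 w hw) (hψ2 w hw) (hjac w hw) (fun v => hW _ v)

end GraphConversion

end SurfaceMCF

end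

noncomputable section

namespace SurfaceMCF

/-! ### The local curvature estimate in coordinates -/

section LocalEstimate

theorem starA_basisChange_neg {m : ℕ} {β θ : E m →L[ℝ] E m →L[ℝ] ℝ} {T : Fin 2 → E m}
    (hθ : ∀ v, θ v v = 0) {P : Matrix (Fin 2) (Fin 2) ℝ} (hP : P.det < 0) :
    starA β (fun i => ∑ k, P i k • T k) θ = -starA β T θ := by
  rw [starA, starA, det_gramA_basisChange (b := β) (T := T) (P := P) (fun _ => rfl),
    alternating_sum hθ, Real.sqrt_mul (sq_nonneg _), Real.sqrt_sq_eq_abs, abs_of_neg hP,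
    neg_mul, div_neg, mul_div_mul_left _ _ hP.ne]

theorem IsInner.exists_orthonormal_pair_neg {m : ℕ} {β : E m →L[ℝ] E m →L[ℝ] ℝ} (hβ : IsInner β)
    {T : Fin 2 → E m} (hT : LinearIndependent ℝ T) : ∃ P : Matrix (Fin 2) (Fin 2) ℝ, P.det < 0 ∧
      gramA β (fun i => ∑ k, P i k • T k) = 1 := by
  obtain ⟨P, hP, hg⟩ := hβ.exists_orthonormal_pair hT
  refine ⟨!![-1, 0; 0, 1] * P, by rw [Matrix.det_mul, Matrix.det_fin_two_of]; linarith, ?_⟩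
  rw [gramA_basisChange (b := β) (T := T) (P := P) (fun _ => rfl)] at hg
  rw [gramA_basisChange (b := β) (T := T) (P := !![-1, 0; 0, 1] * P) (fun _ => rfl),
    Matrix.transpose_mul]
  calc _ = !![-1, 0; 0, 1] * (P * gramA β T * Pᵀ) * !![-1, 0; 0, 1]ᵀ := by
        simp only [Matrix.mul_assoc]
    _ = 1 := by
        rw [hg]
        ext i j
        fin_cases i <;> fin_cases j <;> simp [Matrix.mul_apply]

/-- Orthonormalization making two forms of equal sign positive. -/
theorem exists_orthonormal_positive {m : ℕ} {β ε θ' θ'' : E m →L[ℝ] E m →L[ℝ] ℝ} (hβ : IsInner β)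
    (hθ' : ∀ v, θ' v v = 0) (hθ'' : ∀ v, θ'' v v = 0)
    {T : Fin 2 → E m} (hT : LinearIndependent ℝ T) (hpos : 0 < starA ε T θ' * starA ε T θ'') :
    ∃ P : Matrix (Fin 2) (Fin 2) ℝ, P.det ≠ 0 ∧ gramA β (fun i => ∑ k, P i k • T k) = 1 ∧
      starA ε (fun i => ∑ k, P i k • T k) θ' = |starA ε T θ'| ∧
      starA ε (fun i => ∑ k, P i k • T k) θ'' = |starA ε T θ''| := by
  rcases mul_pos_iff.1 hpos with ⟨p', p''⟩ | ⟨p', p''⟩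
  · obtain ⟨P, hP, hg⟩ := hβ.exists_orthonormal_pair hT
    exact ⟨P, hP.ne', hg, by rw [starA_basisChange hθ' hP, abs_of_pos p'],
      by rw [starA_basisChange hθ'' hP, abs_of_pos p'']⟩
  · obtain ⟨P, hP, hg⟩ := hβ.exists_orthonormal_pair_neg hT
    exact ⟨P, hP.ne, hg, by rw [starA_basisChange_neg hθ' hP, abs_of_neg p'],
      by rw [starA_basisChange_neg hθ'' hP, abs_of_neg p'']⟩

variable {G W' W'' : E 4 → E 4 →L[ℝ] E 4 →L[ℝ] ℝ} {Ω : Set (E 4)} {y₀ : E 4}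

/-- `|A|² exp (-p (|*ω'| + |*ω''|))` for a moving surface in coordinates. -/
def weighted (G W' W'' : E 4 → E 4 →L[ℝ] E 4 →L[ℝ] ℝ) (p : ℝ) (f : SpaceTime → E 4)
    (z : SpaceTime) : ℝ :=
  sffNormSq (unb G) (fun x => f (z.1, x)) z.2 *
    Real.exp (-(p * (|starPullback (unb G) (fun x => f (z.1, x)) (unb W') z.2| +
      |starPullback (unb G) (fun x => f (z.1, x)) (unb W'') z.2|)))

/-- A mean curvature flow of immersions in coordinates. -/
structure IsCoordFlow (G : E 4 → E 4 →L[ℝ] E 4 →L[ℝ] ℝ) (Ω : Set (E 4)) (U : Set SpaceTime)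
    (f : SpaceTime → E 4) : Prop where
  isOpen : IsOpen U
  smooth : ContDiffOn ℝ ∞ f U
  mem : ∀ z ∈ U, f z ∈ Ω
  immersion : ∀ z ∈ U, LinearIndependent ℝ fun i => pder (vs i) f z
  flow : ∀ z ∈ U, pder vt f z = meanCurv (unb G) (fun x => f (z.1, x)) z.2

/-- If y₀ carries a plane calibrated by both forms, that plane is unique, so nearly calibrated
planes at nearby points are graphs of small slope over it and the jet estimate applies. If there is
none, compactness excludes nearly calibrated planes near y₀. The radius m is independent of p, which
permits a finite cover before p is fixed. -/
theorem exists_local_estimate (hΩ : IsOpen Ω) (hG : ContDiffOn ℝ ∞ G Ω)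
    (hi : ∀ y ∈ Ω, IsInner (G y)) (hs : ∀ y v w, G y v w = G y w v) (hy : y₀ ∈ Ω)
    (hW' : ContDiffOn ℝ ∞ W' Ω) (hW'' : ContDiffOn ℝ ∞ W'' Ω)
    (ha' : ∀ y v, W' y v v = 0) (ha'' : ∀ y v, W'' y v v = 0)
    (hm' : ∀ y ∈ Ω, ComassLE (G y) (W' y)) (hm'' : ∀ y ∈ Ω, ComassLE (G y) (W'' y))
    (hopp : ∀ b : SplitBasis, IsCalibratedBy b (W' y₀) → IsCalibratedBy b (W'' y₀) →
      W' y₀ (b (Sum.inr 0)) (b (Sum.inr 1)) * W'' y₀ (b (Sum.inr 0)) (b (Sum.inr 1)) < 0) :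
    ∃ m > 0, ∃ p₀ : ℝ, ∀ p ≥ p₀, ∃ ε > 0, ∃ R : ℝ, ∀ (U : Set SpaceTime) (f : SpaceTime → E 4)
      (z₀ : SpaceTime), IsCoordFlow G Ω U f → z₀ ∈ U → dist (f z₀) y₀ < m →
      1 - ε < |starPullback (unb G) (fun x => f (z₀.1, x)) (unb W') z₀.2| →
      1 - ε < |starPullback (unb G) (fun x => f (z₀.1, x)) (unb W'') z₀.2| →
      0 < starPullback (unb G) (fun x => f (z₀.1, x)) (unb W') z₀.2 *
        starPullback (unb G) (fun x => f (z₀.1, x)) (unb W'') z₀.2 →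
      (∀ z ∈ U, z.1 ≤ z₀.1 → weighted G W' W'' p f z ≤ weighted G W' W'' p f z₀) →
      sffNormSq (unb G) (fun x => f (z₀.1, x)) z₀.2 ≤ R := by
  have hpd : ∀ {U : Set SpaceTime} {f : SpaceTime → E 4} {z₀ : SpaceTime}, IsCoordFlow G Ω U f →
      z₀ ∈ U → pd (fun x => f (z₀.1, x)) z₀.2 = fun i => pder (vs i) f z₀ :=
    fun {U f z₀} hf hz => funext fun i => pder_slice (t := z₀.1) (w := z₀.2)
      ((hf.smooth.contDiffAt (hf.isOpen.mem_nhds hz)).differentiableAt (by simp)) i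
  have hstar : ∀ {U : Set SpaceTime} {f : SpaceTime → E 4} {z₀ : SpaceTime}
      {W : E 4 → E 4 →L[ℝ] E 4 →L[ℝ] ℝ}, IsCoordFlow G Ω U f → z₀ ∈ U →
      starPullback (unb G) (fun x => f (z₀.1, x)) (unb W) z₀.2 =
        starA (G (f z₀)) (fun i => pder (vs i) f z₀) (W (f z₀)) := fun {U f z₀ W} hf hz => by
    rw [starPullback_eq, hpd hf hz]
  by_cases hex : ∃ T : Fin 2 → E 4, LinearIndependent ℝ T ∧ starA (G y₀) T (W' y₀) = 1 ∧
      starA (G y₀) T (W'' y₀) = 1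
  · obtain ⟨T, hT, h1', h1''⟩ := hex
    obtain ⟨P, hP, hg⟩ := (hi _ hy).exists_orthonormal_pair hT
    rw [← starA_basisChange (ha' _) hP] at h1'
    rw [← starA_basisChange (ha'' _) hP] at h1''
    rw [starA, hg, Matrix.det_one, Real.sqrt_one, div_one] at h1' h1''
    have e : ∀ i j, G y₀ (∑ k, P i k • T k) (∑ k, P j k • T k) =
        (1 : Matrix (Fin 2) (Fin 2) ℝ) i j := fun i j => congrFun (congrFun hg i) j
    obtain ⟨b, hb, hb0, hb1⟩ := (hi _ hy).exists_splitBasis ((e 0 0).trans (by simp))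
      ((e 1 1).trans (by simp)) ((e 0 1).trans (by simp))
    have hc' := hb.isCalibratedBy (ha' _) (hm' _ hy) (by rw [hb0, hb1]; exact h1')
    have hc'' := hb.isCalibratedBy (ha'' _) (hm'' _ hy) (by rw [hb0, hb1]; exact h1'')
    have hc := hopp b hc' hc''
    obtain ⟨r, hr, p₀, hp₀⟩ := exists_jet_estimate hb hc' hc'' hc hΩ hG hi hs hy hW' hW'' hm' hm''
    obtain ⟨m, hm, hmN⟩ := exists_nearly_calibrated_mem hΩ hG.continuousOn hi hy hW'.continuousOn
      hW''.continuousOn hm' hm'' (isOpen_planeJet_ball b (baseJet b y₀) r) (fun T hT g' g'' => by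
        obtain ⟨k1, k2⟩ := planeJet_of_calibrated hb (hi _ hy) hc' hc'' hc hT g' g'' y₀
        exact ⟨k1, by simpa only [k2] using Metric.mem_ball_self hr⟩)
    refine ⟨m, hm, p₀, fun p hp => ?_⟩
    obtain ⟨ε, hε, R, hR⟩ := hp₀ p hp
    -- The bound m makes the surface a graph of small slope; the bound ε makes the derivative of the
    -- angle function small.
    refine ⟨min ε m, lt_min hε hm, R, fun U f z₀ hf hz₀ hd g' g'' hpos hmax => ?_⟩
    have hTz := hf.immersion z₀ hz₀
    have hpos2 := hpos
    have k' := g'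
    have k'' := g''
    rw [hstar hf hz₀] at k' k''
    rw [hstar hf hz₀, hstar hf hz₀] at hpos2
    obtain ⟨P, hP, hPg, hP', hP''⟩ := exists_orthonormal_positive (isInner_euclL 4) (ha' _) (ha'' _)
      hTz hpos2
    have hmin := min_le_right ε m
    have hmin' := min_le_left ε m
    obtain ⟨k1, k2⟩ := hmN (f z₀) _ hd hPg (by rw [hP']; linarith) (by rw [hP'']; linarith)
    simp only [planeJet_basisChange hP] at k2
    have k3 : (horMatrix b fun i => pder (vs i) f z₀).det ≠ 0 := fun h0 => k1 (by
      simp only [horMatrix_sum, Matrix.det_mul, h0, mul_zero])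
    obtain ⟨O, u, z₁, χ, hsol, hz₁, hχ, hz₁t, hjet, hO⟩ :=
      exists_graph_solution hΩ hG hi hs hf.isOpen hf.smooth hf.mem hf.immersion hf.flow hz₀ k3
    obtain ⟨-, -, hQ₁, hS₁⟩ := hO z₁ hz₁
    rw [hχ] at hQ₁ hS₁
    have hw : ∀ w ∈ O, (graphSystem b G Ω hΩ hG hi hs).Q u w *
        Real.exp (-(p * (|graphStar b G W' (jet u w)| + |graphStar b G W'' (jet u w)|))) =
        weighted G W' W'' p f (χ w) := fun w hw => by
      obtain ⟨-, -, hQ, hS⟩ := hO w hw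
      rw [hQ, hS W' ha', hS W'' ha'', weighted]
    rw [← hQ₁]
    refine hR O u z₁ hsol hz₁ (by rw [hjet]; exact k2) ?_ ?_ fun w hwO hwt => ?_
    · rw [hS₁ W' ha']; linarith
    · rw [hS₁ W'' ha'']; linarith
    · rw [hw w hwO, hw z₁ hz₁, hχ]
      exact hmax _ (hO w hwO).1 (by rw [(hO w hwO).2.1, ← hz₁t]; exact hwt)
  · push Not at hex
    -- With no common calibrated plane, even the empty set is a neighbourhood of all of them, so no
    -- nearly calibrated plane occurs.
    obtain ⟨m, hm, hmN⟩ := exists_nearly_calibrated_mem hΩ hG.continuousOn hi hy hW'.continuousOn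
      hW''.continuousOn hm' hm'' isOpen_empty (fun T hT g' g'' => (hex T hT g' g'').elim)
    refine ⟨m, hm, 0, fun p _ => ⟨m, hm, 0, fun U f z₀ hf hz₀ hd g' g'' hpos _ => ?_⟩⟩
    rw [hstar hf hz₀] at g' g''
    rw [hstar hf hz₀, hstar hf hz₀] at hpos
    obtain ⟨P, hP, hPg, hP', hP''⟩ := exists_orthonormal_positive (isInner_euclL 4) (ha' _) (ha'' _)
      (hf.immersion z₀ hz₀) hpos
    exact (hmN (f z₀) _ hd hPg (by rw [hP']; linarith) (by rw [hP'']; linarith)).elim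

end LocalEstimate

end SurfaceMCF

end

noncomputable section

namespace SurfaceMCF

/-! ### Regularity of the geometric quantities up to the initial and final times -/

section SliceRegularity

variable {V : Set SpaceTime} {W : Type*} [NormedAddCommGroup W] [NormedSpace ℝ W]

/-- Sets of space-time points with unique derivatives and open time slices. -/
structure IsSliceOpen (V : Set SpaceTime) : Prop where
  unique : UniqueDiffOn ℝ V
  slice : ∀ z ∈ V, {x | (z.1, x) ∈ V} ∈ nhds z.2

theorem isSliceOpen_inter {T : ℝ} (hT : 0 < T) {O : Set SpaceTime} (hO : IsOpen O) :
    IsSliceOpen ((Set.Icc 0 T ×ˢ Set.univ) ∩ O) where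
  unique := ((uniqueDiffOn_Icc hT).prod uniqueDiffOn_univ).inter hO
  slice z hz := by
    have h : Continuous fun x : E 2 => ((z.1, x) : SpaceTime) := by fun_prop
    filter_upwards [(hO.preimage h).mem_nhds hz.2] with x hx
    exact ⟨⟨hz.1.1, trivial⟩, hx⟩

theorem IsSliceOpen.pder_slice (hV : IsSliceOpen V) {f : SpaceTime → W} {z : SpaceTime} (hz : z ∈ V)
    (hf : DifferentiableWithinAt ℝ f V z) (i : Fin 2) :
    pder (dir i) (fun x => f (z.1, x)) z.2 = fderivWithin ℝ f V z (vs i) := by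
  have hc : HasFDerivWithinAt (fun x : E 2 => ((z.1, x) : SpaceTime))
      ((0 : E 2 →L[ℝ] ℝ).prod (ContinuousLinearMap.id ℝ (E 2))) {x | (z.1, x) ∈ V} z.2 :=
    ((hasFDerivAt_const z.1 z.2).prodMk (hasFDerivAt_id z.2)).hasFDerivWithinAt
  have h1 : HasFDerivWithinAt (fun x => f (z.1, x)) _ {x | (z.1, x) ∈ V} z.2 :=
    HasFDerivWithinAt.comp (g := f) z.2 hf.hasFDerivWithinAt hc fun _ h => h
  rw [pder, (h1.hasFDerivAt (hV.slice z hz)).fderiv]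
  rfl

theorem IsSliceOpen.contDiffOn_pder_slice (hV : IsSliceOpen V) {f : SpaceTime → W}
    (hf : ContDiffOn ℝ ∞ f V) (i : Fin 2) :
    ContDiffOn ℝ ∞ (fun z => pder (dir i) (fun x => f (z.1, x)) z.2) V := by
  have h1 : ContDiffOn ℝ ∞ (fun z => fderivWithin ℝ f V z (vs i)) V :=
    (hf.fderivWithin hV.unique (m := ∞) (by simp)).clm_apply contDiffOn_const
  exact h1.congr fun z hz => hV.pder_slice hz (hf.differentiableOn (by simp) z hz) i

variable {f : SpaceTime → E 4} {G W : E 4 → E 4 →L[ℝ] E 4 →L[ℝ] ℝ} {Ω : Set (E 4)}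

section

variable (hV : IsSliceOpen V) (hf : ContDiffOn ℝ ∞ f V) (hfΩ : Set.MapsTo f V Ω)
  (hG : ContDiffOn ℝ ∞ G Ω) (hi : ∀ y ∈ Ω, IsInner (G y))
  (himm : ∀ z ∈ V, LinearIndependent ℝ (pd (fun x => f (z.1, x)) z.2))

include hV hf hfΩ hG

theorem contDiffOn_gramA_slice (i j : Fin 2) :
    ContDiffOn ℝ ∞ (fun z => gramA (G (f z)) (pd (fun x => f (z.1, x)) z.2) i j) V :=
  contDiffOn_apply_apply (ContDiffOn.comp (g := G) hG hf hfΩ) (hV.contDiffOn_pder_slice hf i)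
    (hV.contDiffOn_pder_slice hf j)

include hi

theorem contDiffOn_ambientHess_slice (hΩ : IsOpen Ω) (i j : Fin 2) :
    ContDiffOn ℝ ∞ (fun z => ambientHess (unb G) (fun x => f (z.1, x)) z.2 i j) V := by
  refine ContDiffOn.add ?_ (contDiffOn_christoffel hG hi hΩ hf hfΩ
    (hV.contDiffOn_pder_slice hf i) (hV.contDiffOn_pder_slice hf j))
  exact hV.contDiffOn_pder_slice (hV.contDiffOn_pder_slice hf j) i

include himm

theorem contDiffOn_inv_gramA_slice (k l : Fin 2) :
    ContDiffOn ℝ ∞ (fun z => (gramA (G (f z)) (pd (fun x => f (z.1, x)) z.2))⁻¹ k l) V :=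
  contDiffOn_matrix_inv (contDiffOn_gramA_slice hV hf hfΩ hG)
    (fun z hz => ((hi _ (hfΩ hz)).det_gramA_pos (himm z hz)).ne') k l

theorem contDiffOn_sffNormSq_slice (hΩ : IsOpen Ω) :
    ContDiffOn ℝ ∞ (fun z => sffNormSq (unb G) (fun x => f (z.1, x)) z.2) V := by
  have hGf : ContDiffOn ℝ ∞ (fun z => G (f z)) V := ContDiffOn.comp (g := G) hG hf hfΩ
  have hinv := contDiffOn_inv_gramA_slice hV hf hfΩ hG hi himm
  have hn : ∀ i j, ContDiffOn ℝ ∞ (fun z => norA (G (f z)) (pd (fun x => f (z.1, x)) z.2)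
      (ambientHess (unb G) (fun x => f (z.1, x)) z.2 i j)) V := fun i j => by
    have hh := contDiffOn_ambientHess_slice hV hf hfΩ hG hi hΩ i j
    simp only [norA]
    exact hh.sub (ContDiffOn.sum fun k _ => ContDiffOn.sum fun l _ =>
      ((hinv k l).mul (contDiffOn_apply_apply hGf hh (hV.contDiffOn_pder_slice hf k))).smul
        (hV.contDiffOn_pder_slice hf l))
  simp only [sffNormSq_eq, sffNormSqA]
  exact ContDiffOn.sum fun i _ => ContDiffOn.sum fun j _ => ContDiffOn.sum fun k _ =>
    ContDiffOn.sum fun l _ => ((hinv i j).mul (hinv k l)).mul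
      (contDiffOn_apply_apply hGf (hn i k) (hn j l))

theorem contDiffOn_starPullback_slice (hW : ContDiffOn ℝ ∞ W Ω) :
    ContDiffOn ℝ ∞ (fun z => starPullback (unb G) (fun x => f (z.1, x)) (unb W) z.2) V := by
  have hpos : ∀ z ∈ V, 0 < (gramA (G (f z)) (pd (fun x => f (z.1, x)) z.2)).det := fun z hz =>
    (hi _ (hfΩ hz)).det_gramA_pos (himm z hz)
  simp only [starPullback_eq, starA]
  exact (contDiffOn_apply_apply (ContDiffOn.comp (g := W) hW hf hfΩ) (hV.contDiffOn_pder_slice hf 0)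
    (hV.contDiffOn_pder_slice hf 1)).div
    ((contDiffOn_det (contDiffOn_gramA_slice hV hf hfΩ hG)).sqrt fun z hz => (hpos z hz).ne')
    fun z hz => (Real.sqrt_pos.2 (hpos z hz)).ne'

end

end SliceRegularity

end SurfaceMCF

end

noncomputable section

namespace SurfaceMCF

/-! ### Mean curvature flows in charts -/

section FlowCharts

variable {M : Type*} [TopologicalSpace M] [ChartedSpace (E 4) M]
  {S : Type*} [TopologicalSpace S] [ChartedSpace (E 2) S] {T : ℝ} {F : ℝ → S → M}

/-- A moving surface in the charts around `p` and `q`. -/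
def flowMap (F : ℝ → S → M) (p : S) (q : M) (z : SpaceTime) : E 4 := coordMap (F z.1) p q z.2

/-- The domain of a moving surface in the charts around `p` and `q`. -/
def flowDom (F : ℝ → S → M) (T : ℝ) (p : S) (q : M) : Set SpaceTime :=
  {z | (z.1 ∈ Set.Icc 0 T ∧ z.2 ∈ (extChartAt 𝓘(ℝ, E 2) p).target) ∧
    F z.1 ((extChartAt 𝓘(ℝ, E 2) p).symm z.2) ∈ (extChartAt 𝓘(ℝ, E 4) q).source}

theorem flowDom_source {p : S} {q : M} {z : SpaceTime} (hz : z ∈ flowDom F T p q) :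
    (extChartAt 𝓘(ℝ, E 2) p).symm z.2 ∈ (extChartAt 𝓘(ℝ, E 2) p).source :=
  (extChartAt 𝓘(ℝ, E 2) p).map_target hz.1.2

theorem flowDom_right_inv {p : S} {q : M} {z : SpaceTime} (hz : z ∈ flowDom F T p q) :
    extChartAt 𝓘(ℝ, E 2) p ((extChartAt 𝓘(ℝ, E 2) p).symm z.2) = z.2 :=
  (extChartAt 𝓘(ℝ, E 2) p).right_inv hz.1.2

theorem flowMap_mem {p : S} {q : M} : Set.MapsTo (flowMap F p q) (flowDom F T p q)
    (extChartAt 𝓘(ℝ, E 4) q).target := fun _ hz => (extChartAt 𝓘(ℝ, E 4) q).map_source hz.2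

variable [IsManifold 𝓘(ℝ, E 4) ∞ M] [IsManifold 𝓘(ℝ, E 2) ∞ S] {g : Metric 4 M}

theorem IsMeanCurvatureFlow.contMDiff_slice (hF : IsMeanCurvatureFlow g T F) {t : ℝ}
    (ht : t ∈ Set.Icc 0 T) : ContMDiff 𝓘(ℝ, E 2) 𝓘(ℝ, E 4) ∞ (F t) := by
  rw [← contMDiffOn_univ]
  have h : ContMDiffOn 𝓘(ℝ, E 2) (𝓘(ℝ, ℝ).prod 𝓘(ℝ, E 2)) ∞ (fun x : S => ((t, x) : ℝ × S))
      Set.univ := contMDiffOn_const.prodMk contMDiffOn_id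
  exact ContMDiffOn.comp (g := fun tx : ℝ × S => F tx.1 tx.2) hF.smooth h
    fun x _ => ⟨ht, trivial⟩

theorem IsMeanCurvatureFlow.contMDiffOn_param (hF : IsMeanCurvatureFlow g T F) (p : S) :
    ContMDiffOn 𝓘(ℝ, SpaceTime) 𝓘(ℝ, E 4) ∞
      (fun z : SpaceTime => F z.1 ((extChartAt 𝓘(ℝ, E 2) p).symm z.2))
      (Set.Icc 0 T ×ˢ (extChartAt 𝓘(ℝ, E 2) p).target) := by
  have h1 : ContMDiffOn 𝓘(ℝ, SpaceTime) 𝓘(ℝ, ℝ) ∞ (fun z : SpaceTime => z.1)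
      (Set.Icc 0 T ×ˢ (extChartAt 𝓘(ℝ, E 2) p).target) :=
    contDiff_fst.contMDiff.contMDiffOn
  have h2 : ContMDiffOn 𝓘(ℝ, SpaceTime) 𝓘(ℝ, E 2) ∞ (fun z : SpaceTime => z.2)
      (Set.Icc 0 T ×ˢ (extChartAt 𝓘(ℝ, E 2) p).target) :=
    contDiff_snd.contMDiff.contMDiffOn
  have h3 : ContMDiffOn 𝓘(ℝ, SpaceTime) 𝓘(ℝ, E 2) ∞
      (fun z : SpaceTime => (extChartAt 𝓘(ℝ, E 2) p).symm z.2)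
      (Set.Icc 0 T ×ˢ (extChartAt 𝓘(ℝ, E 2) p).target) :=
    (contMDiffOn_extChartAt_symm p).comp h2 fun z hz => hz.2
  exact ContMDiffOn.comp (g := fun tx : ℝ × S => F tx.1 tx.2) hF.smooth (h1.prodMk h3)
    fun z hz => ⟨hz.1, trivial⟩

theorem IsMeanCurvatureFlow.contDiffOn_flowMap (hF : IsMeanCurvatureFlow g T F) (p : S) (q : M) :
    ContDiffOn ℝ ∞ (flowMap F p q) (flowDom F T p q) := by
  rw [← contMDiffOn_iff_contDiffOn]
  refine (contMDiffOn_extChartAt (I := 𝓘(ℝ, E 4)) (x := q) (n := ∞)).comp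
    ((hF.contMDiffOn_param p).mono fun z hz => ⟨hz.1.1, hz.1.2⟩) fun z hz => ?_
  have := hz.2
  rwa [extChartAt_source] at this

theorem IsMeanCurvatureFlow.exists_flowDom_eq (hF : IsMeanCurvatureFlow g T F) (p : S) (q : M) :
    ∃ O : Set SpaceTime, IsOpen O ∧ flowDom F T p q = (Set.Icc 0 T ×ˢ Set.univ) ∩ O := by
  obtain ⟨u, hu, hu'⟩ := continuousOn_iff'.1 (hF.contMDiffOn_param p).continuousOn
    (extChartAt 𝓘(ℝ, E 4) q).source (isOpen_extChartAt_source q)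
  refine ⟨u ∩ Prod.snd ⁻¹' (extChartAt 𝓘(ℝ, E 2) p).target,
    hu.inter ((isOpen_extChartAt_target p).preimage continuous_snd), ?_⟩
  ext z
  constructor
  · intro hz
    have : z ∈ u ∩ (Set.Icc 0 T ×ˢ (extChartAt 𝓘(ℝ, E 2) p).target) := by
      rw [← hu']; exact ⟨hz.2, hz.1.1, hz.1.2⟩
    exact ⟨⟨hz.1.1, trivial⟩, this.1, hz.1.2⟩
  · rintro ⟨⟨h1, -⟩, h2, h3⟩
    have : z ∈ u ∩ (Set.Icc 0 T ×ˢ (extChartAt 𝓘(ℝ, E 2) p).target) := ⟨h2, h1, h3⟩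
    rw [← hu'] at this
    exact ⟨⟨h1, h3⟩, this.1⟩

theorem IsMeanCurvatureFlow.isSliceOpen_flowDom (hF : IsMeanCurvatureFlow g T F) (hT : 0 < T)
    (p : S) (q : M) : IsSliceOpen (flowDom F T p q) := by
  obtain ⟨O, hO, h⟩ := hF.exists_flowDom_eq p q
  rw [h]
  exact isSliceOpen_inter hT hO

theorem IsMeanCurvatureFlow.linearIndependent_pd (hF : IsMeanCurvatureFlow g T F) {p : S} {q : M}
    {z : SpaceTime} (hz : z ∈ flowDom F T p q) :
    LinearIndependent ℝ (pd (fun x => flowMap F p q (z.1, x)) z.2) := by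
  have h := linearIndependent_pd_coordMap (hF.contMDiff_slice hz.1.1) (flowDom_source hz) hz.2
    (hF.immersion _ hz.1.1 _)
  rwa [flowDom_right_inv hz] at h

/-- The squared norm of the second fundamental form of a moving surface. -/
def normSqA (g : Metric 4 M) (F : ℝ → S → M) (tx : ℝ × S) : ℝ :=
  sffNormSq (coordForm g.inner (F tx.1 tx.2)) (coordMap (F tx.1) tx.2 (F tx.1 tx.2))
    (extChartAt 𝓘(ℝ, E 2) tx.2 tx.2)

/-- The absolute value of the Hodge star of the pull-back of a form to a moving surface. -/
def absStar (g : Metric 4 M) (α : TwoForm 4 M) (F : ℝ → S → M) (tx : ℝ × S) : ℝ :=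
  |starPullback (coordForm g.inner (F tx.1 tx.2)) (coordMap (F tx.1) tx.2 (F tx.1 tx.2))
    (coordForm α.val (F tx.1 tx.2)) (extChartAt 𝓘(ℝ, E 2) tx.2 tx.2)|

theorem IsMeanCurvatureFlow.normSqA_eq (hF : IsMeanCurvatureFlow g T F) {p : S} {q : M}
    {z : SpaceTime} (hz : z ∈ flowDom F T p q) :
    normSqA g F (z.1, (extChartAt 𝓘(ℝ, E 2) p).symm z.2) =
      sffNormSq (unb (coordFormL g.inner q)) (fun x => flowMap F p q (z.1, x)) z.2 := by
  have h := sffNormSq_chart g (hF.contMDiff_slice hz.1.1) (flowDom_source hz) hz.2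
    (hF.immersion _ hz.1.1 _)
  rw [flowDom_right_inv hz] at h
  exact h

theorem IsMeanCurvatureFlow.absStar_eq (hF : IsMeanCurvatureFlow g T F) (α : TwoForm 4 M) {p : S}
    {q : M} {z : SpaceTime} (hz : z ∈ flowDom F T p q) :
    absStar g α F (z.1, (extChartAt 𝓘(ℝ, E 2) p).symm z.2) =
      |starPullback (unb (coordFormL g.inner q)) (fun x => flowMap F p q (z.1, x))
        (unb (coordFormL α.val q)) z.2| := by
  have h := abs_starPullback_chart g α (hF.contMDiff_slice hz.1.1) (flowDom_source hz) hz.2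
  rw [flowDom_right_inv hz] at h
  exact h

theorem IsMeanCurvatureFlow.continuousOn_of_chart (hF : IsMeanCurvatureFlow g T F)
    {φ : ℝ × S → ℝ} (h : ∀ p q, ContinuousOn
      (fun z : SpaceTime => φ (z.1, (extChartAt 𝓘(ℝ, E 2) p).symm z.2)) (flowDom F T p q)) :
    ContinuousOn φ (Set.Icc 0 T ×ˢ Set.univ) := by
  rintro ⟨t, p⟩ ⟨ht, -⟩
  set q := F t p with hq
  set ξ : ℝ × S → SpaceTime := fun tx => (tx.1, extChartAt 𝓘(ℝ, E 2) p tx.2) with hξ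
  have hξc : ContinuousWithinAt ξ (Set.Icc 0 T ×ˢ Set.univ) (t, p) := by
    have : ContinuousAt (extChartAt 𝓘(ℝ, E 2) p) p := continuousAt_extChartAt p
    exact (continuousAt_fst.prodMk (ContinuousAt.comp (x := (t, p)) (g := extChartAt 𝓘(ℝ, E 2) p)
      this continuousAt_snd)).continuousWithinAt
  have hmem : ∀ᶠ tx in nhdsWithin (t, p) (Set.Icc 0 T ×ˢ Set.univ),
      tx.2 ∈ (extChartAt 𝓘(ℝ, E 2) p).source ∧ tx.1 ∈ Set.Icc 0 T ∧
        F tx.1 tx.2 ∈ (extChartAt 𝓘(ℝ, E 4) q).source := by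
    have e1 : ∀ᶠ tx : ℝ × S in nhdsWithin (t, p) (Set.Icc 0 T ×ˢ Set.univ),
        tx.2 ∈ (extChartAt 𝓘(ℝ, E 2) p).source :=
      (continuousAt_snd (p := (t, p))).continuousWithinAt.eventually (extChartAt_source_mem_nhds p)
    have e2 : ∀ᶠ tx : ℝ × S in nhdsWithin (t, p) (Set.Icc 0 T ×ˢ Set.univ),
        F tx.1 tx.2 ∈ (extChartAt 𝓘(ℝ, E 4) q).source :=
      (hF.smooth.continuousOn (t, p) ⟨ht, trivial⟩).eventually
        (extChartAt_source_mem_nhds (I := 𝓘(ℝ, E 4)) q)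
    filter_upwards [e1, e2, self_mem_nhdsWithin] with tx h1 h2 h3
    exact ⟨h1, h3.1, h2⟩
  have hdom : ∀ tx : ℝ × S, (tx.2 ∈ (extChartAt 𝓘(ℝ, E 2) p).source ∧ tx.1 ∈ Set.Icc 0 T ∧
      F tx.1 tx.2 ∈ (extChartAt 𝓘(ℝ, E 4) q).source) → ξ tx ∈ flowDom F T p q := fun tx htx => by
    refine ⟨⟨htx.2.1, (extChartAt 𝓘(ℝ, E 2) p).map_source htx.1⟩, ?_⟩
    simp only [hξ]
    rw [(extChartAt 𝓘(ℝ, E 2) p).left_inv htx.1]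
    exact htx.2.2
  have hpt : (t, p).2 ∈ (extChartAt 𝓘(ℝ, E 2) p).source ∧ (t, p).1 ∈ Set.Icc 0 T ∧
        F (t, p).1 (t, p).2 ∈ (extChartAt 𝓘(ℝ, E 4) q).source :=
    ⟨mem_extChartAt_source p, ht, mem_extChartAt_source q⟩
  have hc := h p q (ξ (t, p)) (hdom _ hpt)
  have hcomp : Filter.Tendsto (fun tx => φ ((ξ tx).1, (extChartAt 𝓘(ℝ, E 2) p).symm (ξ tx).2))
      (nhdsWithin (t, p) (Set.Icc 0 T ×ˢ Set.univ))
      (nhds (φ ((ξ (t, p)).1, (extChartAt 𝓘(ℝ, E 2) p).symm (ξ (t, p)).2))) :=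
    Filter.Tendsto.comp (g := fun z : SpaceTime => φ (z.1, (extChartAt 𝓘(ℝ, E 2) p).symm z.2)) hc (tendsto_nhdsWithin_iff.2 ⟨hξc, hmem.mono fun tx htx => hdom tx htx⟩)
  have hinv : ∀ tx : ℝ × S, tx.2 ∈ (extChartAt 𝓘(ℝ, E 2) p).source →
      φ ((ξ tx).1, (extChartAt 𝓘(ℝ, E 2) p).symm (ξ tx).2) = φ tx := fun tx htx => by
    simp only [hξ]
    rw [(extChartAt 𝓘(ℝ, E 2) p).left_inv htx]
  rw [hinv _ hpt.1] at hcomp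
  exact hcomp.congr' (hmem.mono fun tx htx => hinv tx htx.1)

/-- Continuity up to both end times is needed: the maximum may occur at time 0, and the final time
is reached as a limit. -/
theorem IsMeanCurvatureFlow.continuousOn_normSqA (hF : IsMeanCurvatureFlow g T F) (hT : 0 < T) :
    ContinuousOn (normSqA g F) (Set.Icc 0 T ×ˢ Set.univ) := by
  refine hF.continuousOn_of_chart fun p q => ?_
  refine ContinuousOn.congr ?_ fun z hz => hF.normSqA_eq hz
  exact (contDiffOn_sffNormSq_slice (hF.isSliceOpen_flowDom hT p q) (hF.contDiffOn_flowMap p q)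
    flowMap_mem (contDiffOn_coordFormL g.contMDiff q) (fun y hy => isInner_coordFormL g hy)
    (fun z hz => hF.linearIndependent_pd hz) (isOpen_extChartAt_target q)).continuousOn

theorem IsMeanCurvatureFlow.continuousOn_absStar (hF : IsMeanCurvatureFlow g T F) (hT : 0 < T)
    (α : TwoForm 4 M) : ContinuousOn (absStar g α F) (Set.Icc 0 T ×ˢ Set.univ) := by
  refine hF.continuousOn_of_chart fun p q => ?_
  refine ContinuousOn.congr ?_ fun z hz => hF.absStar_eq α hz
  exact (contDiffOn_starPullback_slice (hF.isSliceOpen_flowDom hT p q) (hF.contDiffOn_flowMap p q)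
    flowMap_mem (contDiffOn_coordFormL g.contMDiff q) (fun y hy => isInner_coordFormL g hy)
    (fun z hz => hF.linearIndependent_pd hz) (contDiffOn_coordFormL α.smooth q)).continuousOn.abs

/-- In the interior of the time interval, a mean curvature flow is a flow in coordinates. -/
theorem IsMeanCurvatureFlow.isCoordFlow (hF : IsMeanCurvatureFlow g T F) (p : S) (q : M) :
    IsCoordFlow (coordFormL g.inner q) (extChartAt 𝓘(ℝ, E 4) q).target
      (flowDom F T p q ∩ {z | z.1 ∈ Set.Ioo 0 T}) (flowMap F p q) := by
  have ho : IsOpen (flowDom F T p q ∩ {z | z.1 ∈ Set.Ioo 0 T}) := by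
    obtain ⟨O, hO, h⟩ := hF.exists_flowDom_eq p q
    have e : flowDom F T p q ∩ {z | z.1 ∈ Set.Ioo 0 T} = O ∩ Prod.fst ⁻¹' Set.Ioo 0 T := by
      ext z
      rw [h]
      exact ⟨fun hz => ⟨hz.1.2, hz.2⟩,
        fun hz => ⟨⟨⟨Set.Ioo_subset_Icc_self hz.2, trivial⟩, hz.1⟩, hz.2⟩⟩
    rw [e]
    exact hO.inter (isOpen_Ioo.preimage continuous_fst)
  have hs := (hF.contDiffOn_flowMap p q).mono
    (Set.inter_subset_left (t := {z : SpaceTime | z.1 ∈ Set.Ioo 0 T}))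
  have hd : ∀ z ∈ flowDom F T p q ∩ {z | z.1 ∈ Set.Ioo 0 T},
      DifferentiableAt ℝ (flowMap F p q) z := fun z hz =>
    (hs.contDiffAt (ho.mem_nhds hz)).differentiableAt (by simp)
  refine ⟨ho, hs, fun z hz => flowMap_mem hz.1, fun z hz => ?_, fun z hz => ?_⟩
  · have h := hF.linearIndependent_pd hz.1
    have e : pd (fun x => flowMap F p q (z.1, x)) z.2 = fun i => pder (vs i) (flowMap F p q) z :=
      funext fun i => pder_slice (t := z.1) (w := z.2) (hd z hz) i
    rwa [e] at h
  · have h1 := hF.flow z.1 hz.1.1.1 p _ q (flowDom_source hz.1) hz.1.2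
    rw [flowDom_right_inv hz.1] at h1
    have h2 := h1.hasDerivAt (Icc_mem_nhds hz.2.1 hz.2.2)
    have h3 : HasDerivAt (fun s => flowMap F p q (s, z.2)) (fderiv ℝ (flowMap F p q) z vt) z.1 := by
      have hc : HasDerivAt (fun s : ℝ => ((s, z.2) : SpaceTime)) vt z.1 :=
        (hasDerivAt_id z.1).prodMk (hasDerivAt_const z.1 z.2)
      exact HasFDerivAt.comp_hasDerivAt (l := flowMap F p q) z.1 (hd z hz).hasFDerivAt hc
    exact h3.unique h2

end FlowCharts

end SurfaceMCF

end

noncomputable section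

namespace SurfaceMCF

/-! ### The curvature estimate on the manifold -/

section Global

variable {M : Type*} [TopologicalSpace M] [ChartedSpace (E 4) M] [IsManifold 𝓘(ℝ, E 4) ∞ M]

theorem comassLE_coordFormL {g : Metric 4 M} {α : TwoForm 4 M} (h : ∀ p, α.HasComassAt g p 1)
    {q : M} {y : E 4} (hy : y ∈ (extChartAt 𝓘(ℝ, E 4) q).target) :
    ComassLE (coordFormL g.inner q y) (coordFormL α.val q y) :=
  comassLE_of_orthonormal (isInner_coordFormL g hy) (fun _ => α.alternating _ _)
    fun u v hu hv huv => (h ((extChartAt 𝓘(ℝ, E 4) q).symm y)).2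
      ⟨chartFrame q y u, chartFrame q y v, hu, hv, huv, rfl⟩

/-- In normal form the mixed components vanish, so ω ∧ ω on the frame is 2λ; opposite orientations
therefore mean λ'λ'' < 0. -/
theorem OppositeOrientations.mul_neg {ω' ω'' : TwoForm 4 M} (h : OppositeOrientations ω' ω'')
    {q : M} {y : E 4} (hy : y ∈ (extChartAt 𝓘(ℝ, E 4) q).target) {b : SplitBasis}
    (h' : IsCalibratedBy b (coordFormL ω'.val q y))
    (h'' : IsCalibratedBy b (coordFormL ω''.val q y)) :
    coordFormL ω'.val q y (b (Sum.inr 0)) (b (Sum.inr 1)) *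
      coordFormL ω''.val q y (b (Sum.inr 0)) (b (Sum.inr 1)) < 0 := by
  set s : Fin 4 → Fin 2 ⊕ Fin 2 := ![Sum.inl 0, Sum.inl 1, Sum.inr 0, Sum.inr 1] with hs
  have hinj : Function.Injective s := by
    intro i j hij
    fin_cases i <;> fin_cases j <;> simp_all
  have hli : LinearIndependent ℝ fun i => chartFrame q y (b (s i)) :=
    (b.linearIndependent.comp s hinj).map' (chartFrame q y : E 4 →ₗ[ℝ] E 4)
      (LinearMap.ker_eq_bot.2 (chartFrame_injective hy))
  have key := h ((extChartAt 𝓘(ℝ, E 4) q).symm y) (fun i => chartFrame q y (b (s i))) hli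
  have hw : ∀ {α : TwoForm 4 M}, IsCalibratedBy b (coordFormL α.val q y) →
      α.wedgeSq ((extChartAt 𝓘(ℝ, E 4) q).symm y) (fun i => chartFrame q y (b (s i))) =
        2 * coordFormL α.val q y (b (Sum.inr 0)) (b (Sum.inr 1)) := fun {α} hα => by
    have e : ∀ i j, α.val ((extChartAt 𝓘(ℝ, E 4) q).symm y) (chartFrame q y (b (s i)))
        (chartFrame q y (b (s j))) = coordFormL α.val q y (b (s i)) (b (s j)) := fun _ _ => rfl
    simp only [TwoForm.wedgeSq, e]
    simp only [hs, Matrix.cons_val_zero, Matrix.cons_val_one, Matrix.cons_val]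
    simp only [hα.one, hα.cross]
    ring
  rw [hw h', hw h''] at key
  linarith

variable {S : Type*} [TopologicalSpace S] [ChartedSpace (E 2) S] [IsManifold 𝓘(ℝ, E 2) ∞ S]

/-- The function `*(F^* α)` may be computed in any chart of the target. -/
theorem starPullback_targetChart (g : Metric 4 M) (α : TwoForm 4 M) {F : S → M}
    (hF : ContMDiff 𝓘(ℝ, E 2) 𝓘(ℝ, E 4) ∞ F) {x : S} {q : M}
    (hq : F x ∈ (extChartAt 𝓘(ℝ, E 4) q).source) :
    starPullback (coordForm g.inner (F x)) (coordMap F x (F x)) (coordForm α.val (F x))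
        (extChartAt 𝓘(ℝ, E 2) x x) =
      starPullback (coordForm g.inner q) (coordMap F x q) (coordForm α.val q)
        (extChartAt 𝓘(ℝ, E 2) x x) := by
  have hx := mem_extChartAt_source (I := 𝓘(ℝ, E 2)) x
  have hev : coordMap F x (F x) =ᶠ[nhds (extChartAt 𝓘(ℝ, E 2) x x)]
      fun w => transition q (F x) (coordMap F x q w) := by
    filter_upwards [coordMap_eventuallyEq hF hx hq,
      (isOpen_extChartAt_target x).mem_nhds (mem_extChartAt_target x)] with w h1 h2
    have : transition x x w = w := (extChartAt 𝓘(ℝ, E 2) x).right_inv h2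
    rw [h1, this]
  have hfx : coordMap F x q (extChartAt 𝓘(ℝ, E 2) x x) = extChartAt 𝓘(ℝ, E 4) q (F x) := by
    rw [coordMap, (extChartAt 𝓘(ℝ, E 2) x).left_inv hx]
  have hydom : coordMap F x q (extChartAt 𝓘(ℝ, E 2) x x) ∈ transitionDom q (F x) := by
    rw [hfx]
    refine ⟨(extChartAt 𝓘(ℝ, E 4) q).map_source hq, ?_⟩
    rw [Set.mem_preimage, (extChartAt 𝓘(ℝ, E 4) q).left_inv hq]
    exact mem_extChartAt_source (F x)
  rw [coordForm_eq, coordForm_eq, coordForm_eq, coordForm_eq, starPullback_congr hev]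
  exact starPullback_targetChange ((contDiffAt_coordMap hF hx hq).differentiableAt (by simp))
    (((contDiffOn_transition q (F x)).contDiffAt
      ((isOpen_transitionDom q (F x)).mem_nhds hydom)).differentiableAt (by simp))
    (coordFormL_transition g.inner hydom) (coordFormL_transition α.val hydom)

/-- `|A|² exp (-p (|*ω'| + |*ω''|))` for a moving surface. -/
def weightedA (g : Metric 4 M) (ω' ω'' : TwoForm 4 M) (p : ℝ) (F : ℝ → S → M) (tx : ℝ × S) : ℝ :=
  normSqA g F tx * Real.exp (-(p * (absStar g ω' F tx + absStar g ω'' F tx)))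

set_option maxHeartbeats 2000000 in
/-- The curvature estimate at an interior maximum, for surfaces passing close to a given point. -/
theorem exists_nhds_estimate.{u, v} {M : Type u} [TopologicalSpace M] [ChartedSpace (E 4) M]
    [IsManifold 𝓘(ℝ, E 4) ∞ M] (g : Metric 4 M) {ω' ω'' : TwoForm 4 M}
    (hc' : ∀ p, ω'.HasComassAt g p 1) (hc'' : ∀ p, ω''.HasComassAt g p 1)
    (hor : OppositeOrientations ω' ω'') (q : M) :
    ∃ N ∈ nhds q, ∃ p₀ : ℝ, ∀ p ≥ p₀, ∃ ε > 0, ∃ R : ℝ, ∀ (S : Type v) [TopologicalSpace S]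
      [ChartedSpace (E 2) S] [IsManifold 𝓘(ℝ, E 2) ∞ S] (T : ℝ) (F : ℝ → S → M),
      IsMeanCurvatureFlow g T F → ∀ t₀ ∈ Set.Ioo 0 T, ∀ x₀ : S, F t₀ x₀ ∈ N →
      1 - ε < absStar g ω' F (t₀, x₀) → 1 - ε < absStar g ω'' F (t₀, x₀) →
      0 < starPullback (coordForm g.inner (F t₀ x₀)) (coordMap (F t₀) x₀ (F t₀ x₀))
          (coordForm ω'.val (F t₀ x₀)) (extChartAt 𝓘(ℝ, E 2) x₀ x₀) *
        starPullback (coordForm g.inner (F t₀ x₀)) (coordMap (F t₀) x₀ (F t₀ x₀))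
          (coordForm ω''.val (F t₀ x₀)) (extChartAt 𝓘(ℝ, E 2) x₀ x₀) →
      (∀ t ∈ Set.Icc 0 t₀, ∀ x, weightedA g ω' ω'' p F (t, x) ≤ weightedA g ω' ω'' p F (t₀, x₀)) →
      normSqA g F (t₀, x₀) ≤ R := by
  set φ := extChartAt 𝓘(ℝ, E 4) q with hφ
  have hq := mem_extChartAt_target (I := 𝓘(ℝ, E 4)) q
  obtain ⟨m, hm, p₀, hp₀⟩ := exists_local_estimate (G := coordFormL g.inner q)
    (W' := coordFormL ω'.val q) (W'' := coordFormL ω''.val q) (isOpen_extChartAt_target q)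
    (contDiffOn_coordFormL g.contMDiff q) (fun y hy => isInner_coordFormL g hy)
    (fun y v w => g.symm _ _ _) hq (contDiffOn_coordFormL ω'.smooth q)
    (contDiffOn_coordFormL ω''.smooth q) (fun y v => ω'.alternating _ _)
    (fun y v => ω''.alternating _ _) (fun y hy => comassLE_coordFormL hc' hy)
    (fun y hy => comassLE_coordFormL hc'' hy) (fun b h' h'' => hor.mul_neg hq h' h'')
  have hN : {y | y ∈ φ.source ∧ dist (φ y) (φ q) < m} ∈ nhds q := by
    have h1 : ∀ᶠ y in nhds q, φ y ∈ Metric.ball (φ q) m :=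
      (continuousAt_extChartAt q).eventually (Metric.ball_mem_nhds _ hm)
    filter_upwards [extChartAt_source_mem_nhds (I := 𝓘(ℝ, E 4)) q, h1] with y hy1 hy2
    exact ⟨hy1, hy2⟩
  refine ⟨_, hN, p₀, fun p hp => ?_⟩
  obtain ⟨ε, hε, R, hR⟩ := hp₀ p hp
  refine ⟨ε, hε, R, ?_⟩
  intro S _ _ _ T F hF t₀ ht₀ x₀ hx₀ g' g'' hpos hmax
  set ψ := extChartAt 𝓘(ℝ, E 2) x₀ with hψ
  have hx := mem_extChartAt_source (I := 𝓘(ℝ, E 2)) x₀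
  have hinv : ψ.symm (ψ x₀) = x₀ := ψ.left_inv hx
  have hz₀ : ((t₀, ψ x₀) : SpaceTime) ∈ flowDom F T x₀ q := by
    refine ⟨⟨Set.Ioo_subset_Icc_self ht₀, ψ.map_source hx⟩, ?_⟩
    change F t₀ (ψ.symm (ψ x₀)) ∈ _
    rw [hinv]
    exact hx₀.1
  have hA := hF.normSqA_eq hz₀
  have hS' := hF.absStar_eq ω' hz₀
  have hS'' := hF.absStar_eq ω'' hz₀
  have hw : ∀ z ∈ flowDom F T x₀ q, weighted (coordFormL g.inner q) (coordFormL ω'.val q)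
      (coordFormL ω''.val q) p (flowMap F x₀ q) z =
      weightedA g ω' ω'' p F (z.1, ψ.symm z.2) := fun z hz => by
    rw [weighted, weightedA, hF.normSqA_eq hz, hF.absStar_eq ω' hz, hF.absStar_eq ω'' hz]
  simp only [← hψ, hinv] at hA hS' hS''
  rw [starPullback_targetChart g ω' (hF.contMDiff_slice (Set.Ioo_subset_Icc_self ht₀)) hx₀.1,
    starPullback_targetChart g ω'' (hF.contMDiff_slice (Set.Ioo_subset_Icc_self ht₀)) hx₀.1] at hpos
  rw [hA]
  refine hR _ (flowMap F x₀ q) (t₀, ψ x₀) (hF.isCoordFlow x₀ q) ⟨hz₀, ht₀⟩ ?_ ?_ ?_ hpos ?_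
  · have : flowMap F x₀ q (t₀, ψ x₀) = φ (F t₀ x₀) := by
      change φ (F t₀ (ψ.symm (ψ x₀))) = _
      rw [hinv]
    rw [this]
    exact hx₀.2
  · rwa [hS'] at g'
  · rwa [hS''] at g''
  · intro z hz hzt
    rw [hw z hz.1, hw _ hz₀]
    simp only [hinv]
    exact hmax z.1 ⟨hz.2.1.le, hzt⟩ _

/-- The choice of constants, uniform over a compact manifold. -/
theorem exists_uniform_estimate.{u, v} {M : Type u} [TopologicalSpace M] [ChartedSpace (E 4) M]
    [IsManifold 𝓘(ℝ, E 4) ∞ M] [CompactSpace M] (g : Metric 4 M) {ω' ω'' : TwoForm 4 M}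
    (hc' : ∀ p, ω'.HasComassAt g p 1) (hc'' : ∀ p, ω''.HasComassAt g p 1)
    (hor : OppositeOrientations ω' ω'') :
    ∃ p ≥ (0 : ℝ), ∃ ε > 0, ε < 1 ∧ ∃ R : ℝ, ∀ (S : Type v) [TopologicalSpace S]
      [ChartedSpace (E 2) S] [IsManifold 𝓘(ℝ, E 2) ∞ S] (T : ℝ) (F : ℝ → S → M),
      IsMeanCurvatureFlow g T F → ∀ t₀ ∈ Set.Ioo 0 T, ∀ x₀ : S,
      1 - ε < absStar g ω' F (t₀, x₀) → 1 - ε < absStar g ω'' F (t₀, x₀) →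
      0 < starPullback (coordForm g.inner (F t₀ x₀)) (coordMap (F t₀) x₀ (F t₀ x₀))
          (coordForm ω'.val (F t₀ x₀)) (extChartAt 𝓘(ℝ, E 2) x₀ x₀) *
        starPullback (coordForm g.inner (F t₀ x₀)) (coordMap (F t₀) x₀ (F t₀ x₀))
          (coordForm ω''.val (F t₀ x₀)) (extChartAt 𝓘(ℝ, E 2) x₀ x₀) →
      (∀ t ∈ Set.Icc 0 t₀, ∀ x, weightedA g ω' ω'' p F (t, x) ≤ weightedA g ω' ω'' p F (t₀, x₀)) →
      normSqA g F (t₀, x₀) ≤ R := by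
  choose N hN p₀ hp₀ using fun q => exists_nhds_estimate.{u, v} g hc' hc'' hor q
  obtain ⟨s, hs⟩ := CompactSpace.elim_nhds_subcover N hN
  -- A single exponent must serve all points of the finite cover, and it has to be fixed before the
  -- ε's, which depend on it.
  obtain ⟨p, hp⟩ : ∃ p : ℝ, 0 ≤ p ∧ ∀ q ∈ s, p₀ q ≤ p := by
    have : ∀ᶠ p : ℝ in Filter.atTop, 0 ≤ p ∧ ∀ q ∈ s, p₀ q ≤ p :=
      (Filter.eventually_ge_atTop 0).and
        ((Finset.eventually_all s).2 fun q _ => Filter.eventually_ge_atTop _)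
    exact this.exists
  choose! ε hε R hR using fun q (hq : q ∈ s) => hp₀ q p (hp.2 q hq)
  obtain ⟨e, he⟩ : ∃ e : ℝ, (0 < e ∧ e < 1) ∧ ∀ q ∈ s, e ≤ ε q := by
    have : ∀ᶠ e : ℝ in nhdsWithin 0 (Set.Ioi 0), (0 < e ∧ e < 1) ∧ ∀ q ∈ s, e ≤ ε q := by
      refine Filter.Eventually.and (Ioo_mem_nhdsGT one_pos) ((Finset.eventually_all s).2 fun q hq => ?_)
      filter_upwards [Ioo_mem_nhdsGT (hε q hq)] with e he
      exact he.2.le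
    exact this.exists
  obtain ⟨R', hR'⟩ : ∃ R' : ℝ, ∀ q ∈ s, R q ≤ R' := by
    have : ∀ᶠ p : ℝ in Filter.atTop, ∀ q ∈ s, R q ≤ p :=
      (Finset.eventually_all s).2 fun q _ => Filter.eventually_ge_atTop _
    exact this.exists
  refine ⟨p, hp.1, e, he.1.1, he.1.2, R', ?_⟩
  intro S _ _ _ T F hF t₀ ht₀ x₀ g' g'' hpos hmax
  have hcov : F t₀ x₀ ∈ ⋃ q ∈ s, N q := by rw [hs]; trivial
  obtain ⟨q, hq, hqN⟩ := Set.mem_iUnion₂.1 hcov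
  have heq := he.2 q hq
  exact (hR q hq S T F hF t₀ ht₀ x₀ hqN (by linarith) (by linarith) hpos hmax).trans (hR' q hq)

theorem absStar_eq_hodgeStar {g : Metric 4 M} {α : TwoForm 4 M} {μ : TwoForm 2 S} {F : ℝ → S → M}
    {t : ℝ} {x : S} (h : 0 < hodgeStar g α μ (F t) x) :
    absStar g α F (t, x) = hodgeStar g α μ (F t) x := by
  rw [hodgeStar] at h ⊢
  rw [absStar]
  rcases lt_trichotomy (coordForm μ.val x (extChartAt 𝓘(ℝ, E 2) x x) (dir 0) (dir 1)) 0
    with hs | hs | hs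
  · rw [sign_neg hs] at h ⊢
    simp only [SignType.coe_neg_one, neg_mul, one_mul] at h ⊢
    exact abs_of_neg (by linarith)
  · rw [hs, sign_zero] at h
    simp at h
  · rw [sign_pos hs] at h ⊢
    simp only [SignType.coe_one, one_mul] at h ⊢
    exact abs_of_pos h

/-- Both functions carry the same orientation sign, which squares to 1. The relative sign is all
that survives of the orientation once absolute values are used. -/
theorem starPullback_mul_pos {g : Metric 4 M} {ω' ω'' : TwoForm 4 M} {μ : TwoForm 2 S} {F : S → M}
    {x : S} (h' : 0 < hodgeStar g ω' μ F x) (h'' : 0 < hodgeStar g ω'' μ F x) :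
    0 < starPullback (coordForm g.inner (F x)) (coordMap F x (F x)) (coordForm ω'.val (F x))
          (extChartAt 𝓘(ℝ, E 2) x x) *
        starPullback (coordForm g.inner (F x)) (coordMap F x (F x)) (coordForm ω''.val (F x))
          (extChartAt 𝓘(ℝ, E 2) x x) := by
  have h := mul_pos h' h''
  rw [hodgeStar, hodgeStar] at h
  rcases lt_trichotomy (coordForm μ.val x (extChartAt 𝓘(ℝ, E 2) x x) (dir 0) (dir 1)) 0
    with hs | hs | hs
  · rw [sign_neg hs] at h
    simpa using h
  · rw [hs, sign_zero] at h
    simp at h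
  · rw [sign_pos hs] at h
    simpa using h

theorem absStar_le_one {g : Metric 4 M} {α : TwoForm 4 M} (hα : ∀ p, α.HasComassAt g p 1) {T : ℝ}
    {F : ℝ → S → M} (hF : IsMeanCurvatureFlow g T F) {t : ℝ} (ht : t ∈ Set.Icc 0 T) (x : S) :
    absStar g α F (t, x) ≤ 1 := by
  have hx := mem_extChartAt_source (I := 𝓘(ℝ, E 2)) x
  have hy : coordMap (F t) x (F t x) (extChartAt 𝓘(ℝ, E 2) x x) ∈
      (extChartAt 𝓘(ℝ, E 4) (F t x)).target := by
    rw [coordMap, (extChartAt 𝓘(ℝ, E 2) x).left_inv hx]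
    exact mem_extChartAt_target (F t x)
  exact (comassLE_coordFormL hα hy).abs_starA_le (isInner_coordFormL g hy)
    (linearIndependent_pd_coordMap (hF.contMDiff_slice ht) hx (mem_extChartAt_source (F t x))
      (hF.immersion t ht x))

end Global

end SurfaceMCF

end

noncomputable section

namespace SurfaceMCF

/-! ### The maximum principle argument -/

section MaximumPrinciple

variable {M : Type*} [TopologicalSpace M] [ChartedSpace (E 4) M] [IsManifold 𝓘(ℝ, E 4) ∞ M]
  {S : Type*} [TopologicalSpace S] [ChartedSpace (E 2) S] [IsManifold 𝓘(ℝ, E 2) ∞ S]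
  {g : Metric 4 M} {ω' ω'' : TwoForm 4 M} {T : ℝ} {F : ℝ → S → M}

theorem IsMeanCurvatureFlow.continuousOn_weightedA (hF : IsMeanCurvatureFlow g T F) (hT : 0 < T)
    (p : ℝ) : ContinuousOn (weightedA g ω' ω'' p F) (Set.Icc 0 T ×ˢ Set.univ) :=
  (hF.continuousOn_normSqA hT).mul (Real.continuous_exp.comp_continuousOn
    (continuousOn_const.mul ((hF.continuousOn_absStar hT ω').add
      (hF.continuousOn_absStar hT ω''))).neg)

/-- A bound for `|A|²` at the interior maxima of the weighted quantity and at the initial time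
gives a bound for all times. -/
theorem IsMeanCurvatureFlow.normSqA_le [CompactSpace S] (hF : IsMeanCurvatureFlow g T F)
    (hc' : ∀ p, ω'.HasComassAt g p 1) (hc'' : ∀ p, ω''.HasComassAt g p 1) (hT : 0 < T)
    {p A₀ R : ℝ} (hp : 0 ≤ p) (hA₀ : ∀ x : S, normA g (F 0) x ≤ A₀)
    (hmax : ∀ t₀ ∈ Set.Ioo 0 T, ∀ x₀ : S,
      (∀ t ∈ Set.Icc 0 t₀, ∀ x, weightedA g ω' ω'' p F (t, x) ≤ weightedA g ω' ω'' p F (t₀, x₀)) →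
      normSqA g F (t₀, x₀) ≤ R) {t : ℝ} (ht : t ∈ Set.Icc 0 T) (x : S) :
    normSqA g F (t, x) ≤ max (A₀ ^ 2) R * Real.exp (p * 2) := by
  have hR0 : 0 ≤ max (A₀ ^ 2) R := (sq_nonneg A₀).trans (le_max_left _ _)
  -- The interior estimate needs a two-sided time neighbourhood, hence t < T; the time T follows by
  -- continuity.
  have hlt : ∀ t ∈ Set.Ico 0 T, normSqA g F (t, x) ≤ max (A₀ ^ 2) R * Real.exp (p * 2) := by
    intro t ht
    have hsub : Set.Icc 0 t ×ˢ (Set.univ : Set S) ⊆ Set.Icc 0 T ×ˢ Set.univ :=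
      Set.prod_mono (Set.Icc_subset_Icc_right ht.2.le) le_rfl
    have hcomp : IsCompact (Set.Icc 0 t ×ˢ (Set.univ : Set S)) := isCompact_Icc.prod isCompact_univ
    obtain ⟨⟨t₀, x₀⟩, ⟨ht₀, -⟩, hm⟩ := hcomp.exists_isMaxOn
      ⟨(t, x), ⟨ht.1, le_rfl⟩, trivial⟩ ((hF.continuousOn_weightedA (ω' := ω') (ω'' := ω'') hT p).mono hsub)
    replace ht₀ : t₀ ∈ Set.Icc 0 t := ht₀
    have hm' : ∀ s ∈ Set.Icc 0 t, ∀ y,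
        weightedA g ω' ω'' p F (s, y) ≤ weightedA g ω' ω'' p F (t₀, x₀) := fun s hs y =>
      hm (⟨hs, trivial⟩ : (s, y) ∈ Set.Icc 0 t ×ˢ (Set.univ : Set S))
    have hbound : normSqA g F (t₀, x₀) ≤ max (A₀ ^ 2) R := by
      rcases ht₀.1.eq_or_lt with h0 | h0
      · rw [← h0]
        exact (Real.sqrt_le_iff.1 (hA₀ x₀)).2.trans (le_max_left _ _)
      · exact (hmax t₀ ⟨h0, ht₀.2.trans_lt ht.2⟩ x₀ fun s hs y =>
          hm' s ⟨hs.1, hs.2.trans ht₀.2⟩ y).trans (le_max_right _ _)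
    have hw₀ : weightedA g ω' ω'' p F (t₀, x₀) ≤ max (A₀ ^ 2) R := by
      -- The weight is at most 1 at the maximum and at least exp(-2p) at (t, x), since each star is
      -- at most 1; the loss is the factor exp(2p).
      have he : Real.exp (-(p * (absStar g ω' F (t₀, x₀) + absStar g ω'' F (t₀, x₀)))) ≤ 1 := by
        rw [Real.exp_le_one_iff, neg_nonpos]
        exact mul_nonneg hp (add_nonneg (abs_nonneg _) (abs_nonneg _))
      calc weightedA g ω' ω'' p F (t₀, x₀) ≤ max (A₀ ^ 2) R *
            Real.exp (-(p * (absStar g ω' F (t₀, x₀) + absStar g ω'' F (t₀, x₀)))) :=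
            mul_le_mul_of_nonneg_right hbound (Real.exp_pos _).le
        _ ≤ max (A₀ ^ 2) R * 1 := mul_le_mul_of_nonneg_left he hR0
        _ = _ := mul_one _
    have hw := (hm' t ⟨ht.1, le_rfl⟩ x).trans hw₀
    have ht' : t ∈ Set.Icc 0 T := Set.Ico_subset_Icc_self ht
    have hs' := absStar_le_one hc' hF ht' x
    have hs'' := absStar_le_one hc'' hF ht' x
    have e : normSqA g F (t, x) = weightedA g ω' ω'' p F (t, x) *
        Real.exp (p * (absStar g ω' F (t, x) + absStar g ω'' F (t, x))) := by
      rw [weightedA, mul_assoc, ← Real.exp_add, neg_add_cancel, Real.exp_zero, mul_one]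
    rw [e]
    calc _ ≤ max (A₀ ^ 2) R * Real.exp (p * (absStar g ω' F (t, x) + absStar g ω'' F (t, x))) :=
          mul_le_mul_of_nonneg_right hw (Real.exp_pos _).le
      _ ≤ _ := mul_le_mul_of_nonneg_left
          (Real.exp_le_exp.2 (mul_le_mul_of_nonneg_left (by linarith) hp)) hR0
  rcases ht.2.eq_or_lt with rfl | h
  · have hc : ContinuousOn (fun s => normSqA g F (s, x)) (Set.Icc 0 t) :=
      (hF.continuousOn_normSqA hT).comp (by fun_prop) fun s hs => ⟨hs, trivial⟩
    have hcl : t ∈ closure (Set.Ico 0 t) := by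
      rw [closure_Ico hT.ne]; exact ht
    have hcw : ContinuousWithinAt (fun s => normSqA g F (s, x)) (Set.Ico 0 t) t :=
      (hc t ht).mono Set.Ico_subset_Icc_self
    exact hcw.closure_le hcl continuousWithinAt_const hlt
  · exact hlt t ⟨ht.1, h⟩

end MaximumPrinciple

end SurfaceMCF

end

/-! ### The curvature bound. -/

theorem mainTheorem8 {M : Type*} [TopologicalSpace M]
    [ChartedSpace (SurfaceMCF.E 4) M] [IsManifold 𝓘(ℝ, SurfaceMCF.E 4) ∞ M]
    [T2Space M] [CompactSpace M]
    (g : SurfaceMCF.Metric 4 M) (ω' ω'' : SurfaceMCF.TwoForm 4 M)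
    (hcal' : ω'.IsCalibrating g) (hcal'' : ω''.IsCalibrating g)
    (hpar' : ω'.IsParallel g) (hpar'' : ω''.IsParallel g)
    (hor : SurfaceMCF.OppositeOrientations ω' ω'') :
    ∃ ε : ℝ, 0 < ε ∧ ε < 1 ∧ ∀ A₀ : ℝ, ∃ C : ℝ,
      ∀ (S : Type*) [TopologicalSpace S] [ChartedSpace (SurfaceMCF.E 2) S]
        [IsManifold 𝓘(ℝ, SurfaceMCF.E 2) ∞ S] [T2Space S] [CompactSpace S]
        (μ : SurfaceMCF.TwoForm 2 S), SurfaceMCF.IsOrientationForm μ →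
      ∀ (T : ℝ), 0 < T → ∀ F : ℝ → S → M, SurfaceMCF.IsMeanCurvatureFlow g T F →
        (∀ x : S, SurfaceMCF.normA g (F 0) x ≤ A₀) →
        (∀ t ∈ Set.Icc 0 T, ∀ x : S,
          1 - ε < SurfaceMCF.hodgeStar g ω' μ (F t) x ∧ 1 - ε < SurfaceMCF.hodgeStar g ω'' μ (F t) x) →
        ∀ t ∈ Set.Icc 0 T, ∀ x : S, SurfaceMCF.normA g (F t) x ≤ C := by
  obtain ⟨p, hp, ε, hε, hε1, R, hR⟩ :=
    SurfaceMCF.exists_uniform_estimate g hcal'.comass hcal''.comass hor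
  -- Only this constant involves A₀; ε, p and R come from the geometry of M and the two forms.
  refine ⟨ε, hε, hε1, fun A₀ => ⟨Real.sqrt (max (A₀ ^ 2) R * Real.exp (p * 2)), ?_⟩⟩
  intro S _ _ _ _ _ μ _ T hT F hF hA₀ hstar t ht x
  exact Real.sqrt_le_sqrt (hF.normSqA_le hcal'.comass hcal''.comass hT hp hA₀
    (fun t₀ ht₀ x₀ hmax => by
      have h := hstar t₀ (Set.Ioo_subset_Icc_self ht₀) x₀
      refine hR S T F hF t₀ ht₀ x₀ ?_ ?_
        (SurfaceMCF.starPullback_mul_pos (μ := μ) (by linarith [h.1]) (by linarith [h.2])) hmax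
      · rw [SurfaceMCF.absStar_eq_hodgeStar (μ := μ) (by linarith [h.1])]; exact h.1
      · rw [SurfaceMCF.absStar_eq_hodgeStar (μ := μ) (by linarith [h.2])]; exact h.2) ht x)
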